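/- Let $n\ge 2$, $0\le p\le n$, $r_0>0$, and let $k\in\mathbb{C}$ with $k=0$ or $k\neq 0$, $0\le\arg k<\pi$. Consider complex-valued differential $p$-forms on Euclidean space $\mathbb{R}^n$ with volume form $\mu$, pointwise Hermitian inner product $(\cdot,\cdot)$ on $p$-covectors, Hodge operator $*$, coderivative $\delta=(-1)^p*^{-1}\mathrm{d}\,*$ on $p$-forms ($\delta=0$ on $0$-forms), and Laplace–Beltrami operator $\Delta=\mathrm{d}\delta+\delta\mathrm{d}$ (so $\Delta=-\sum_i\partial_i^2$ on functions). With $r=|X-X'|$, $H^{(1)}_\nu=J_\nu+iY_\nu$ the Hankel function of the first kind and $S_n(1)$ the measure of the unit sphere of $\mathbb{R}^n$, put $$g_n(X,X')=\begin{cases}\frac{i}{4}\left(\frac{k}{2\pi r}\right)^{\frac n2-1}H^{(1)}_{\frac n2-1}(kr), & k\ne0,\\[0.5ex] \frac1{2\pi}\ln\frac{r_0}{r}, & k=0,\ n=2,\\[0.5ex] \frac{1}{(n-2)S_n(1)}\,r^{2-n}, & k=0,\ n\ge3.\end{cases}$$ Let $I_p(X,X')$ be the identity double $p$-form: its value on a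 $p$-tuple $(v_1,\dots,v_p)$ of vectors at $X'$ is the $p$-covector $(w_1,\dots,w_p)\mapsto\det(\langle v_i,w_j\rangle)$ at $X$. Let $G_p=\overline{g}_n I_p$ be the Green kernel. For a $p$-form $\omega$ and a double $p$-form $K$, let $\langle\omega,K\rangle(X')$ be the $p$-covector at $X'$ given by $(v_1,\dots,v_p)\mapsto\int_{\mathbb{R}^n}\bigl(\omega(X),K(X,X')(v_1,\dots,v_p)\bigr)\,\mu(X)$. The Green operator is $\mathcal{G}\omega=\langle\omega,G_p\rangle$, defined for the smooth $p$-forms $\omega$ for which this integral exists (as a Lebesgue integral) for every $X'$. Then: (i) Every smooth compactly supported $p$-form is in the domain of $\mathcal{G}$; and for every smooth $p$-form $\omega$ in the domain of $\mathcal{G}$, the $p$-form $\mathcal{G}\omega$ is smooth and $(\Delta-k^2)\,\mathcal{G}\omega=\omega$. That is, $\mathcal{G}$ is a right inverse of the Helmholtz operator $\Delta-k^2$. (ii) For every $X'$, $G_p(\cdot,X')$ is locally integrable, and in the sense of distributions, with the differential operator acting in the variable $X$, $$(\Delta-\overline{k}^2)\,G_p=\delta(X,X')\,I_p ,$$ where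 $\delta(X,X')$ is the Dirac distribution; i.e., $\langle(\Delta-k^2)\varphi,\,G_p\rangle(X')=\varphi(X')$ for every smooth compactly supported $p$-form $\varphi$ and every $X'$. That is, $G_p$ is a fundamental solution of the adjoint Helmholtz operator on $p$-forms. -/

import Mathlib

open scoped ContDiff ComplexConjugate
open MeasureTheory

noncomputable section

/-! ### Exterior algebra of Euclidean space -/

/-- Euclidean space `ℝⁿ`. -/
abbrev Euc (n : ℕ) : Type := EuclideanSpace ℝ (Fin n)

/-- Complex-valued `p`-covectors on `ℝⁿ`: alternating `p`-linear functions of `p` vectors. -/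
abbrev Cov (n p : ℕ) : Type := Euc n [⋀^Fin p]→L[ℝ] ℂ

/-- Complex differential `p`-forms on `ℝⁿ` (smoothness is imposed separately). -/
abbrev PForm (n p : ℕ) : Type := Euc n → Cov n p

/-- Double `p`-forms on `ℝⁿ × ℝⁿ`: `K X X'` is a `p`-covector at the observation point `X'` whose
values are `p`-covectors at the source point `X`. -/
abbrev DoubleForm (n p : ℕ) : Type := Euc n → Euc n → Euc n [⋀^Fin p]→L[ℝ] Cov n p

/-- The tuple `(e_{j_1}, …, e_{j_p})` of Cartesian basis vectors, for a multi-index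
`J = (j_1 < ⋯ < j_p)`. -/
def frame {n p : ℕ} (J : Fin p ↪o Fin n) : Fin p → Euc n :=
  fun i => EuclideanSpace.single (J i) 1

/-- The pointwise Hermitian inner product `(α, β) = ∑_J α_J conj β_J` of `p`-covectors
(sum over increasing multi-indices in Cartesian coordinates), as a real-linear map in `β`. -/
def covInner {n p : ℕ} (α : Cov n p) : Cov n p →L[ℝ] ℂ :=
  LinearMap.mkContinuous
    { toFun := fun β => ∑ J : Fin p ↪o Fin n, α (frame J) * conj (β (frame J))
      map_add' := fun β γ => by
        simp [mul_add, Finset.sum_add_distrib]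
      map_smul' := fun c β => by
        simp [Finset.mul_sum, mul_left_comm] }
    (∑ J : Fin p ↪o Fin n, ‖α (frame J)‖ * ∏ i, ‖frame J i‖)
    (fun β => by
      refine (norm_sum_le _ _).trans ?_
      rw [Finset.sum_mul]
      refine Finset.sum_le_sum fun J _ => ?_
      rw [norm_mul, RCLike.norm_conj, mul_assoc, mul_comm (∏ i, ‖frame J i‖)]
      exact mul_le_mul_of_nonneg_left (β.le_opNorm _) (norm_nonneg _))

/-- The metric (Riesz) isomorphism on simple `p`-vectors, before bundling continuity:
`g (v₁ ∧ ⋯ ∧ v_p) = g v₁ ∧ ⋯ ∧ g v_p`, i.e. `(w₁, …, w_p) ↦ det ⟨v_i, w_j⟩`. -/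
def rieszAlt (n p : ℕ) : Euc n [⋀^Fin p]→ₗ[ℝ] (Euc n [⋀^Fin p]→ₗ[ℝ] ℂ) where
  toFun v := Complex.ofRealCLM.toLinearMap.compAlternatingMap
    ((Matrix.detRowAlternating (R := ℝ) (n := Fin p)).compLinearMap
      (LinearMap.pi fun i => (innerSL ℝ (v i)).toLinearMap))
  map_update_add' {hd} v i x y := by
    obtain rfl := Subsingleton.elim hd (instDecidableEqFin p)
    ext w
    have h (z : Euc n) : (fun j i' => inner ℝ (Function.update v i z i') (w j)) =
        Matrix.updateCol (Matrix.of fun j i' => inner ℝ (v i') (w j)) i fun j => inner ℝ z (w j) := by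
      ext j i'
      by_cases hi : i' = i
      · subst hi; simp
      · simp [hi]
    have h2 := Matrix.det_updateCol_add (Matrix.of fun j i' => inner ℝ (v i') (w j)) i
      (fun j => inner ℝ x (w j)) (fun j => inner ℝ y (w j))
    have h3 : (fun j => inner ℝ (x + y) (w j)) =
      (fun j => inner ℝ x (w j)) + fun j => inner ℝ y (w j) := by ext j; simp [inner_add_left]
    rw [← h3, ← h, ← h, ← h] at h2
    exact (congrArg Complex.ofReal h2).trans (Complex.ofReal_add _ _)
  map_update_smul' {hd} v i c x := by
    obtain rfl := Subsingleton.elim hd (instDecidableEqFin p)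
    ext w
    have h (z : Euc n) : (fun j i' => inner ℝ (Function.update v i z i') (w j)) =
        Matrix.updateCol (Matrix.of fun j i' => inner ℝ (v i') (w j)) i fun j => inner ℝ z (w j) := by
      ext j i'
      by_cases hi : i' = i
      · subst hi; simp
      · simp [hi]
    have h2 := Matrix.det_updateCol_smul (Matrix.of fun j i' => inner ℝ (v i') (w j)) i c
      (fun j => inner ℝ x (w j))
    have h3 : (fun j => inner ℝ (c • x) (w j)) = c • (fun j => inner ℝ x (w j)) := by
      ext j; simp [inner_smul_left]
    rw [← h3, ← h, ← h] at h2
    refine (congrArg Complex.ofReal h2).trans ?_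
    exact (Complex.ofReal_mul _ _).trans (Complex.real_smul).symm
  map_eq_zero_of_eq' v i j hv hij := by
    ext w
    exact (congrArg Complex.ofReal
      (Matrix.det_zero_of_column_eq hij (M := fun j i' => inner ℝ (v i') (w j))
        fun k => by simp [hv])).trans Complex.ofReal_zero

theorem rieszAlt_apply {n p : ℕ} (v w : Fin p → Euc n) :
    rieszAlt n p v w = ((Matrix.of fun j i => inner ℝ (v i) (w j)).det : ℝ) := rfl

theorem norm_rieszAlt_le {n p : ℕ} (v w : Fin p → Euc n) :
    ‖rieszAlt n p v w‖ ≤ ((p.factorial : ℝ) * ∏ i, ‖v i‖) * ∏ i, ‖w i‖ := by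
  rw [rieszAlt_apply, Complex.norm_real, Matrix.det_apply]
  refine (norm_sum_le _ _).trans ?_
  have h (σ : Equiv.Perm (Fin p)) (_ : σ ∈ Finset.univ) :
      ‖Equiv.Perm.sign σ • ∏ i, (Matrix.of fun j i => inner ℝ (v i) (w j)) (σ i) i‖ ≤
        (∏ i, ‖v i‖) * ∏ i, ‖w i‖ := by
    have h1 : ‖Equiv.Perm.sign σ • ∏ i, (Matrix.of fun j i => inner ℝ (v i) (w j)) (σ i) i‖ =
        ‖∏ i, inner ℝ (v i) (w (σ i))‖ := by
      rcases Int.units_eq_one_or (Equiv.Perm.sign σ) with h | h <;> simp [h]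
    rw [h1, norm_prod, ← Equiv.prod_comp σ (fun i => ‖w i‖), ← Finset.prod_mul_distrib]
    exact Finset.prod_le_prod (fun _ _ => norm_nonneg _) fun i _ => norm_inner_le_norm _ _
  refine (Finset.sum_le_card_nsmul _ _ _ h).trans (le_of_eq ?_)
  simp [Fintype.card_perm, mul_assoc]

/-- The metric (Riesz) isomorphism `g (v₁ ∧ ⋯ ∧ v_p) : (w₁, …, w_p) ↦ det ⟨v_i, w_j⟩`. -/
def riesz (n p : ℕ) : Euc n [⋀^Fin p]→L[ℝ] Cov n p :=
  AlternatingMap.mkContinuousAlternating (rieszAlt n p) (p.factorial : ℝ) norm_rieszAlt_le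

/-- The unit volume form `μ = dx¹ ∧ ⋯ ∧ dxⁿ` with its arguments grouped as a `p`-tuple `a` and a
`q`-tuple `w`, contracted with `a`: for `p + q = n`, this is `i_{a₁ ∧ ⋯ ∧ a_p} μ`, i.e.
`w ↦ μ (a₁, …, a_p, w₁, …, w_q)`. -/
def contractVol {n p q : ℕ} (h : p + q = n) (a : Fin p → Euc n) : Cov n q where
  toFun w := (((EuclideanSpace.basisFun (Fin n) ℝ).toBasis.det
    (Fin.append a w ∘ Fin.cast h.symm) : ℝ) : ℂ)
  map_update_add' {hd} w i x y := by
    obtain rfl := Subsingleton.elim hd (instDecidableEqFin q)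
    subst h
    have e (z : Euc (p + q)) : Fin.append a (Function.update w i z) ∘ Fin.cast rfl =
        Function.update (Fin.append a w) (Fin.natAdd p i) z := by
      ext j : 1
      refine Fin.addCases (fun j => ?_) (fun j => ?_) j
      · have : Fin.castAdd q j ≠ Fin.natAdd p i := by
          intro hh
          have := congrArg Fin.val hh
          simp at this
          omega
        simp [this]
      · by_cases hj : j = i
        · subst hj; simp
        · have : Fin.natAdd p j ≠ Fin.natAdd p i := by
            simpa using hj
          simp [hj]
    rw [e, e, e, AlternatingMap.map_update_add, Complex.ofReal_add]
  map_update_smul' {hd} w i c x := by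
    obtain rfl := Subsingleton.elim hd (instDecidableEqFin q)
    subst h
    have e (z : Euc (p + q)) : Fin.append a (Function.update w i z) ∘ Fin.cast rfl =
        Function.update (Fin.append a w) (Fin.natAdd p i) z := by
      ext j : 1
      refine Fin.addCases (fun j => ?_) (fun j => ?_) j
      · have : Fin.castAdd q j ≠ Fin.natAdd p i := by
          intro hh
          have := congrArg Fin.val hh
          simp at this
          omega
        simp [this]
      · by_cases hj : j = i
        · subst hj; simp
        · have : Fin.natAdd p j ≠ Fin.natAdd p i := by
            simpa using hj
          simp [hj]
    rw [e, e, AlternatingMap.map_update_smul, smul_eq_mul, Complex.ofReal_mul, Complex.real_smul]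
  map_eq_zero_of_eq' w i j hw hij := by
    subst h
    have : (EuclideanSpace.basisFun (Fin (p + q)) ℝ).toBasis.det
        (Fin.append a w ∘ Fin.cast rfl) = 0 :=
      AlternatingMap.map_eq_zero_of_eq _ _ (i := Fin.natAdd p i) (j := Fin.natAdd p j)
        (by simpa using hw) (by simpa using hij)
    simp only [this, Complex.ofReal_zero]
  cont := by
    subst h
    refine Complex.continuous_ofReal.comp ?_
    simp only [Module.Basis.det_apply]
    refine Continuous.matrix_det (continuous_matrix fun i j => ?_)
    simp only [Module.Basis.toMatrix_apply, OrthonormalBasis.coe_toBasis_repr_apply,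
      EuclideanSpace.basisFun_repr, Function.comp_apply]
    refine Fin.addCases (fun j => ?_) (fun j => ?_) j
    · simpa using continuous_const
    · simp only [Fin.cast_eq_self, Fin.append_right]
      fun_prop

/-- The Hodge operator from `p`-covectors to `q`-covectors, `q = n - p`:
`*φ = i(g⁻¹ φ, μ)`, where `g⁻¹ φ = ∑_J φ_J e_J` in Cartesian coordinates.
(It is set to `0` if `p + q ≠ n`.) -/
def hodge {n p : ℕ} (q : ℕ) (φ : Cov n p) : Cov n q :=
  if h : p + q = n then ∑ J : Fin p ↪o Fin n, φ (frame J) • contractVol h (frame J) else 0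

/-- The inverse Hodge operator `*⁻¹ = (-1)^{pq} *`, from `q`-covectors to `p`-covectors. -/
def hodgeInv {n q : ℕ} (p : ℕ) (φ : Cov n q) : Cov n p :=
  (-1 : ℂ) ^ (p * q) • hodge p φ

/-! ### Differential operators -/

/-- The coderivative of `(p+1)`-forms, `δ η = (-1)^{p+1} *⁻¹ d * η` (the coderivative of `0`-forms
vanishes). -/
def coderiv {n p : ℕ} (η : PForm n (p + 1)) : PForm n p := fun X =>
  (-1 : ℂ) ^ (p + 1) •
    hodgeInv p (extDeriv (fun Y => hodge (n - (p + 1)) (η Y)) X)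

/-- The Laplace-Beltrami operator `Δ = dδ + δd` on `p`-forms. -/
def laplaceBeltrami {n : ℕ} : {p : ℕ} → PForm n p → PForm n p
  | 0, η => coderiv (extDeriv η)
  | _ + 1, η => extDeriv (coderiv η) + coderiv (extDeriv η)

/-- The Helmholtz operator `Δ - k²` on `p`-forms. -/
def helmholtz {n p : ℕ} (k : ℂ) (η : PForm n p) : PForm n p :=
  laplaceBeltrami η - k ^ 2 • η

/-! ### Bessel and Hankel functions -/

/-- The Bessel function of the first kind,
`J_ν(z) = ∑_m (-1)^m / (m! Γ(m+ν+1)) (z/2)^{2m+ν}` (principal branch; note that `(Γ s)⁻¹ = 0` at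
the poles of `Γ`, as it should be). -/
def besselJ (ν : ℝ) (z : ℂ) : ℂ :=
  (z / 2) ^ (ν : ℂ) *
    ∑' m : ℕ, (-1) ^ m / (m.factorial : ℂ) * (Complex.Gamma ((m : ℂ) + ν + 1))⁻¹ * (z / 2) ^ (2 * m)

/-- The Bessel function of the second kind of nonnegative integer order `m`:
`Y_m(z) = (2/π) (log(z/2) + γ) J_m(z) - (1/π) ∑_{j<m} (m-1-j)!/j! (z/2)^{2j-m}`
`- (1/π) ∑_j (-1)^j (H_j + H_{j+m}) / (j! (j+m)!) (z/2)^{2j+m}`,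
with Euler's constant `γ` and the harmonic numbers `H_j`. -/
def besselYNat (m : ℕ) (z : ℂ) : ℂ :=
  2 / Real.pi * (Complex.log (z / 2) + Real.eulerMascheroniConstant) * besselJ m z
    - 1 / Real.pi * ∑ j ∈ Finset.range m,
        ((m - 1 - j).factorial : ℂ) / (j.factorial : ℂ) * (z / 2) ^ (2 * (j : ℤ) - (m : ℤ))
    - 1 / Real.pi * ∑' j : ℕ,
        (-1) ^ j * (((harmonic j : ℚ) : ℂ) + ((harmonic (j + m) : ℚ) : ℂ)) /
          ((j.factorial : ℂ) * ((j + m).factorial : ℂ)) * (z / 2) ^ (2 * j + m)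

/-- The Bessel function of the second kind of real order `ν`:
`Y_ν = (J_ν cos νπ - J_{-ν}) / sin νπ` for non-integer `ν`, and the limit of this expression for
integer `ν`, with `Y_{-m} = (-1)^m Y_m`. -/
def besselY (ν : ℝ) (z : ℂ) : ℂ :=
  if (⌊ν⌋ : ℝ) = ν then
    (if 0 ≤ ν then 1 else (-1) ^ ⌊ν⌋.natAbs) * besselYNat ⌊ν⌋.natAbs z
  else
    (besselJ ν z * Real.cos (ν * Real.pi) - besselJ (-ν) z) / Real.sin (ν * Real.pi)

/-- The Hankel function of the first kind `H^{(1)}_ν = J_ν + i Y_ν`. -/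
def hankel1 (ν : ℝ) (z : ℂ) : ℂ :=
  besselJ ν z + Complex.I * besselY ν z

/-! ### The Green operator and the Green kernel -/

/-- The scalar fundamental solution `g_n(X, X')`, with `r = |X - X'|` and `S_n(1)` the surface
measure of the unit sphere. -/
def scalarGreen (n : ℕ) (k : ℂ) (r₀ : ℝ) (X X' : Euc n) : ℂ :=
  if k = 0 then
    if n = 2 then ((1 / (2 * Real.pi) * Real.log (r₀ / dist X X') : ℝ) : ℂ)
    else ((1 / (((n : ℝ) - 2) * ((volume : Measure (Euc n)).toSphere).real Set.univ) *
      (dist X X') ^ (2 - (n : ℤ)) : ℝ) : ℂ)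
  else
    Complex.I / 4 * (k / (2 * Real.pi * dist X X')) ^ (((n : ℝ) / 2 - 1 : ℝ) : ℂ) *
      hankel1 ((n : ℝ) / 2 - 1) (k * dist X X')

/-- The identity double `p`-form, `⟨I_p(X, X'), Γ v⟩_{X'} = (g v)_X`, where `Γ` is the parallel
transport (the identity in `ℝⁿ`). -/
def identityDouble (n p : ℕ) : DoubleForm n p := fun _ _ => riesz n p

/-- The extension `f̄ I_p` of the conjugate of a scalar kernel `f` to `p`-forms. -/
def kernelExtension {n : ℕ} (p : ℕ) (f : Euc n → Euc n → ℂ) : DoubleForm n p :=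
  fun X X' => conj (f X X') • identityDouble n p X X'

/-- The pointwise inner product of a `p`-covector `α` at `X` with the `X`-part of the value of a
double `p`-form: the `p`-covector `v ↦ (α, ⟨D, v⟩)` at `X'`. -/
def doubleInner {n p : ℕ} (α : Cov n p) (D : Euc n [⋀^Fin p]→L[ℝ] Cov n p) : Cov n p :=
  (covInner α).compContinuousAlternatingMap D

/-- The pairing `⟨η(X), K(X, X')⟩_{L²}` of a `p`-form with a double `p`-form, integrated in `X`. -/
def l2Double {n p : ℕ} (η : PForm n p) (K : DoubleForm n p) : PForm n p :=
  fun X' => ∫ X, doubleInner (η X) (K X X')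

/-- The integral defining `l2Double η K` exists at every observation point. -/
def L2DoubleExists {n p : ℕ} (η : PForm n p) (K : DoubleForm n p) : Prop :=
  ∀ X', Integrable fun X => doubleInner (η X) (K X X')

/-- The Green kernel `G_p = ḡ_n I_p`. -/
def greenKernel (n p : ℕ) (k : ℂ) (r₀ : ℝ) : DoubleForm n p :=
  kernelExtension p (scalarGreen n k r₀)

/-- The Green operator `𝒢 η (X') = ⟨η(X), G_p(X, X')⟩_{L²}`. -/
def greenOperator {n p : ℕ} (k : ℂ) (r₀ : ℝ) (η : PForm n p) : PForm n p :=
  l2Double η (greenKernel n p k r₀)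

/-- Test forms: smooth compactly supported `p`-forms. -/
def IsTestForm {n p : ℕ} (φ : PForm n p) : Prop :=
  ContDiff ℝ ∞ φ ∧ HasCompactSupport φ

/-- For a double form `K` that is locally integrable in `X`, the distribution `(Δ - κ²) K(·, X')`
acting in the source variable, paired with a test form `φ`:
`⟨φ, (Δ - κ²) K(·, X')⟩ = ⟨(Δ - κ̄²) φ, K(·, X')⟩_{L²}` (the pairing is conjugate linear in `K`, and
`Δ` is formally self-adjoint). -/
def distribHelmholtz {n p : ℕ} (κ : ℂ) (K : DoubleForm n p) (φ : PForm n p) : PForm n p :=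
  l2Double (helmholtz (conj κ) φ) K

/-- The distribution `δ(X, X') K(X, X')`, with the Dirac distribution `δ(·, X')` and a double form
`K` that is continuous in `X`, paired with a test form `φ`. -/
def diracDouble {n p : ℕ} (K : DoubleForm n p) (φ : PForm n p) : PForm n p :=
  fun X' => doubleInner (φ X') (K X' X')

end

/-!
Both parts of the theorem reduce to the scalar Helmholtz equation on `ℝⁿ`.

*Reduction to scalars.* In Cartesian coordinates `d = ∑ dxˡ ∧ ∂_l`, and Lagrange's identity
(`pair_contractVol`: contraction with the volume form is isometric) shows that conjugating `dxˡ ∧` by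
the Hodge operator gives the interior product with `e_l`, so `δ = -∑ i_l ∂_l`. Cartan's relation
`i_m ε_l + ε_l i_m = δ_{lm}` then makes the Laplace-Beltrami operator act componentwise as `-∑ ∂_l²`
(`laplaceBeltrami_eq_neg_lap`). Pairing a form with `ḡ I_p` is multiplication by `g`
(`doubleInner_riesz`). It remains to study the potential `∫ G(|Y - X|²) η(X) dX`, for `η` with values
in a Banach space and `G` the profile of the kernel as a function of `s = r²`.

*The kernel.* All that is used of `G` is `IsRadialGreen`: the radial equation
`s G'' + (n/2) G' + (k²/4) G = 0` for `s > 0` and the limit of the flux through small spheres. For the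
Hankel function both are read off from the power series of the Bessel functions: in odd dimensions
`G` is a combination of the two Frobenius solutions, and Euler's reflection formula gives the flux;
in even dimensions it is `s^{-m} ((log s + c) U - w)` with explicit entire `U` and `w`, for which the
equation is a recurrence between the coefficients (`logU_succ`, `logW_succ`).

*Fundamental solution.* Integration by parts against the kernel truncated by a cutoff in `s / δ`
leaves an integral of the test form against an approximate identity whose mass is fixed by the flux,
and a term that vanishes as `δ → 0` (`IsRadialGreen.integral_smul_helm_eq`). This is part (ii), and
it handles compactly supported densities in part (i).

*Densities without decay.* In part (i) the density is only assumed to make the integral converge at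
each point, which by itself does not allow differentiation under the integral sign. The kernel is
reproduced by a compactly supported one: if `S` is `G` smoothly cut off near the origin and
`K = (-Δ - k²) S`, a test function, then `K * S = S` and `((-Δ - k²) K) * S = 0` away from the
origin. So near a point the potential of a far density is its own convolution with `K`, hence smooth
and a solution of the homogeneous equation (`IsRadialGreen.potential_of_far`). Fubini's theorem needs
the integrals to be locally bounded in `Y`, which follows from pointwise convergence at one point
once the values of `G` at nearby large radii are comparable (`HasComparison`).

*Comparison at infinity.* It suffices that `f(r) = G(r²)` satisfies `|f'| ≤ C |f|` for large `r`. For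
`Im k > 0` this follows from invariant cones for the two exponential modes. For `k > 0` the energy
bounds `r^{(n-1)/2} |f'|` from above, and the Wronskian of `f` and its conjugate, which is a nonzero
constant because the imaginary part of the kernel is a regular solution, then bounds `|f|` from below.
-/

noncomputable section

/-! ### Exterior algebra in Cartesian coordinates -/

/-- The Cartesian basis vector `e_l`. -/
def basisVec {n : ℕ} (l : Fin n) : Euc n := EuclideanSpace.single l 1

theorem basisVec_apply {n : ℕ} (l m : Fin n) : (basisVec l : Euc n) m = if m = l then 1 else 0 := by
  simp [basisVec]

theorem inner_basisVec_left {n : ℕ} (l : Fin n) (x : Euc n) : inner ℝ (basisVec l) x = x l := by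
  simp [basisVec, EuclideanSpace.inner_single_left]

theorem sum_smul_basisVec {n : ℕ} (x : Euc n) : ∑ l, x l • basisVec l = x := by
  ext m
  simp [basisVec_apply]

theorem riesz_apply {n p : ℕ} (v w : Fin p → Euc n) :
    riesz n p v w = ((Matrix.of fun j i => inner ℝ (v i) (w j)).det : ℝ) := rfl

theorem riesz_comm {n p : ℕ} (v w : Fin p → Euc n) : riesz n p v w = riesz n p w v := by
  rw [riesz_apply, riesz_apply, ← Matrix.det_transpose]
  congr 2
  ext i j
  simp [real_inner_comm]

theorem riesz_frame_frame {n p : ℕ} (J K : Fin p ↪o Fin n) :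
    riesz n p (frame J) (frame K) = if J = K then 1 else 0 := by
  rw [riesz_apply]
  split_ifs with h
  · subst h
    have : (Matrix.of fun j i => inner ℝ (frame J i) (frame J j)) =
        (1 : Matrix (Fin p) (Fin p) ℝ) := by
      ext i j
      simp [frame, Matrix.one_apply, EuclideanSpace.inner_single_left, eq_comm]
    rw [this, Matrix.det_one, Complex.ofReal_one]
  · -- some index of `K` is missing from `J`, so the corresponding row vanishes
    obtain ⟨j, hj⟩ : ∃ j, ∀ i, J i ≠ K j := by
      by_contra! hc
      have hsub : Finset.univ.image K ⊆ Finset.univ.image J := by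
        intro x hx
        obtain ⟨j, -, rfl⟩ := Finset.mem_image.1 hx
        obtain ⟨i, hi⟩ := hc j
        exact Finset.mem_image.2 ⟨i, Finset.mem_univ _, hi⟩
      have heq := Finset.eq_of_subset_of_card_le hsub (by
        rw [Finset.card_image_of_injective _ J.injective,
          Finset.card_image_of_injective _ K.injective])
      apply h
      have hr : Set.range J = Set.range K := by
        have := congrArg (fun s : Finset (Fin n) => (s : Set (Fin n))) heq
        simpa using this.symm
      exact DFunLike.coe_injective ((StrictMono.range_inj J.strictMono K.strictMono).1 hr)
    rw [Matrix.det_eq_zero_of_row_eq_zero j, Complex.ofReal_zero]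
    intro i
    have := hj i
    simp [frame, EuclideanSpace.inner_single_left, this]

/-- An injective multi-index is an increasing one composed with a permutation. -/
theorem exists_orderEmb_comp_perm {n p : ℕ} (u : Fin p → Fin n) (hu : Function.Injective u) :
    ∃ (J : Fin p ↪o Fin n) (σ : Equiv.Perm (Fin p)), u = J ∘ σ := by
  have hc : (Finset.univ.image u).card = p := by
    rw [Finset.card_image_of_injective _ hu]; simp
  let J := (Finset.univ.image u).orderEmbOfFin hc
  have hr : ∀ i, ∃ j, J j = u i := fun i => by
    have : u i ∈ Set.range J := by
      rw [Finset.range_orderEmbOfFin]; simp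
    exact this
  choose s hs using hr
  have hinj : Function.Injective s := fun a b hab => hu (by rw [← hs, ← hs, hab])
  refine ⟨J, Equiv.ofBijective s (Finite.injective_iff_bijective.1 hinj), ?_⟩
  funext i
  exact (hs i).symm

/-- Expansion of a covector in the basis dual to the frames. -/
theorem cov_expansion {n p : ℕ} (φ : Cov n p) (v : Fin p → Euc n) :
    φ v = ∑ J : Fin p ↪o Fin n, φ (frame J) * riesz n p v (frame J) := by
  let ψ : Cov n p := ∑ J : Fin p ↪o Fin n, φ (frame J) • riesz n p (frame J)
  have hψ (v : Fin p → Euc n) :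
      ψ v = ∑ J : Fin p ↪o Fin n, φ (frame J) * riesz n p v (frame J) := by
    simp only [ψ, ContinuousAlternatingMap.sum_apply, ContinuousAlternatingMap.smul_apply,
      smul_eq_mul]
    exact Finset.sum_congr rfl fun J _ => by rw [riesz_comm]
  rw [← hψ]
  suffices h : φ.toAlternatingMap = ψ.toAlternatingMap from congrArg (fun f => f v) h
  refine Module.Basis.ext_alternating (EuclideanSpace.basisFun (Fin n) ℝ).toBasis fun u hu => ?_
  obtain ⟨J, σ, rfl⟩ := exists_orderEmb_comp_perm u hu
  have e : (fun i => (EuclideanSpace.basisFun (Fin n) ℝ).toBasis ((J ∘ σ) i)) = frame J ∘ σ := by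
    funext i; simp [frame]
  rw [e, AlternatingMap.map_perm, AlternatingMap.map_perm]
  congr 1
  change φ (frame J) = ψ (frame J)
  simp [hψ, riesz_frame_frame]

/-- The complex-bilinear pairing of covectors, `∑_J α_J β_J`. -/
def pair {n p : ℕ} (α β : Cov n p) : ℂ := ∑ J : Fin p ↪o Fin n, α (frame J) * β (frame J)

theorem pair_riesz {n p : ℕ} (φ : Cov n p) (v : Fin p → Euc n) : pair φ (riesz n p v) = φ v :=
  (cov_expansion φ v).symm

theorem riesz_pair {n p : ℕ} (φ : Cov n p) (v : Fin p → Euc n) : pair (riesz n p v) φ = φ v := by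
  rw [← pair_riesz φ v]
  exact Finset.sum_congr rfl fun J _ => mul_comm _ _

theorem doubleInner_riesz {n p : ℕ} (c : ℂ) (α : Cov n p) :
    doubleInner α (c • riesz n p) = conj c • α := by
  ext v
  change ∑ J : Fin p ↪o Fin n, α (frame J) * conj (c • riesz n p v (frame J)) = conj c * α v
  rw [cov_expansion α v, Finset.mul_sum]
  refine Finset.sum_congr rfl fun J _ => ?_
  rw [riesz_apply]
  simp
  ring

theorem eq_sum_riesz {n p : ℕ} (α : Cov n p) :
    α = ∑ J : Fin p ↪o Fin n, α (frame J) • riesz n p (frame J) := by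
  ext v
  rw [cov_expansion α v]
  simp only [ContinuousAlternatingMap.sum_apply, ContinuousAlternatingMap.smul_apply, smul_eq_mul]
  exact Finset.sum_congr rfl fun J _ => by rw [riesz_comm]

/-- The exterior product `dx^l ∧ ψ`. -/
def wedge {n p : ℕ} (l : Fin n) (ψ : Cov n p) : Cov n (p + 1) :=
  ContinuousAlternatingMap.alternatizeUncurryFin
    ((EuclideanSpace.proj l : Euc n →L[ℝ] ℝ).smulRight ψ)

theorem wedge_apply {n p : ℕ} (l : Fin n) (ψ : Cov n p) (v : Fin (p + 1) → Euc n) :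
    wedge l ψ v = ∑ i : Fin (p + 1), (-1) ^ (i : ℕ) * ((v i l : ℝ) : ℂ) * ψ (i.removeNth v) := by
  rw [wedge, ContinuousAlternatingMap.alternatizeUncurryFin_apply]
  refine Finset.sum_congr rfl fun i _ => ?_
  simp [mul_assoc]

/-- The interior product `i_{e_l} ψ`. -/
def intProd {n p : ℕ} (l : Fin n) (ψ : Cov n (p + 1)) : Cov n p := ψ.curryLeft (basisVec l)

theorem intProd_apply {n p : ℕ} (l : Fin n) (ψ : Cov n (p + 1)) (v : Fin p → Euc n) :
    intProd l ψ v = ψ (Fin.cons (basisVec l) v) := rfl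

theorem removeNth_succ_cons {α : Type*} {p : ℕ} (x : α) (v : Fin (p + 1) → α) (i : Fin (p + 1)) :
    Fin.removeNth (α := fun _ => α) i.succ (Fin.cons x v) = Fin.cons x (i.removeNth v) := by
  funext j
  refine Fin.cases ?_ (fun j => ?_) j
  · simp [Fin.removeNth]
  · simp [Fin.removeNth]

theorem intProd_wedge_zero {n : ℕ} (l m : Fin n) (ψ : Cov n 0) :
    intProd m (wedge l ψ) = if m = l then ψ else 0 := by
  ext v
  rw [intProd_apply, wedge_apply]
  have hv (w : Fin 0 → Euc n) : ψ w = ψ v := by rw [Subsingleton.elim w v]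
  split_ifs with h
  · subst h
    simp [basisVec_apply, hv]
  · simp [basisVec_apply, Ne.symm h]

/-- Cartan's anticommutation relation `i_m ε_l + ε_l i_m = δ_{lm}`. -/
theorem intProd_wedge {n p : ℕ} (l m : Fin n) (ψ : Cov n (p + 1)) :
    intProd m (wedge l ψ) + wedge l (intProd m ψ) = if m = l then ψ else 0 := by
  ext v
  rw [ContinuousAlternatingMap.add_apply, intProd_apply, wedge_apply, wedge_apply,
    Fin.sum_univ_succ]
  simp only [removeNth_succ_cons, Fin.cons_zero, Fin.cons_succ, intProd_apply, Fin.val_succ,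
    pow_succ, Fin.val_zero, pow_zero, one_mul, mul_neg, mul_one, neg_mul, Finset.sum_neg_distrib,
    neg_add_cancel_right, Fin.removeNth_zero, Fin.tail_cons]
  split_ifs with h
  · subst h; simp [basisVec_apply]
  · simp [basisVec_apply, Ne.symm h]

/-- Euler's relation: `∑_k ε_k i_k` is multiplication by the degree. -/
theorem sum_wedge_intProd {n p : ℕ} (ψ : Cov n (p + 1)) :
    ∑ k, wedge k (intProd k ψ) = ((p : ℂ) + 1) • ψ := by
  ext v
  rw [ContinuousAlternatingMap.sum_apply]
  simp only [wedge_apply, intProd_apply, ContinuousAlternatingMap.smul_apply]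
  rw [Finset.sum_comm]
  have key (i : Fin (p + 1)) :
      ∑ k, (-1 : ℂ) ^ (i : ℕ) * ((v i k : ℝ) : ℂ) * ψ (Fin.cons (basisVec k) (i.removeNth v)) = ψ v := by
    have h1 : ψ (Fin.cons (v i) (i.removeNth v)) =
        ∑ k, ((v i k : ℝ) : ℂ) * ψ (Fin.cons (basisVec k) (i.removeNth v)) := by
      have : ψ.curryLeft (v i) = ∑ k, v i k • ψ.curryLeft (basisVec k) := by
        conv_lhs => rw [← sum_smul_basisVec (v i)]
        simp
      have := congrArg (fun f : Cov n p => f (i.removeNth v)) this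
      simp only [ContinuousAlternatingMap.sum_apply] at this
      refine this.trans (Finset.sum_congr rfl fun k _ => ?_)
      exact Complex.real_smul
    have h2 := ψ.toAlternatingMap.map_insertNth i (v i) (i.removeNth v)
    rw [Fin.insertNth_self_removeNth] at h2
    have h3 : ψ v = (-1 : ℂ) ^ (i : ℕ) * ψ (Fin.cons (v i) (i.removeNth v)) := by
      refine h2.trans ?_
      rw [zsmul_eq_mul]
      push_cast
      rfl
    rw [h3, h1, Finset.mul_sum]
    exact Finset.sum_congr rfl fun k _ => by ring
  simp [key]

theorem riesz_cons {n p : ℕ} (l : Fin n) (a : Fin p → Euc n) :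
    riesz n (p + 1) (Fin.cons (basisVec l) a) = wedge l (riesz n p a) := by
  ext w
  rw [riesz_apply, Matrix.det_succ_column_zero, wedge_apply]
  push_cast
  refine Finset.sum_congr rfl fun i _ => ?_
  rw [riesz_apply]
  congr 2
  simp [inner_basisVec_left]

theorem pair_sum_left {n p : ℕ} {ι : Type*} (s : Finset ι) (f : ι → Cov n p) (β : Cov n p) :
    pair (∑ i ∈ s, f i) β = ∑ i ∈ s, pair (f i) β := by
  simp only [pair, ContinuousAlternatingMap.sum_apply, Finset.sum_mul]
  exact Finset.sum_comm

theorem pair_smul_left {n p : ℕ} (c : ℂ) (α β : Cov n p) : pair (c • α) β = c * pair α β := by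
  simp [pair, Finset.mul_sum, mul_assoc]

theorem wedge_add {n p : ℕ} (l : Fin n) (α β : Cov n p) :
    wedge l (α + β) = wedge l α + wedge l β := by
  ext v; simp [wedge_apply, mul_add, Finset.sum_add_distrib]

theorem wedge_smul {n p : ℕ} (l : Fin n) (c : ℂ) (α : Cov n p) :
    wedge l (c • α) = c • wedge l α := by
  ext v; simp only [wedge_apply, ContinuousAlternatingMap.smul_apply, smul_eq_mul, Finset.mul_sum]
  exact Finset.sum_congr rfl fun _ _ => by ring

/-- Exterior multiplication by `dx^l`, as a linear map. -/
def wedgeL {n p : ℕ} (l : Fin n) : Cov n p →ₗ[ℂ] Cov n (p + 1) where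
  toFun := wedge l
  map_add' := wedge_add l
  map_smul' := wedge_smul l

theorem wedge_sum {n p : ℕ} {ι : Type*} (l : Fin n) (s : Finset ι) (f : ι → Cov n p) :
    wedge l (∑ i ∈ s, f i) = ∑ i ∈ s, wedge l (f i) := map_sum (wedgeL l) f s

/-- Interior multiplication by `e_l`, as a linear map. -/
def intProdL {n p : ℕ} (l : Fin n) : Cov n (p + 1) →ₗ[ℂ] Cov n p where
  toFun := intProd l
  map_add' := fun _ _ => rfl
  map_smul' := fun _ _ => rfl

theorem intProd_sum {n p : ℕ} {ι : Type*} (l : Fin n) (s : Finset ι) (f : ι → Cov n (p + 1)) :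
    intProd l (∑ i ∈ s, f i) = ∑ i ∈ s, intProd l (f i) := map_sum (intProdL l) f s

/-- Exterior and interior multiplication are adjoint. -/
theorem pair_wedge {n p : ℕ} (l : Fin n) (α : Cov n p) (β : Cov n (p + 1)) :
    pair (wedge l α) β = pair α (intProd l β) := by
  rw [eq_sum_riesz α, wedge_sum, pair_sum_left, pair_sum_left]
  refine Finset.sum_congr rfl fun J _ => ?_
  rw [wedge_smul, pair_smul_left, pair_smul_left, ← riesz_cons, riesz_pair, riesz_pair,
    intProd_apply]

theorem sum_pair_intProd {n p : ℕ} (α β : Cov n (p + 1)) :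
    ∑ k, pair (intProd k α) (intProd k β) = ((p : ℂ) + 1) * pair α β := by
  simp_rw [← pair_wedge]
  rw [← pair_sum_left, sum_wedge_intProd, pair_smul_left]

/-- The interior product of `μ (a, ·)` with `e_k` is `μ (a, e_k, ·)`. -/
theorem intProd_contractVol {n p q : ℕ} (h : p + (q + 1) = n) (h' : (p + 1) + q = n)
    (a : Fin p → Euc n) (k : Fin n) :
    intProd k (contractVol h a) = contractVol h' (Fin.snoc (α := fun _ => Euc n) a (basisVec k)) := by
  ext w
  rw [intProd_apply]
  change (((EuclideanSpace.basisFun (Fin n) ℝ).toBasis.det _ : ℝ) : ℂ) =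
    (((EuclideanSpace.basisFun (Fin n) ℝ).toBasis.det _ : ℝ) : ℂ)
  rw [Fin.append_left_snoc]
  rfl

/-- The contraction `∑_k ⟨e_k ∧ a, e_k ∧ b⟩ = (n - p) ⟨a, b⟩`. -/
theorem sum_riesz_snoc {n p : ℕ} (a b : Fin p → Euc n) :
    ∑ k, riesz n (p + 1) (Fin.snoc (α := fun _ => Euc n) a (basisVec k))
        (Fin.snoc (α := fun _ => Euc n) b (basisVec k)) = ((n : ℂ) - p) * riesz n p a b := by
  have h1 (k : Fin n) : riesz n (p + 1) (Fin.snoc (α := fun _ => Euc n) a (basisVec k))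
        (Fin.snoc (α := fun _ => Euc n) b (basisVec k)) = intProd k (wedge k (riesz n p a)) b := by
    rw [intProd_apply, ← riesz_cons, riesz_apply, riesz_apply, Fin.snoc_eq_cons_rotate,
      Fin.snoc_eq_cons_rotate]
    exact congrArg _ (Matrix.det_submatrix_equiv_self (finRotate (p + 1)) (Matrix.of fun j i =>
      inner ℝ ((Fin.cons (basisVec k) a : Fin (p + 1) → Euc n) i)
        ((Fin.cons (basisVec k) b : Fin (p + 1) → Euc n) j)))
  simp_rw [h1]
  cases p with
  | zero => simp [intProd_wedge_zero]
  | succ p =>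
    have h2 (k : Fin n) : intProd k (wedge k (riesz n (p + 1) a)) b =
        riesz n (p + 1) a b - wedge k (intProd k (riesz n (p + 1) a)) b := by
      rw [eq_sub_iff_add_eq, ← ContinuousAlternatingMap.add_apply, intProd_wedge]
      simp
    simp_rw [h2]
    rw [Finset.sum_sub_distrib, ← ContinuousAlternatingMap.sum_apply (s := Finset.univ)
      (f := fun k => wedge k (intProd k (riesz n (p + 1) a))), sum_wedge_intProd]
    simp
    ring

/-- Lagrange's identity in top degree: the product of two determinants is a Gram determinant. -/
theorem contractVol_mul {n p : ℕ} (h : p + 0 = n) (a b : Fin p → Euc n) (w w' : Fin 0 → Euc n) :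
    contractVol h a w * contractVol h b w' = riesz n p a b := by
  subst h
  rw [riesz_apply]
  change ((_ : ℝ) : ℂ) * ((_ : ℝ) : ℂ) = _
  rw [← Complex.ofReal_mul, Module.Basis.det_apply, Module.Basis.det_apply]
  rw [mul_comm, ← Matrix.det_transpose, ← Matrix.det_mul]
  congr 2
  ext i j
  simp only [Matrix.mul_apply, Matrix.transpose_apply, Module.Basis.toMatrix_apply,
    OrthonormalBasis.coe_toBasis_repr_apply, EuclideanSpace.basisFun_repr, Function.comp_apply,
    Matrix.of_apply]
  rw [PiLp.inner_apply]
  refine Finset.sum_congr rfl fun k _ => ?_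
  have e (x : Fin p → Euc (p + 0)) (w : Fin 0 → Euc (p + 0)) (i : Fin p) :
      Fin.append x w (Fin.cast rfl i) = x i := Fin.append_left x w i
  simp only [RCLike.inner_apply, conj_trivial]
  rw [e, e]

/-- Lagrange's identity: contraction with the volume form is isometric. The induction on `q` replaces
both contractions by their interior products with `e_k`, summed over `k`. -/
theorem pair_contractVol {n : ℕ} (q : ℕ) : ∀ {p : ℕ} (h : p + q = n) (a b : Fin p → Euc n),
    pair (contractVol h a) (contractVol h b) = riesz n p a b := by
  induction q with
  | zero =>
    intro p h a b
    have hu : Unique (Fin 0 ↪o Fin n) :=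
      { default := ⟨⟨Fin.elim0, fun i => i.elim0⟩, fun {i} => i.elim0⟩
        uniq := fun J => by ext i; exact i.elim0 }
    rw [pair, Fintype.sum_unique]
    exact contractVol_mul h a b _ _
  | succ q ih =>
    intro p h a b
    have h' : (p + 1) + q = n := by omega
    have h1 := sum_pair_intProd (contractVol h a) (contractVol h b)
    simp_rw [intProd_contractVol h h', ih h'] at h1
    rw [sum_riesz_snoc] at h1
    have h2 : (n : ℂ) - p = q + 1 := by rw [← h]; push_cast; ring
    have h3 : (q : ℂ) + 1 ≠ 0 := by exact_mod_cast Nat.succ_ne_zero q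
    rw [h2] at h1
    exact (mul_left_cancel₀ h3 h1).symm
end

noncomputable section

/-! ### The Hodge operator and the coderivative in coordinates -/

theorem contractVol_apply {n p q : ℕ} (h : p + q = n) (a : Fin p → Euc n) (w : Fin q → Euc n) :
    contractVol h a w = (((EuclideanSpace.basisFun (Fin n) ℝ).toBasis.det
      (Fin.append a w ∘ Fin.cast h.symm) : ℝ) : ℂ) := rfl

/-- Moving the last argument of a covector to the front. -/
theorem cov_snoc {n p : ℕ} (φ : Cov n (p + 1)) (x : Euc n) (v : Fin p → Euc n) :
    φ (Fin.snoc (α := fun _ => Euc n) v x) = (-1 : ℂ) ^ p * φ (Fin.cons x v) := by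
  have h := φ.toAlternatingMap.map_perm (Fin.cons x v) (finRotate (p + 1))
  rw [sign_finRotate] at h
  rw [Fin.snoc_eq_cons_rotate]
  refine h.trans ?_
  simp [Units.smul_def, zsmul_eq_mul]

/-- Moving the first vector of `μ (x, a, w)` to the end is a cyclic permutation of all the
arguments. -/
theorem contractVol_cons {n p q : ℕ} (h : (p + 1) + q = n) (h' : p + (q + 1) = n) (x : Euc n)
    (a : Fin p → Euc n) (w : Fin q → Euc n) :
    contractVol h' a (Fin.snoc (α := fun _ => Euc n) w x) =
      (-1 : ℂ) ^ (p + q) * contractVol h (Fin.cons x a) w := by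
  obtain rfl : n = p + q + 1 := by omega
  rw [contractVol_apply, contractVol_apply, Fin.append_cons, Fin.append_snoc]
  have h1 := (EuclideanSpace.basisFun (Fin (p + q + 1)) ℝ).toBasis.det.map_perm
    (Fin.cons x (Fin.append a w)) (finRotate (p + q + 1))
  rw [sign_finRotate] at h1
  rw [Fin.snoc_eq_cons_rotate]
  refine (congrArg Complex.ofReal h1).trans ?_
  rw [Units.smul_def, zsmul_eq_mul]
  push_cast
  rfl

theorem contractVol_swap {p : ℕ} : ∀ {n q : ℕ} (h : p + q = n) (h' : q + p = n)
    (a : Fin p → Euc n) (w : Fin q → Euc n),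
    contractVol h a w = (-1 : ℂ) ^ (p * q) * contractVol h' w a := by
  induction p with
  | zero =>
    intro n q h h' a w
    rw [contractVol_apply, contractVol_apply]
    subst h'
    rw [zero_mul, pow_zero, one_mul]
    congr 2
    funext i
    rw [Subsingleton.elim a Fin.elim0]
    change Fin.append Fin.elim0 w _ = Fin.append w Fin.elim0 _
    rw [Fin.elim0_append, Fin.append_elim0]
    rfl
  | succ p ih =>
    intro n q h h' a w
    have h1 : p + (q + 1) = n := by omega
    have h2 : (q + 1) + p = n := by omega
    obtain ⟨x, b, rfl⟩ : ∃ x b, a = Fin.cons x b := ⟨a 0, Fin.tail a, (Fin.cons_self_tail a).symm⟩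
    have e1 := contractVol_cons h h1 x b w
    rw [ih h1 h2] at e1
    have e2 : contractVol h2 (Fin.snoc (α := fun _ => Euc n) w x) b =
        contractVol h' w (Fin.cons x b) := by
      rw [contractVol_apply, contractVol_apply, Fin.append_left_snoc]; rfl
    rw [e2] at e1
    have e3 : ((-1 : ℂ) ^ (p + q)) * (-1) ^ (p + q) = 1 := by
      rw [← mul_pow]; simp
    calc contractVol h (Fin.cons x b) w
        = (-1 : ℂ) ^ (p + q) * ((-1 : ℂ) ^ (p + q) * contractVol h (Fin.cons x b) w) := by
          rw [← mul_assoc, e3, one_mul]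
      _ = _ := by
          rw [← e1, ← mul_assoc, ← pow_add]
          congr 1
          rw [show p + q + p * (q + 1) = 2 * p + (p + 1) * q by ring, pow_add, pow_mul]
          simp

theorem hodge_apply {n p q : ℕ} (h : p + q = n) (φ : Cov n p) (w : Fin q → Euc n) :
    hodge q φ w = ∑ J : Fin p ↪o Fin n, φ (frame J) * contractVol h (frame J) w := by
  rw [hodge, dif_pos h]
  simp [ContinuousAlternatingMap.sum_apply]

/-- Conjugating exterior multiplication by the Hodge operator gives interior multiplication. -/
theorem hodge_wedge_hodge {n p q : ℕ} (h : (p + 1) + q = n) (l : Fin n) (φ : Cov n (p + 1)) :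
    hodge p (wedge l (hodge q φ)) = (-1 : ℂ) ^ (p * q) • intProd l φ := by
  have h' : (q + 1) + p = n := by omega
  have h'' : p + (q + 1) = n := by omega
  ext v
  rw [hodge_apply h']
  have e1 : ∑ K : Fin (q + 1) ↪o Fin n, wedge l (hodge q φ) (frame K) *
      contractVol h' (frame K) v =
      (-1 : ℂ) ^ ((q + 1) * p) * pair (wedge l (hodge q φ)) (contractVol h'' v) := by
    rw [pair, Finset.mul_sum]
    refine Finset.sum_congr rfl fun K _ => ?_
    rw [contractVol_swap h' h'']
    ring
  rw [e1, pair_wedge, intProd_contractVol h'' h]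
  have e2 : hodge q φ = ∑ J : Fin (p + 1) ↪o Fin n, φ (frame J) • contractVol h (frame J) := by
    rw [hodge, dif_pos h]
  rw [e2, pair_sum_left]
  simp_rw [pair_smul_left, pair_contractVol, riesz_comm (frame _)]
  rw [← cov_expansion, cov_snoc, ContinuousAlternatingMap.smul_apply, intProd_apply, smul_eq_mul,
    ← mul_assoc, ← pow_add]
  congr 1
  rw [show (q + 1) * p + p = 2 * p + p * q by ring, pow_add, pow_mul]
  simp

/-- The Hodge operator as a continuous linear map. -/
def hodgeCLM (n p q : ℕ) : Cov n p →L[ℝ] Cov n q :=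
  if h : p + q = n then ∑ J : Fin p ↪o Fin n,
    ((ContinuousAlternatingMap.apply ℝ (Euc n) ℂ (frame J)) : Cov n p →L[ℝ] ℂ).smulRight
      (contractVol h (frame J)) else 0

theorem hodgeCLM_apply {n p q : ℕ} (φ : Cov n p) : hodgeCLM n p q φ = hodge q φ := by
  rw [hodge, hodgeCLM]
  split_ifs with h
  · simp
  · simp

/-- Interior multiplication as a continuous linear map. -/
def intProdCLM {n p : ℕ} (l : Fin n) : Cov n (p + 1) →L[ℝ] Cov n p :=
  (ContinuousLinearMap.apply ℝ (Cov n p) (basisVec l)).comp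
    (ContinuousAlternatingMap.curryLeftLI.toContinuousLinearMap)

/-- Exterior multiplication as a continuous linear map. -/
def wedgeCLM {n p : ℕ} (l : Fin n) : Cov n p →L[ℝ] Cov n (p + 1) :=
  (ContinuousAlternatingMap.alternatizeUncurryFinCLM ℝ (Euc n) ℂ).comp
    (ContinuousLinearMap.smulRightL ℝ (Euc n) (Cov n p) (EuclideanSpace.proj l))

theorem wedgeCLM_apply {n p : ℕ} (l : Fin n) (φ : Cov n p) : wedgeCLM l φ = wedge l φ := rfl

theorem alternatizeUncurryFin_eq_sum_wedge {n p : ℕ} (A : Euc n →L[ℝ] Cov n p) :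
    ContinuousAlternatingMap.alternatizeUncurryFin A = ∑ l, wedge l (A (basisVec l)) := by
  have : A = ∑ l, (EuclideanSpace.proj l : Euc n →L[ℝ] ℝ).smulRight (A (basisVec l)) := by
    ext1 x
    conv_lhs => rw [← sum_smul_basisVec x]
    simp
  conv_lhs => rw [this]
  exact map_sum (ContinuousAlternatingMap.alternatizeUncurryFinCLM ℝ (Euc n) ℂ) _ _

/-- `d = ∑_l dx^l ∧ ∂_l`. -/
theorem extDeriv_eq_sum {n p : ℕ} (η : PForm n p) (X : Euc n) :
    extDeriv η X = ∑ l, wedge l (fderiv ℝ η X (basisVec l)) :=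
  alternatizeUncurryFin_eq_sum_wedge _

theorem cov_eq_zero_of_lt {n p : ℕ} (h : n < p) (φ : Cov n p) : φ = 0 := by
  ext v
  rw [cov_expansion]
  have : IsEmpty (Fin p ↪o Fin n) := ⟨fun J => by
    have := Fintype.card_le_of_injective J J.injective
    simp at this
    omega⟩
  simp

/-- The symbol of the coderivative. -/
theorem hodgeInv_wedge_hodge {n p : ℕ} (l : Fin n) (φ : Cov n (p + 1)) :
    (-1 : ℂ) ^ (p + 1) • hodgeInv p (wedge l (hodge (n - (p + 1)) φ)) = -intProd l φ := by
  by_cases h : p + 1 ≤ n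
  · rw [hodgeInv, hodge_wedge_hodge (by omega), smul_smul, smul_smul, ← neg_one_smul ℂ (intProd l φ)]
    congr 1
    rw [← pow_add, ← pow_add, show p + 1 + p * (n - (p + 1) + 1) + p * (n - (p + 1)) =
      2 * (p + p * (n - (p + 1))) + 1 by ring, pow_add, pow_mul]
    simp
  · -- in degrees above `n` there are no nonzero covectors
    rw [cov_eq_zero_of_lt (by omega) φ]
    have h1 : hodge (n - (p + 1)) (0 : Cov n (p + 1)) = 0 := by
      rw [← hodgeCLM_apply, map_zero]
    have h2 : intProd l (0 : Cov n (p + 1)) = 0 := (intProdL l).map_zero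
    have h3 : wedge l (0 : Cov n (n - (p + 1))) = 0 := (wedgeL l).map_zero
    have h4 : hodge p (0 : Cov n (n - (p + 1) + 1)) = 0 := by
      rw [← hodgeCLM_apply, map_zero]
    rw [h1, h2, h3, hodgeInv, h4]
    ext v
    change (-1 : ℂ) ^ (p + 1) * ((-1) ^ (p * (n - (p + 1) + 1)) * 0) = -0
    simp

/-- `δ = -∑_l i_l ∂_l`. -/
theorem coderiv_eq_sum {n p : ℕ} (η : PForm n (p + 1)) (X : Euc n)
    (hη : DifferentiableAt ℝ η X) :
    coderiv η X = -∑ l, intProd l (fderiv ℝ η X (basisVec l)) := by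
  rw [coderiv]
  have h1 : fderiv ℝ (fun Y => hodge (n - (p + 1)) (η Y)) X =
      (hodgeCLM n (p + 1) (n - (p + 1))).comp (fderiv ℝ η X) := by
    have := ((hodgeCLM n (p + 1) (n - (p + 1))).hasFDerivAt.comp X hη.hasFDerivAt).fderiv
    rw [← this]
    congr 1
    funext Y
    exact (hodgeCLM_apply _).symm
  rw [extDeriv_eq_sum, h1]
  have h2 : ∀ f : Fin n → Cov n (n - (p + 1) + 1), (-1 : ℂ) ^ (p + 1) • hodgeInv p (∑ l, f l) =
      ∑ l, (-1 : ℂ) ^ (p + 1) • hodgeInv p (f l) := fun f => by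
    simp only [hodgeInv, ← hodgeCLM_apply, map_sum, Finset.smul_sum]
  rw [h2, ← Finset.sum_neg_distrib]
  refine Finset.sum_congr rfl fun l _ => ?_
  rw [ContinuousLinearMap.comp_apply, hodgeCLM_apply, hodgeInv_wedge_hodge]

/-- The Laplacian `∑_l ∂_l²` of a vector-valued function. -/
def lap {n : ℕ} {F : Type*} [NormedAddCommGroup F] [NormedSpace ℝ F] (u : Euc n → F) (X : Euc n) :
    F := ∑ l : Fin n, fderiv ℝ (fun Y => fderiv ℝ u Y (basisVec l)) X (basisVec l)

theorem contDiff_fderiv_apply {n : ℕ} {F : Type*} [NormedAddCommGroup F] [NormedSpace ℝ F]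
    {u : Euc n → F} (hu : ContDiff ℝ ∞ u) (v : Euc n) :
    ContDiff ℝ ∞ fun Y => fderiv ℝ u Y v :=
  (hu.fderiv_right (m := ∞) (by simp)).clm_apply contDiff_const

theorem fderiv_clm_comp_apply {n : ℕ} {F G : Type*} [NormedAddCommGroup F] [NormedSpace ℝ F]
    [NormedAddCommGroup G] [NormedSpace ℝ G] (A : F →L[ℝ] G) {u : Euc n → F} {X : Euc n}
    (hu : DifferentiableAt ℝ u X) (v : Euc n) :
    fderiv ℝ (fun Y => A (u Y)) X v = A (fderiv ℝ u X v) := by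
  exact congrArg (fun B => B v) (A.hasFDerivAt.comp X hu.hasFDerivAt).fderiv

theorem fderiv_fderiv_comm {n : ℕ} {F : Type*} [NormedAddCommGroup F] [NormedSpace ℝ F]
    {u : Euc n → F} (hu : ContDiff ℝ ∞ u) (X v w : Euc n) :
    fderiv ℝ (fun Y => fderiv ℝ u Y v) X w = fderiv ℝ (fun Y => fderiv ℝ u Y w) X v := by
  have hd : DifferentiableAt ℝ (fderiv ℝ u) X :=
    (hu.fderiv_right (m := ∞) (by simp)).differentiable (by simp) X
  have e (v w : Euc n) : fderiv ℝ (fun Y => fderiv ℝ u Y v) X w = fderiv ℝ (fderiv ℝ u) X w v :=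
    fderiv_clm_comp_apply (ContinuousLinearMap.apply ℝ F v) hd w
  rw [e, e]
  exact (hu.contDiffAt.isSymmSndFDerivAt (by simpa using WithTop.coe_le_coe.2 (le_top : (2 : ℕ∞) ≤ ⊤))).eq w v

theorem fderiv_fun_sum_apply {n : ℕ} {F : Type*} [NormedAddCommGroup F] [NormedSpace ℝ F]
    {u : Fin n → Euc n → F} {X : Euc n} (hu : ∀ l, DifferentiableAt ℝ (u l) X) (v : Euc n) :
    fderiv ℝ (fun Y => ∑ l, u l Y) X v = ∑ l, fderiv ℝ (u l) X v := by
  rw [fderiv_fun_sum fun l _ => hu l, sum_apply]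

/-- On smooth forms the Laplace–Beltrami operator acts componentwise, as `-∑_l ∂_l²`. -/
theorem laplaceBeltrami_eq_neg_lap {n p : ℕ} (η : PForm n p) (hη : ContDiff ℝ ∞ η) :
    laplaceBeltrami η = -lap η := by
  have hd (l : Fin n) : Differentiable ℝ fun Y => fderiv ℝ η Y (basisVec l) :=
    (contDiff_fderiv_apply hη _).differentiable (by simp)
  have hext : extDeriv η = fun X => ∑ l, wedgeCLM l (fderiv ℝ η X (basisVec l)) := by
    funext X; rw [extDeriv_eq_sum]; rfl
  have hextd : Differentiable ℝ (extDeriv η) := by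
    rw [hext]
    exact Differentiable.fun_sum fun l _ => (wedgeCLM l).differentiable.comp (hd l)
  have hdd (X : Euc n) : coderiv (extDeriv η) X =
      -∑ m, ∑ l, intProd m (wedge l
        (fderiv ℝ (fun Y => fderiv ℝ η Y (basisVec l)) X (basisVec m))) := by
    rw [coderiv_eq_sum _ _ (hextd X)]
    congr 1
    refine Finset.sum_congr rfl fun m _ => ?_
    rw [← intProd_sum, hext,
      fderiv_fun_sum_apply (u := fun l Y => wedgeCLM l (fderiv ℝ η Y (basisVec l)))
        fun l => ((wedgeCLM l).differentiable.comp (hd l)) X]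
    congr 1
    refine Finset.sum_congr rfl fun l _ => ?_
    exact fderiv_clm_comp_apply (wedgeCLM l) (hd l X) _
  cases p with
  | zero =>
    funext X
    change coderiv (extDeriv η) X = -lap η X
    rw [hdd, lap]
    congr 1
    refine Finset.sum_congr rfl fun m _ => ?_
    simp [intProd_wedge_zero]
  | succ p =>
    have hco : coderiv η = fun X => -∑ l, intProdCLM l (fderiv ℝ η X (basisVec l)) := by
      funext X; rw [coderiv_eq_sum η X (hη.differentiable (by simp) X)]; rfl
    funext X
    change extDeriv (coderiv η) X + coderiv (extDeriv η) X = -lap η X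
    have h1 : extDeriv (coderiv η) X = -∑ m, ∑ l, wedge m (intProd l
        (fderiv ℝ (fun Y => fderiv ℝ η Y (basisVec l)) X (basisVec m))) := by
      rw [extDeriv_eq_sum, ← Finset.sum_neg_distrib]
      refine Finset.sum_congr rfl fun m _ => ?_
      rw [← wedge_sum, hco, fderiv_fun_neg, neg_apply,
        fderiv_fun_sum_apply (u := fun l Y => intProdCLM l (fderiv ℝ η Y (basisVec l)))
        fun l => ((intProdCLM l).differentiable.comp (hd l)) X]
      rw [← wedgeCLM_apply, map_neg, wedgeCLM_apply]
      congr 2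
      refine Finset.sum_congr rfl fun l _ => ?_
      exact fderiv_clm_comp_apply (intProdCLM l) (hd l X) _
    rw [h1, hdd, lap, ← neg_add]
    congr 1
    rw [Finset.sum_comm, ← Finset.sum_add_distrib]
    refine Finset.sum_congr rfl fun m _ => ?_
    rw [← Finset.sum_add_distrib]
    have : ∀ l, wedge l (intProd m (fderiv ℝ (fun Y => fderiv ℝ η Y (basisVec m)) X (basisVec l))) +
        intProd m (wedge l (fderiv ℝ (fun Y => fderiv ℝ η Y (basisVec l)) X (basisVec m))) =
        if m = l then fderiv ℝ (fun Y => fderiv ℝ η Y (basisVec l)) X (basisVec m) else 0 := by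
      intro l
      rw [fderiv_fderiv_comm hη X (basisVec m) (basisVec l)]
      exact (add_comm _ _).trans (intProd_wedge _ _ _)
    simp [this]

theorem helmholtz_eq {n p : ℕ} (k : ℂ) (η : PForm n p) (hη : ContDiff ℝ ∞ η) :
    helmholtz k η = fun X => -lap η X - k ^ 2 • η X := by
  rw [helmholtz, laplaceBeltrami_eq_neg_lap η hη]
  rfl
end

noncomputable section

/-! ### Radial functions -/

section Radial

open Filter Topology

theorem hasFDerivAt_radial {n : ℕ} {H : ℝ → ℂ} {H' : ℂ} {x : Euc n}
    (h : HasDerivAt H H' (‖x‖ ^ 2)) :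
    HasFDerivAt (fun y : Euc n => H (‖y‖ ^ 2)) ((2 • innerSL ℝ x).smulRight H') x := by
  have h1 := h.hasFDerivAt.comp x (hasStrictFDerivAt_norm_sq x).hasFDerivAt
  refine h1.congr_fderiv ?_
  ext v
  simp [mul_assoc]

theorem fderiv_radial {n : ℕ} {H : ℝ → ℂ} {H' : ℂ} {x : Euc n}
    (h : HasDerivAt H H' (‖x‖ ^ 2)) (l : Fin n) :
    fderiv ℝ (fun y : Euc n => H (‖y‖ ^ 2)) x (basisVec l) = (2 * x l) • H' := by
  rw [(hasFDerivAt_radial h).fderiv]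
  have : inner ℝ x (basisVec l) = x l := by rw [real_inner_comm, inner_basisVec_left]
  simp [this, mul_assoc]

/-- The derivatives of the components of the radial field `2 M(|x|²) x`, which is the gradient of
`H(|x|²)` if `M = H'`. -/
theorem fderiv_radialField {n : ℕ} {M : ℝ → ℂ} {M' : ℂ} {x : Euc n}
    (h : HasDerivAt M M' (‖x‖ ^ 2)) (l : Fin n) :
    fderiv ℝ (fun y : Euc n => (2 * y l) • M (‖y‖ ^ 2)) x (basisVec l) =
      (2 : ℝ) • M (‖x‖ ^ 2) + (4 * x l ^ 2) • M' := by
  have h1 : HasFDerivAt (fun y : Euc n => 2 * y l) (2 • (EuclideanSpace.proj l : Euc n →L[ℝ] ℝ)) x := by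
    have := (EuclideanSpace.proj l : Euc n →L[ℝ] ℝ).hasFDerivAt (x := x)
    refine (this.const_mul 2).congr_fderiv ?_
    ext v; simp
  have h2 := (h1.smul (hasFDerivAt_radial h)).fderiv
  rw [Pi.smul_def'] at h2
  rw [h2]
  have : inner ℝ x (basisVec l) = x l := by rw [real_inner_comm, inner_basisVec_left]
  simp [this, basisVec_apply]
  ring

theorem sum_fderiv_radialField {n : ℕ} {M : ℝ → ℂ} {M' : ℂ} {x : Euc n}
    (h : HasDerivAt M M' (‖x‖ ^ 2)) :
    ∑ l, fderiv ℝ (fun y : Euc n => (2 * y l) • M (‖y‖ ^ 2)) x (basisVec l) =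
      (2 * n : ℝ) • M (‖x‖ ^ 2) + (4 * ‖x‖ ^ 2) • M' := by
  simp_rw [fderiv_radialField h]
  have h2 : ∑ l, 4 * x l ^ 2 = 4 * ‖x‖ ^ 2 := by
    rw [← Finset.mul_sum, EuclideanSpace.real_norm_sq_eq]
  rw [Finset.sum_add_distrib, ← Finset.sum_smul, ← Finset.sum_smul, h2]
  simp [mul_comm]

theorem lap_radial {n : ℕ} {H H1 : ℝ → ℂ} {H2 : ℂ} {x : Euc n}
    (h : ∀ᶠ s in 𝓝 (‖x‖ ^ 2), HasDerivAt H (H1 s) s) (h1 : HasDerivAt H1 H2 (‖x‖ ^ 2)) :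
    lap (fun y : Euc n => H (‖y‖ ^ 2)) x = (2 * n : ℝ) • H1 (‖x‖ ^ 2) + (4 * ‖x‖ ^ 2) • H2 := by
  rw [← sum_fderiv_radialField h1, lap]
  refine Finset.sum_congr rfl fun l _ => ?_
  have hc : Tendsto (fun y : Euc n => ‖y‖ ^ 2) (𝓝 x) (𝓝 (‖x‖ ^ 2)) :=
    (continuous_norm.pow 2).continuousAt
  have : (fun Y : Euc n => fderiv ℝ (fun y : Euc n => H (‖y‖ ^ 2)) Y (basisVec l)) =ᶠ[𝓝 x]
      fun y => (2 * y l) • H1 (‖y‖ ^ 2) := by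
    filter_upwards [hc.eventually h] with y hy
    exact fderiv_radial hy l
  rw [this.fderiv_eq]

theorem contDiff_radial {n : ℕ} {H : ℝ → ℂ} (h : ContDiff ℝ ∞ H) :
    ContDiff ℝ ∞ fun y : Euc n => H (‖y‖ ^ 2) :=
  h.comp (contDiff_norm_sq ℝ)

/-- `G` is the profile of a radial fundamental solution of `-Δ - k²` as a function of `s = r²`, and
`G₁` is its derivative: the Helmholtz equation `s G'' + (n/2) G' + (k²/4) G = 0` holds for `s > 0`,
and the flux through small spheres tends to `-1`. -/
structure IsRadialGreen (n : ℕ) (k : ℂ) (G G₁ : ℝ → ℂ) : Prop where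
  hasDerivAt : ∀ s, 0 < s → HasDerivAt G (G₁ s) s
  hasDerivAt_deriv : ∀ s, 0 < s →
    HasDerivAt G₁ (-((n : ℂ) / 2 * G₁ s + k ^ 2 / 4 * G s) / s) s
  tendsto_flux : Tendsto (fun s : ℝ => s ^ ((n : ℝ) / 2) • G₁ s) (𝓝[>] 0)
    (𝓝 (-(1 / (2 * ((volume : Measure (Euc n)).toSphere).real Set.univ) : ℝ)))

namespace IsRadialGreen

variable {n : ℕ} {k : ℂ} {G G₁ : ℝ → ℂ}

theorem contDiffOn_aux (hG : IsRadialGreen n k G G₁) (m : ℕ) :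
    ContDiffOn ℝ m G (Set.Ioi 0) ∧ ContDiffOn ℝ m G₁ (Set.Ioi 0) := by
  induction m with
  | zero =>
    constructor
    · exact contDiffOn_zero.2 fun s hs => (hG.hasDerivAt s hs).continuousAt.continuousWithinAt
    · exact contDiffOn_zero.2 fun s hs => (hG.hasDerivAt_deriv s hs).continuousAt.continuousWithinAt
  | succ m ih =>
    push_cast
    rw [contDiffOn_succ_iff_deriv_of_isOpen isOpen_Ioi,
      contDiffOn_succ_iff_deriv_of_isOpen isOpen_Ioi]
    refine ⟨⟨fun s hs => (hG.hasDerivAt s hs).differentiableAt.differentiableWithinAt, by simp,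
      ih.2.congr fun s hs => (hG.hasDerivAt s hs).deriv⟩,
      fun s hs => (hG.hasDerivAt_deriv s hs).differentiableAt.differentiableWithinAt, by simp, ?_⟩
    have h1 : ContDiffOn ℝ m (fun s : ℝ => -((n : ℂ) / 2 * G₁ s + k ^ 2 / 4 * G s) / s)
        (Set.Ioi 0) := by
      simp_rw [div_eq_mul_inv]
      refine ContDiffOn.mul ((contDiffOn_const.mul ih.2).add (contDiffOn_const.mul ih.1)).neg
        (ContDiffOn.inv Complex.ofRealCLM.contDiff.contDiffOn fun s hs => ?_)
      exact Complex.ofReal_ne_zero.2 (ne_of_gt hs)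
    exact h1.congr fun s hs => (hG.hasDerivAt_deriv s hs).deriv

theorem contDiffOn (hG : IsRadialGreen n k G G₁) : ContDiffOn ℝ ∞ G (Set.Ioi 0) :=
  contDiffOn_infty.2 fun m => (hG.contDiffOn_aux m).1

theorem contDiffOn_deriv (hG : IsRadialGreen n k G G₁) : ContDiffOn ℝ ∞ G₁ (Set.Ioi 0) :=
  contDiffOn_infty.2 fun m => (hG.contDiffOn_aux m).2

end IsRadialGreen

/-- A smooth cutoff in `s = r²`, vanishing for `s ≤ δ` and equal to `1` for `s ≥ 2δ`. -/
def cutoff (δ s : ℝ) : ℝ := Real.smoothTransition (s / δ - 1)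

/-- The derivative of the cutoff. -/
def cutoffDeriv (δ s : ℝ) : ℝ := deriv Real.smoothTransition (s / δ - 1) / δ

theorem cutoff_eq_zero {δ s : ℝ} (hδ : 0 < δ) (hs : s ≤ δ) : cutoff δ s = 0 :=
  Real.smoothTransition.zero_of_nonpos (by rw [sub_nonpos, div_le_one hδ]; exact hs)

theorem cutoff_eq_one {δ s : ℝ} (hδ : 0 < δ) (hs : 2 * δ ≤ s) : cutoff δ s = 1 :=
  Real.smoothTransition.one_of_one_le (by
    rw [le_sub_iff_add_le, le_div_iff₀ hδ]; linarith)

theorem cutoff_nonneg (δ s : ℝ) : 0 ≤ cutoff δ s := Real.smoothTransition.nonneg _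

theorem cutoff_le_one (δ s : ℝ) : cutoff δ s ≤ 1 := Real.smoothTransition.le_one _

theorem contDiff_smoothTransition : ContDiff ℝ ∞ Real.smoothTransition :=
  Real.smoothTransition.contDiff

theorem contDiff_cutoff (δ : ℝ) : ContDiff ℝ ∞ (cutoff δ) :=
  contDiff_smoothTransition.comp ((contDiff_id.div_const δ).sub contDiff_const)

theorem hasDerivAt_cutoff (δ s : ℝ) : HasDerivAt (cutoff δ) (cutoffDeriv δ s) s := by
  have h1 : HasDerivAt (fun s : ℝ => s / δ - 1) (1 / δ) s :=
    ((hasDerivAt_id s).div_const δ).sub_const 1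
  have h2 := (contDiff_smoothTransition.differentiable (by simp) (s / δ - 1)).hasDerivAt
  have := h2.comp s h1
  rwa [mul_one_div] at this

theorem contDiff_cutoffDeriv (δ : ℝ) : ContDiff ℝ ∞ (cutoffDeriv δ) := by
  have h : ContDiff ℝ ∞ (deriv Real.smoothTransition) :=
    ((contDiff_infty_iff_deriv (𝕜 := ℝ)).1 contDiff_smoothTransition).2
  exact (h.comp ((contDiff_id.div_const δ).sub contDiff_const)).div_const δ

theorem cutoffDeriv_nonneg {δ : ℝ} (hδ : 0 < δ) (s : ℝ) : 0 ≤ cutoffDeriv δ s :=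
  div_nonneg (Real.smoothTransition.monotone.deriv_nonneg) hδ.le

theorem cutoffDeriv_eq_zero {δ s : ℝ} (hδ : 0 < δ) (hs : s < δ ∨ 2 * δ < s) :
    cutoffDeriv δ s = 0 := by
  rw [← (hasDerivAt_cutoff δ s).deriv]
  rcases hs with hs | hs
  · have : cutoff δ =ᶠ[𝓝 s] fun _ => 0 := by
      filter_upwards [Iio_mem_nhds hs] with t ht using cutoff_eq_zero hδ (le_of_lt ht)
    rw [this.deriv_eq, deriv_const]
  · have : cutoff δ =ᶠ[𝓝 s] fun _ => 1 := by
      filter_upwards [Ioi_mem_nhds hs] with t ht using cutoff_eq_one hδ (le_of_lt ht)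
    rw [this.deriv_eq, deriv_const]

/-- Cutting off a function that is smooth on `(0, ∞)` gives a smooth function on `ℝ`. -/
theorem contDiff_cutoff_smul {δ : ℝ} (hδ : 0 < δ) {H : ℝ → ℂ}
    (hH : ContDiffOn ℝ ∞ H (Set.Ioi 0)) : ContDiff ℝ ∞ fun s => cutoff δ s • H s := by
  rw [contDiff_iff_contDiffAt]
  intro s
  rcases lt_or_ge s δ with hs | hs
  · have : (fun s => cutoff δ s • H s) =ᶠ[𝓝 s] fun _ => 0 := by
      filter_upwards [Iio_mem_nhds hs] with t ht
      rw [cutoff_eq_zero hδ (le_of_lt ht), zero_smul]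
    exact contDiffAt_const.congr_of_eventuallyEq this
  · exact (contDiff_cutoff δ).contDiffAt.smul (hH.contDiffAt (Ioi_mem_nhds (hδ.trans_le hs)))

end Radial
end

noncomputable section

/-! ### Flux kernels and the singularity at the origin -/

section Fundamental

open Filter Topology

/-- The surface measure `S_n(1)` of the unit sphere. -/
def sphereArea (n : ℕ) : ℝ := ((volume : Measure (Euc n)).toSphere).real Set.univ

theorem sphereArea_eq (n : ℕ) :
    sphereArea n = n * (volume : Measure (Euc n)).real (Metric.ball 0 1) := by
  rw [sphereArea, Measure.toSphere_real_apply_univ, finrank_euclideanSpace_fin]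

theorem sphereArea_pos {n : ℕ} (hn : 2 ≤ n) : 0 < sphereArea n := by
  rw [sphereArea_eq]
  have : 0 < (volume : Measure (Euc n)).real (Metric.ball 0 1) :=
    ENNReal.toReal_pos (Metric.measure_ball_pos _ _ one_pos).ne' measure_ball_lt_top.ne
  positivity

/-- The radial kernel `4 ρ_δ'(s) s^{1 - n/2}`, `s = |x|²`. It has mass `2 S_n(1)`, and concentrates
at the origin as `δ → 0`. -/
def fluxKernel (n : ℕ) (δ : ℝ) (x : Euc n) : ℝ :=
  4 * cutoffDeriv δ (‖x‖ ^ 2) * (‖x‖ ^ 2) ^ (1 - (n : ℝ) / 2)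

theorem fluxKernel_nonneg {n : ℕ} {δ : ℝ} (hδ : 0 < δ) (x : Euc n) : 0 ≤ fluxKernel n δ x := by
  have := cutoffDeriv_nonneg hδ (‖x‖ ^ 2)
  unfold fluxKernel
  positivity

theorem fluxKernel_eq_zero {n : ℕ} {δ : ℝ} (hδ : 0 < δ) {x : Euc n}
    (h : ‖x‖ ^ 2 < δ ∨ 2 * δ < ‖x‖ ^ 2) : fluxKernel n δ x = 0 := by
  rw [fluxKernel, cutoffDeriv_eq_zero hδ h]; simp

/-- In polar coordinates the flux kernel is the derivative of `2 ρ_δ(r²)`. -/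
theorem fluxKernel_profile {n : ℕ} (hn : 2 ≤ n) (δ : ℝ) {r : ℝ} (hr : 0 < r) :
    r ^ (n - 1) • (4 * cutoffDeriv δ (r ^ 2) * (r ^ 2) ^ (1 - (n : ℝ) / 2)) =
      2 * (cutoffDeriv δ (r ^ 2) * (2 * r)) := by
  have h1 : (r ^ 2) ^ (1 - (n : ℝ) / 2) = r ^ (2 - (n : ℝ)) := by
    rw [← Real.rpow_natCast r 2, ← Real.rpow_mul hr.le]
    congr 1; push_cast; ring
  have h2 : r ^ (n - 1) * r ^ (2 - (n : ℝ)) = r := by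
    rw [← Real.rpow_natCast r (n - 1), ← Real.rpow_add hr, Nat.cast_sub (by omega)]
    rw [show ((n : ℝ) - (1 : ℕ) + (2 - n)) = 1 by push_cast; ring, Real.rpow_one]
  rw [h1, smul_eq_mul]
  linear_combination (4 * cutoffDeriv δ (r ^ 2)) * h2

theorem hasDerivAt_cutoff_sq (δ r : ℝ) :
    HasDerivAt (fun r => cutoff δ (r ^ 2)) (cutoffDeriv δ (r ^ 2) * (2 * r)) r := by
  have := (hasDerivAt_cutoff δ (r ^ 2)).comp r (hasDerivAt_pow 2 r)
  refine this.congr_deriv ?_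
  simp

theorem tendsto_cutoff_sq {δ : ℝ} (hδ : 0 < δ) :
    Tendsto (fun r => cutoff δ (r ^ 2)) atTop (𝓝 1) := by
  refine tendsto_const_nhds.congr' ?_
  filter_upwards [(tendsto_pow_atTop two_ne_zero).eventually_ge_atTop (2 * δ)] with r hr
  exact (cutoff_eq_one hδ hr).symm

theorem integrable_fluxKernel {n : ℕ} (hn : 2 ≤ n) {δ : ℝ} (hδ : 0 < δ) :
    Integrable (fluxKernel n δ) := by
  have : Nonempty (Fin n) := ⟨⟨0, by omega⟩⟩
  refine (integrable_fun_norm_addHaar (volume : Measure (Euc n))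
    (f := fun r => 4 * cutoffDeriv δ (r ^ 2) * (r ^ 2) ^ (1 - (n : ℝ) / 2))).2 ?_
  rw [finrank_euclideanSpace_fin]
  have h : IntegrableOn (fun r => 2 * (cutoffDeriv δ (r ^ 2) * (2 * r))) (Set.Ioi 0) :=
    (integrableOn_Ioi_deriv_of_nonneg' (fun r _ => hasDerivAt_cutoff_sq δ r)
      (fun r hr => mul_nonneg (cutoffDeriv_nonneg hδ _) (by have : 0 < r := hr; positivity))
      (tendsto_cutoff_sq hδ)).const_mul 2
  exact h.congr_fun (fun r hr => (fluxKernel_profile hn δ hr).symm) measurableSet_Ioi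

theorem integral_fluxKernel {n : ℕ} (hn : 2 ≤ n) {δ : ℝ} (hδ : 0 < δ) :
    ∫ x, fluxKernel n δ x = 2 * sphereArea n := by
  have : Nonempty (Fin n) := ⟨⟨0, by omega⟩⟩
  refine (integral_fun_norm_addHaar (volume : Measure (Euc n))
    (fun r => 4 * cutoffDeriv δ (r ^ 2) * (r ^ 2) ^ (1 - (n : ℝ) / 2))).trans ?_
  rw [finrank_euclideanSpace_fin]
  have h : ∫ r in Set.Ioi (0 : ℝ), cutoffDeriv δ (r ^ 2) * (2 * r) = 1 - cutoff δ (0 ^ 2) :=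
    integral_Ioi_of_hasDerivAt_of_nonneg' (fun r _ => hasDerivAt_cutoff_sq δ r)
      (fun r hr => mul_nonneg (cutoffDeriv_nonneg hδ _) (by have : 0 < r := hr; positivity))
      (tendsto_cutoff_sq hδ)
  rw [cutoff_eq_zero hδ (by simpa using hδ.le)] at h
  rw [setIntegral_congr_fun measurableSet_Ioi fun r hr => fluxKernel_profile hn δ hr,
    integral_const_mul, h, sphereArea_eq]
  simp
  ring

variable {F : Type*} [NormedAddCommGroup F] [NormedSpace ℝ F] [CompleteSpace F]

/-- The flux kernels act as an approximate identity of mass `2 S_n(1)`. -/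
theorem tendsto_integral_fluxKernel {n : ℕ} (hn : 2 ≤ n) {q : Euc n → F} {q₀ : F}
    (hq : Tendsto q (𝓝[≠] 0) (𝓝 q₀))
    (hi : ∀ δ, 0 < δ → Integrable fun x => fluxKernel n δ x • q x) :
    Tendsto (fun δ => ∫ x, fluxKernel n δ x • q x) (𝓝[>] 0) (𝓝 ((2 * sphereArea n) • q₀)) := by
  rw [Metric.tendsto_nhds]
  intro ε hε
  have hS := sphereArea_pos hn
  have hε' : 0 < ε / (4 * sphereArea n) := by positivity
  have h1 := (Metric.tendsto_nhds.1 hq) _ hε'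
  rw [eventually_nhdsWithin_iff, Metric.eventually_nhds_iff] at h1
  obtain ⟨r, hr, h1⟩ := h1
  have hr2 : 0 < r ^ 2 / 2 := by positivity
  filter_upwards [Ioo_mem_nhdsGT hr2] with δ hδ
  have hδ0 : 0 < δ := hδ.1
  have hK := integrable_fluxKernel hn hδ0
  have e : ∫ x, fluxKernel n δ x • q x - fluxKernel n δ x • q₀ =
      (∫ x, fluxKernel n δ x • q x) - (2 * sphereArea n) • q₀ := by
    rw [integral_sub (hi δ hδ0) (hK.smul_const q₀), integral_smul_const,
      integral_fluxKernel hn hδ0]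
  rw [dist_eq_norm, ← e]
  have h2 : ‖∫ x, fluxKernel n δ x • q x - fluxKernel n δ x • q₀‖ ≤
      ∫ x, fluxKernel n δ x * (ε / (4 * sphereArea n)) := by
    refine norm_integral_le_of_norm_le (hK.mul_const _) (Eventually.of_forall fun x => ?_)
    rw [← smul_sub, norm_smul, Real.norm_of_nonneg (fluxKernel_nonneg hδ0 x)]
    by_cases hx : ‖x‖ ^ 2 < δ ∨ 2 * δ < ‖x‖ ^ 2
    · rw [fluxKernel_eq_zero hδ0 hx]; simp
    · push Not at hx
      refine mul_le_mul_of_nonneg_left ?_ (fluxKernel_nonneg hδ0 x)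
      rw [← dist_eq_norm]
      refine (h1 ?_ ?_).le
      · rw [dist_zero_right]
        refine lt_of_pow_lt_pow_left₀ 2 hr.le (hx.2.trans_lt ?_)
        have := hδ.2
        linarith
      · rintro rfl
        simp at hx
        linarith [hx.1]
  rw [integral_mul_const, integral_fluxKernel hn hδ0] at h2
  refine h2.trans_lt ?_
  rw [show 2 * sphereArea n * (ε / (4 * sphereArea n)) = ε / 2 by field_simp; ring]
  linarith

namespace IsRadialGreen

variable {n : ℕ} {k : ℂ} {G G₁ : ℝ → ℂ}

/-- The singularity of `G` is weaker than `s^{-(n-1)/2} = r^{-(n-1)}`. -/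
theorem tendsto_rpow_smul (hn : 2 ≤ n) (hG : IsRadialGreen n k G G₁) :
    Tendsto (fun s : ℝ => s ^ (((n : ℝ) - 1) / 2) • G s) (𝓝[>] 0) (𝓝 0) := by
  have hn' : (2 : ℝ) ≤ n := by exact_mod_cast hn
  obtain ⟨C, hC⟩ := hG.tendsto_flux.norm.isBoundedUnder_le
  rw [eventually_map, eventually_nhdsWithin_iff, Metric.eventually_nhds_iff] at hC
  obtain ⟨r, hr, hC⟩ := hC
  set s₀ := r / 2 with hs₀
  have hs₀p : 0 < s₀ := by positivity
  have hb (t : ℝ) (ht : 0 < t) (ht' : t ≤ s₀) : ‖G₁ t‖ ≤ C * t ^ (-((n : ℝ) / 2)) := by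
    have h1 := @hC t (by rw [Real.dist_0_eq_abs, abs_of_pos ht]; linarith) ht
    rw [norm_smul, Real.norm_of_nonneg (by positivity)] at h1
    rw [Real.rpow_neg ht.le, ← div_eq_mul_inv, le_div_iff₀ (by positivity), mul_comm]
    exact h1
  have hC0 : 0 ≤ C := by
    have h1 := (norm_nonneg _).trans (hb s₀ hs₀p le_rfl)
    have h2 : 0 < s₀ ^ (-((n : ℝ) / 2)) := by positivity
    exact nonneg_of_mul_nonneg_left h1 h2
  -- bound `t ^ (-n/2)` by `s ^ (3/4 - n/2) t ^ (-3/4)`, and integrate over `[s, s₀]`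
  have hGb (s : ℝ) (hs : 0 < s) (hs' : s ≤ s₀) :
      ‖G s‖ ≤ ‖G s₀‖ + C * s ^ (3 / 4 - (n : ℝ) / 2) * (4 * s₀ ^ (1 / 4 : ℝ)) := by
    set D := C * s ^ (3 / 4 - (n : ℝ) / 2) with hD
    have hD0 : 0 ≤ D := by positivity
    have key : ‖G s₀ - G s‖ ≤ D * (4 * (s₀ ^ (1 / 4 : ℝ) - s ^ (1 / 4 : ℝ))) := by
      have hB (t : ℝ) (ht : 0 < t) : HasDerivAt
          (fun t : ℝ => D * (4 * (t ^ (1 / 4 : ℝ) - s ^ (1 / 4 : ℝ)))) (D * t ^ (-(3 / 4) : ℝ)) t := by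
        have h1 := (((Real.hasDerivAt_rpow_const (p := 1 / 4) (Or.inl ht.ne')).sub_const
          (s ^ (1 / 4 : ℝ))).const_mul 4).const_mul D
        refine h1.congr_deriv ?_
        rw [show (1 / 4 - 1 : ℝ) = -(3 / 4) by norm_num]
        ring
      refine image_norm_le_of_norm_deriv_right_le_deriv_boundary' (f := fun t => G t - G s)
        (f' := G₁) (a := s) (b := s₀) (B := fun t => D * (4 * (t ^ (1 / 4 : ℝ) - s ^ (1 / 4 : ℝ))))
        (B' := fun t => D * t ^ (-(3 / 4) : ℝ)) ?_ ?_ ?_ ?_ ?_ ?_ ⟨hs', le_rfl⟩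
      · exact fun t ht => ((hG.hasDerivAt t (hs.trans_le ht.1)).sub_const _).continuousAt.continuousWithinAt
      · exact fun t ht => ((hG.hasDerivAt t (hs.trans_le ht.1)).sub_const _).hasDerivWithinAt
      · simp
      · exact fun t ht => (hB t (hs.trans_le ht.1)).continuousAt.continuousWithinAt
      · exact fun t ht => (hB t (hs.trans_le ht.1)).hasDerivWithinAt
      · intro t ht
        have ht0 := hs.trans_le ht.1
        refine (hb t ht0 ht.2.le).trans ?_
        rw [hD, mul_assoc]
        refine mul_le_mul_of_nonneg_left ?_ hC0
        have e1 : t ^ (-((n : ℝ) / 2)) = t ^ (3 / 4 - (n : ℝ) / 2) * t ^ (-(3 / 4) : ℝ) := by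
          rw [← Real.rpow_add ht0]; congr 1; ring
        rw [e1]
        refine mul_le_mul_of_nonneg_right ?_ (by positivity)
        exact Real.rpow_le_rpow_of_nonpos hs ht.1 (by linarith)
    have h3 : ‖G s‖ ≤ ‖G s₀‖ + ‖G s₀ - G s‖ := by
      have := norm_sub_le (G s₀) (G s₀ - G s)
      simpa using this
    refine h3.trans (add_le_add_right (key.trans ?_) _)
    have : 0 < s ^ (1 / 4 : ℝ) := by positivity
    gcongr
    linarith
  rw [tendsto_zero_iff_norm_tendsto_zero]
  have hlim : Tendsto (fun s : ℝ => s ^ (((n : ℝ) - 1) / 2) * ‖G s₀‖ +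
      C * (4 * s₀ ^ (1 / 4 : ℝ)) * s ^ (1 / 4 : ℝ)) (𝓝[>] 0) (𝓝 0) := by
    have h0 (e : ℝ) (he : 0 < e) : Tendsto (fun s : ℝ => s ^ e) (𝓝[>] 0) (𝓝 0) := by
      have := (Real.continuousAt_rpow_const 0 e (Or.inr he.le)).tendsto
      rw [Real.zero_rpow he.ne'] at this
      exact this.mono_left nhdsWithin_le_nhds
    have := ((h0 (((n : ℝ) - 1) / 2) (by linarith)).mul_const ‖G s₀‖).add
      ((h0 (1 / 4) (by norm_num)).const_mul (C * (4 * s₀ ^ (1 / 4 : ℝ))))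
    simpa using this
  refine squeeze_zero' (Eventually.of_forall fun s => norm_nonneg _) ?_ hlim
  filter_upwards [Ioc_mem_nhdsGT hs₀p] with s hs
  have hs0 : 0 < s := hs.1
  rw [norm_smul, Real.norm_of_nonneg (by positivity)]
  refine (mul_le_mul_of_nonneg_left (hGb s hs0 hs.2) (by positivity)).trans (le_of_eq ?_)
  have e2 : s ^ (((n : ℝ) - 1) / 2) * s ^ (3 / 4 - (n : ℝ) / 2) = s ^ (1 / 4 : ℝ) := by
    rw [← Real.rpow_add hs0]; congr 1; ring
  rw [mul_add, ← e2]
  ring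

/-- The product of the cutoff `1 - ρ_1` and the singular part of the kernel is integrable. -/
theorem integrable_singular (hn : 2 ≤ n) (hG : IsRadialGreen n k G G₁) :
    Integrable fun x : Euc n => (1 - cutoff 1 (‖x‖ ^ 2)) • G (‖x‖ ^ 2) := by
  have : Nonempty (Fin n) := ⟨⟨0, by omega⟩⟩
  refine (integrable_fun_norm_addHaar (volume : Measure (Euc n))
    (f := fun r => (1 - cutoff 1 (r ^ 2)) • G (r ^ 2))).2 ?_
  rw [finrank_euclideanSpace_fin]
  set f : ℝ → ℂ := fun y => y ^ (n - 1) • (1 - cutoff 1 (y ^ 2)) • G (y ^ 2) with hf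
  have h0 : f 0 = 0 := by simp [hf, show n - 1 ≠ 0 by omega]
  have hcont : ContinuousOn f (Set.Icc 0 2) := by
    intro y hy
    rcases eq_or_lt_of_le hy.1 with rfl | hy0
    · rw [ContinuousWithinAt, h0]
      have h1 : Tendsto f (𝓝[>] 0) (𝓝 0) := by
        have hsq : Tendsto (fun y : ℝ => y ^ 2) (𝓝[>] 0) (𝓝[>] 0) := by
          refine tendsto_nhdsWithin_iff.2 ⟨?_, ?_⟩
          · have : Tendsto (fun y : ℝ => y ^ 2) (𝓝 0) (𝓝 (0 ^ 2)) := (continuous_pow 2).tendsto 0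
            simpa using this.mono_left nhdsWithin_le_nhds
          · filter_upwards [self_mem_nhdsWithin] with y hy
            exact pow_pos (show 0 < y from hy) 2
        have h2 := (hG.tendsto_rpow_smul hn).comp hsq
        have h3 : Tendsto (fun y : ℝ => 1 - cutoff 1 (y ^ 2)) (𝓝[>] 0) (𝓝 (1 - cutoff 1 (0 ^ 2))) :=
          ((continuous_const.sub ((contDiff_cutoff 1).continuous.comp (continuous_pow 2))).tendsto
            0).mono_left nhdsWithin_le_nhds
        have h4 := h3.smul h2
        rw [smul_zero] at h4
        refine h4.congr' ?_
        filter_upwards [self_mem_nhdsWithin] with y hy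
        have hy0 : 0 < y := hy
        have e1 : (y ^ 2) ^ (((n : ℝ) - 1) / 2) = y ^ (n - 1) := by
          rw [← Real.rpow_natCast y 2, ← Real.rpow_mul hy0.le, ← Real.rpow_natCast y (n - 1),
            Nat.cast_sub (by omega)]
          congr 1; push_cast; ring
        simp only [Function.comp_apply, hf]
        rw [e1, smul_comm]
      have h5 : 𝓝[Set.Icc 0 2] (0 : ℝ) ≤ pure 0 ⊔ 𝓝[>] 0 := by
        rw [← nhdsWithin_singleton, ← nhdsWithin_union]
        refine nhdsWithin_mono _ fun y hy => ?_
        rcases eq_or_lt_of_le hy.1 with h | h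
        · left; exact h.symm
        · right; exact h
      refine Tendsto.mono_left ?_ h5
      exact Tendsto.sup (by rw [tendsto_pure_left]; intro s hs; rw [h0]; exact mem_of_mem_nhds hs) h1
    · have h1 : ContinuousAt G (y ^ 2) := (hG.hasDerivAt _ (by positivity)).continuousAt
      have h2 : ContinuousAt (fun y : ℝ => G (y ^ 2)) y :=
        ContinuousAt.comp (f := fun y : ℝ => y ^ 2) h1 (continuous_pow 2).continuousAt
      exact ((continuous_pow (n - 1)).continuousAt.smul
        ((continuous_const.sub ((contDiff_cutoff 1).continuous.comp (continuous_pow 2))).continuousAt.smul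
          h2)).continuousWithinAt
  have h1 : IntegrableOn f (Set.Icc 0 2) := hcont.integrableOn_Icc
  refine (h1.of_forall_sdiff_eq_zero measurableSet_Ioi fun y hy => ?_)
  have hy0 : 0 < y := hy.1
  have hy2 : 2 < y := by
    by_contra! h
    exact hy.2 ⟨hy0.le, h⟩
  rw [hf]
  simp only
  rw [cutoff_eq_one one_pos (by nlinarith)]
  simp

/-- The regular part `ρ_δ(|x|²) G(|x|²)` of the kernel. -/
theorem contDiff_regular (hG : IsRadialGreen n k G G₁) {δ : ℝ} (hδ : 0 < δ) :
    ContDiff ℝ ∞ fun x : Euc n => cutoff δ (‖x‖ ^ 2) • G (‖x‖ ^ 2) :=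
  contDiff_radial (contDiff_cutoff_smul hδ hG.contDiffOn)

theorem locallyIntegrable (hn : 2 ≤ n) (hG : IsRadialGreen n k G G₁) :
    LocallyIntegrable fun x : Euc n => G (‖x‖ ^ 2) := by
  have h1 := (hG.integrable_singular hn).locallyIntegrable
  have h2 : LocallyIntegrable fun x : Euc n => cutoff 1 (‖x‖ ^ 2) • G (‖x‖ ^ 2) :=
    (hG.contDiff_regular one_pos).continuous.locallyIntegrable
  refine (h1.add h2).congr (Eventually.of_forall fun x => ?_)
  change (1 - cutoff 1 (‖x‖ ^ 2)) • G (‖x‖ ^ 2) + cutoff 1 (‖x‖ ^ 2) • G (‖x‖ ^ 2) = _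
  rw [← add_smul]
  simp

end IsRadialGreen

end Fundamental
end

noncomputable section

/-! ### The fundamental solution property -/

section Green

open Filter Topology

section RealSpace

variable {n : ℕ} {F : Type*} [NormedAddCommGroup F] [NormedSpace ℝ F]

theorem hasCompactSupport_fderiv_apply {u : Euc n → F} (hu : HasCompactSupport u) (v : Euc n) :
    HasCompactSupport fun x => fderiv ℝ u x v :=
  hu.fderiv_apply ℝ v

theorem contDiff_lap {u : Euc n → F} (hu : ContDiff ℝ ∞ u) : ContDiff ℝ ∞ (lap u) :=
  ContDiff.sum fun _ _ => contDiff_fderiv_apply (contDiff_fderiv_apply hu _) _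

theorem hasCompactSupport_lap {u : Euc n → F} (hu : HasCompactSupport u) :
    HasCompactSupport (lap u) := by
  refine HasCompactSupport.intro hu fun x hx => ?_
  refine Finset.sum_eq_zero fun l _ => ?_
  have h : u =ᶠ[𝓝 x] 0 := notMem_tsupport_iff_eventuallyEq.1 hx
  have h1 : (fun Y => fderiv ℝ u Y (basisVec l)) =ᶠ[𝓝 x] fun _ => 0 := by
    filter_upwards [h.eventuallyEq_nhds] with y hy
    rw [hy.fderiv_eq]; simp
  rw [h1.fderiv_eq]
  simp

theorem lap_congr {u v : Euc n → F} {x : Euc n} (h : u =ᶠ[𝓝 x] v) : lap u x = lap v x := by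
  refine Finset.sum_congr rfl fun l _ => ?_
  have h1 : (fun Y => fderiv ℝ u Y (basisVec l)) =ᶠ[𝓝 x] fun Y => fderiv ℝ v Y (basisVec l) := by
    filter_upwards [h.eventuallyEq_nhds] with y hy
    rw [hy.fderiv_eq]
  rw [h1.fderiv_eq]

end RealSpace

variable {n : ℕ} {F : Type*} [NormedAddCommGroup F] [NormedSpace ℂ F]

theorem integrable_smul_of_hasCompactSupport {u : Euc n → ℂ} {φ : Euc n → F}
    (hu : Continuous u) (hφ : Continuous φ) (hc : HasCompactSupport φ) :
    Integrable fun x => u x • φ x :=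
  (hu.smul hφ).integrable_of_hasCompactSupport hc.smul_left

variable [NormedSpace ℝ F] [IsScalarTower ℝ ℂ F]

/-- Integration by parts against a test function. -/
theorem integral_smul_fderiv {u : Euc n → ℂ} {φ : Euc n → F} (hu : ContDiff ℝ ∞ u)
    (hφ : ContDiff ℝ ∞ φ) (hc : HasCompactSupport φ) (v : Euc n) :
    ∫ x, u x • fderiv ℝ φ x v = -∫ x, fderiv ℝ u x v • φ x :=
  integral_smul_fderiv_eq_neg_fderiv_smul_of_integrable
    (integrable_smul_of_hasCompactSupport (contDiff_fderiv_apply hu v).continuous hφ.continuous hc)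
    (integrable_smul_of_hasCompactSupport hu.continuous (contDiff_fderiv_apply hφ v).continuous
      (hasCompactSupport_fderiv_apply hc v))
    (integrable_smul_of_hasCompactSupport hu.continuous hφ.continuous hc)
    (fun x _ => hu.differentiable (by simp) x) (fun x _ => hφ.differentiable (by simp) x)

theorem integral_smul_lap_eq_sum {u : Euc n → ℂ} {φ : Euc n → F} (hu : ContDiff ℝ ∞ u)
    (hφ : ContDiff ℝ ∞ φ) (hc : HasCompactSupport φ) :
    ∫ x, u x • lap φ x =
      -∑ l, ∫ x, fderiv ℝ u x (basisVec l) • fderiv ℝ φ x (basisVec l) := by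
  simp only [lap, Finset.smul_sum]
  rw [integral_finsetSum, ← Finset.sum_neg_distrib]
  · exact Finset.sum_congr rfl fun l _ => integral_smul_fderiv hu (contDiff_fderiv_apply hφ _)
      (hasCompactSupport_fderiv_apply hc _) _
  · exact fun l _ => integrable_smul_of_hasCompactSupport hu.continuous
      (contDiff_fderiv_apply (contDiff_fderiv_apply hφ _) _).continuous
      (hasCompactSupport_fderiv_apply (hasCompactSupport_fderiv_apply hc _) _)

/-- Green's second identity for a test function. -/
theorem integral_smul_lap {u : Euc n → ℂ} {φ : Euc n → F} (hu : ContDiff ℝ ∞ u)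
    (hφ : ContDiff ℝ ∞ φ) (hc : HasCompactSupport φ) :
    ∫ x, u x • lap φ x = ∫ x, lap u x • φ x := by
  rw [integral_smul_lap_eq_sum hu hφ hc]
  simp only [lap, Finset.sum_smul]
  rw [integral_finsetSum, ← Finset.sum_neg_distrib]
  · refine Finset.sum_congr rfl fun l _ => ?_
    rw [integral_smul_fderiv (contDiff_fderiv_apply hu _) hφ hc, neg_neg]
  · exact fun l _ => integrable_smul_of_hasCompactSupport
      (contDiff_fderiv_apply (contDiff_fderiv_apply hu _) _).continuous hφ.continuous hc

theorem hasDerivAt_cutoff_smul {δ : ℝ} (hδ : 0 < δ) {H H' : ℝ → ℂ}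
    (hH : ∀ s, 0 < s → HasDerivAt H (H' s) s) (s : ℝ) :
    HasDerivAt (fun s => cutoff δ s • H s) (cutoffDeriv δ s • H s + cutoff δ s • H' s) s := by
  rcases lt_or_ge s δ with hs | hs
  · have h1 : (fun s => cutoff δ s • H s) =ᶠ[𝓝 s] fun _ => 0 := by
      filter_upwards [Iio_mem_nhds hs] with t ht
      rw [cutoff_eq_zero hδ (le_of_lt ht), zero_smul]
    rw [cutoff_eq_zero hδ hs.le, cutoffDeriv_eq_zero hδ (Or.inl hs), zero_smul, zero_smul, add_zero]
    exact (hasDerivAt_const s 0).congr_of_eventuallyEq h1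
  · rw [add_comm]
    exact (hasDerivAt_cutoff δ s).smul (hH s (hδ.trans_le hs))

theorem contDiff_cutoffDeriv_smul {δ : ℝ} (hδ : 0 < δ) {H : ℝ → ℂ}
    (hH : ContDiffOn ℝ ∞ H (Set.Ioi 0)) : ContDiff ℝ ∞ fun s => cutoffDeriv δ s • H s := by
  rw [contDiff_iff_contDiffAt]
  intro s
  rcases lt_or_ge s δ with hs | hs
  · have : (fun s => cutoffDeriv δ s • H s) =ᶠ[𝓝 s] fun _ => 0 := by
      filter_upwards [Iio_mem_nhds hs] with t ht
      rw [cutoffDeriv_eq_zero hδ (Or.inl ht), zero_smul]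
    exact contDiffAt_const.congr_of_eventuallyEq this
  · exact (contDiff_cutoffDeriv δ).contDiffAt.smul (hH.contDiffAt (Ioi_mem_nhds (hδ.trans_le hs)))

end Green

section Helm

variable {n : ℕ} {F : Type*} [NormedAddCommGroup F] [NormedSpace ℂ F] [NormedSpace ℝ F]

/-- The Helmholtz operator `-Δ - k²` acting componentwise. -/
def helm (k : ℂ) (u : Euc n → F) (x : Euc n) : F := -lap u x - k ^ 2 • u x

theorem hasCompactSupport_helm (k : ℂ) {u : Euc n → F} (hu : HasCompactSupport u) :
    HasCompactSupport (helm k u) := by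
  have h1 : HasCompactSupport fun x => k ^ 2 • u x := by
    exact hu.smul_left (f := fun _ => k ^ 2)
  have h2 : HasCompactSupport fun x => -lap u x := (hasCompactSupport_lap hu).neg
  exact h2.sub h1

open Topology in
theorem helm_congr (k : ℂ) {u v : Euc n → F} {x : Euc n} (h : u =ᶠ[𝓝 x] v) :
    helm k u x = helm k v x := by
  rw [helm, helm, lap_congr h, h.eq_of_nhds]

end Helm

section Green

open Filter Topology

variable {n : ℕ} {F : Type*} [NormedAddCommGroup F] [NormedSpace ℂ F] [NormedSpace ℝ F]
  [IsScalarTower ℝ ℂ F]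

theorem contDiff_helm (k : ℂ) {u : Euc n → F} (hu : ContDiff ℝ ∞ u) : ContDiff ℝ ∞ (helm k u) :=
  (contDiff_lap hu).neg.sub (contDiff_const.smul hu)

theorem integral_smul_helm (k : ℂ) {u : Euc n → ℂ} {φ : Euc n → F} (hu : ContDiff ℝ ∞ u)
    (hφ : ContDiff ℝ ∞ φ) (hc : HasCompactSupport φ) :
    ∫ x, u x • helm k φ x = ∫ x, helm k u x • φ x := by
  simp only [helm, smul_sub, smul_neg, sub_smul, neg_smul]
  rw [integral_sub, integral_sub, integral_neg, integral_neg, integral_smul_lap hu hφ hc]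
  · simp only [smul_smul, smul_eq_mul, mul_comm]
  · exact (integrable_smul_of_hasCompactSupport (contDiff_lap hu).continuous hφ.continuous hc).neg
  · simp only [smul_eq_mul]
    exact integrable_smul_of_hasCompactSupport (continuous_const.mul hu.continuous) hφ.continuous hc
  · exact (integrable_smul_of_hasCompactSupport hu.continuous (contDiff_lap hφ).continuous
      (hasCompactSupport_lap hc)).neg
  · simp only [smul_smul]
    exact integrable_smul_of_hasCompactSupport (hu.continuous.mul continuous_const) hφ.continuous hc

namespace IsRadialGreen

variable {k : ℂ} {G G₁ : ℝ → ℂ}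

/-- Integrating by parts with the truncated kernel leaves two terms supported in the region where
the truncation acts. -/
theorem integral_cutoff_smul_helm (hG : IsRadialGreen n k G G₁) {δ : ℝ} (hδ : 0 < δ)
    {φ : Euc n → F} (hφ : ContDiff ℝ ∞ φ) (hc : HasCompactSupport φ) :
    ∫ x, (cutoff δ (‖x‖ ^ 2) • G (‖x‖ ^ 2)) • helm k φ x =
      (∑ l, ∫ x : Euc n, ((2 * x l) • cutoffDeriv δ (‖x‖ ^ 2) • G (‖x‖ ^ 2)) •
        fderiv ℝ φ x (basisVec l)) -
      ∫ x : Euc n, ((4 * ‖x‖ ^ 2) • cutoffDeriv δ (‖x‖ ^ 2) • G₁ (‖x‖ ^ 2)) • φ x := by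
  set S : Euc n → ℂ := fun x => cutoff δ (‖x‖ ^ 2) • G (‖x‖ ^ 2) with hS
  set M : ℝ → ℂ := fun s => cutoff δ s • G₁ s with hM
  have hSc : ContDiff ℝ ∞ S := hG.contDiff_regular hδ
  have hMc : ContDiff ℝ ∞ M := contDiff_cutoff_smul hδ hG.contDiffOn_deriv
  have hcoord (l : Fin n) : ContDiff ℝ ∞ fun x : Euc n => 2 * x l :=
    contDiff_const.mul (EuclideanSpace.proj l : Euc n →L[ℝ] ℝ).contDiff
  have hW (l : Fin n) : ContDiff ℝ ∞ fun x : Euc n => (2 * x l) • M (‖x‖ ^ 2) :=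
    (hcoord l).smul (contDiff_radial hMc)
  have hV (l : Fin n) : ContDiff ℝ ∞ fun x : Euc n =>
      (2 * x l) • cutoffDeriv δ (‖x‖ ^ 2) • G (‖x‖ ^ 2) :=
    (hcoord l).smul (contDiff_radial (contDiff_cutoffDeriv_smul hδ hG.contDiffOn))
  have hdS (x : Euc n) (l : Fin n) : fderiv ℝ S x (basisVec l) =
      (2 * x l) • cutoffDeriv δ (‖x‖ ^ 2) • G (‖x‖ ^ 2) + (2 * x l) • M (‖x‖ ^ 2) := by
    rw [← smul_add]
    exact fderiv_radial (hasDerivAt_cutoff_smul hδ hG.hasDerivAt _) l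
  have hlap : ∫ x, S x • lap φ x =
      -(∑ l, ∫ x : Euc n, ((2 * x l) • cutoffDeriv δ (‖x‖ ^ 2) • G (‖x‖ ^ 2)) •
        fderiv ℝ φ x (basisVec l)) +
      ∫ x, (∑ l, fderiv ℝ (fun x : Euc n => (2 * x l) • M (‖x‖ ^ 2)) x (basisVec l)) • φ x := by
    rw [integral_smul_lap_eq_sum hSc hφ hc]
    simp_rw [hdS, add_smul, Finset.sum_smul]
    have h1 (l : Fin n) := integrable_smul_of_hasCompactSupport (hV l).continuous
      (contDiff_fderiv_apply hφ (basisVec l)).continuous (hasCompactSupport_fderiv_apply hc _)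
    have h2 (l : Fin n) := integrable_smul_of_hasCompactSupport (hW l).continuous
      (contDiff_fderiv_apply hφ (basisVec l)).continuous (hasCompactSupport_fderiv_apply hc _)
    rw [Finset.sum_congr rfl fun l _ => integral_add (h1 l) (h2 l), Finset.sum_add_distrib, neg_add,
      integral_finsetSum]
    · congr 1
      rw [← Finset.sum_neg_distrib]
      refine Finset.sum_congr rfl fun l _ => ?_
      rw [integral_smul_fderiv (hW l) hφ hc, neg_neg]
    · exact fun l _ => integrable_smul_of_hasCompactSupport
        (contDiff_fderiv_apply (hW l) _).continuous hφ.continuous hc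
  have hdiv (x : Euc n) :
      ∑ l, fderiv ℝ (fun x : Euc n => (2 * x l) • M (‖x‖ ^ 2)) x (basisVec l) =
      (4 * ‖x‖ ^ 2) • cutoffDeriv δ (‖x‖ ^ 2) • G₁ (‖x‖ ^ 2) - k ^ 2 * S x := by
    rw [sum_fderiv_radialField (hasDerivAt_cutoff_smul hδ hG.hasDerivAt_deriv _)]
    rcases eq_or_ne x 0 with rfl | hx
    · simp [hS, cutoff_eq_zero hδ hδ.le]
    · have : (‖x‖ : ℂ) ≠ 0 := by simpa using hx
      simp only [hS, Complex.real_smul]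
      push_cast
      field_simp
      ring
  have hE : Integrable fun x : Euc n => ((4 * ‖x‖ ^ 2) • cutoffDeriv δ (‖x‖ ^ 2) •
      G₁ (‖x‖ ^ 2)) • φ x := by
    refine integrable_smul_of_hasCompactSupport ?_ hφ.continuous hc
    exact (continuous_const.mul (continuous_norm.pow 2)).smul
      (contDiff_radial (contDiff_cutoffDeriv_smul hδ hG.contDiffOn_deriv)).continuous
  have hSφ : Integrable fun x => (k ^ 2 * S x) • φ x :=
    integrable_smul_of_hasCompactSupport (continuous_const.mul hSc.continuous) hφ.continuous hc
  simp_rw [hdiv, sub_smul] at hlap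
  rw [integral_sub hE hSφ] at hlap
  have hsplit : ∫ x, S x • helm k φ x = -(∫ x, S x • lap φ x) - ∫ x, (k ^ 2 * S x) • φ x := by
    simp only [helm, smul_sub, smul_neg]
    rw [integral_sub, integral_neg]
    · simp only [smul_smul, mul_comm]
    · exact (integrable_smul_of_hasCompactSupport hSc.continuous (contDiff_lap hφ).continuous
        (hasCompactSupport_lap hc)).neg
    · simp only [smul_smul, mul_comm (S _)]
      exact hSφ
  rw [hsplit, hlap]
  abel

variable [CompleteSpace F]

/-- `(-Δ - k²) G(|x|²)` is the Dirac distribution at the origin. -/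
theorem integral_smul_helm_eq (hn : 2 ≤ n) (hG : IsRadialGreen n k G G₁)
    {φ : Euc n → F} (hφ : ContDiff ℝ ∞ φ) (hc : HasCompactSupport φ) :
    ∫ x : Euc n, G (‖x‖ ^ 2) • helm k φ x = φ 0 := by
  have hn' : (2 : ℝ) ≤ n := by exact_mod_cast hn
  have hloc : Integrable fun x : Euc n => G (‖x‖ ^ 2) • helm k φ x :=
    (hG.locallyIntegrable hn).integrable_smul_right_of_hasCompactSupport
      (contDiff_helm k hφ).continuous (hasCompactSupport_helm k hc)
  -- removing the truncation
  have hL : Tendsto (fun δ => ∫ x : Euc n, (cutoff δ (‖x‖ ^ 2) • G (‖x‖ ^ 2)) • helm k φ x)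
      (𝓝[>] 0) (𝓝 (∫ x : Euc n, G (‖x‖ ^ 2) • helm k φ x)) := by
    refine tendsto_integral_filter_of_dominated_convergence
      (fun x => ‖G (‖x‖ ^ 2) • helm k φ x‖) ?_ ?_ hloc.norm ?_
    · filter_upwards [self_mem_nhdsWithin] with δ hδ
      exact ((hG.contDiff_regular hδ).continuous.smul
        (contDiff_helm k hφ).continuous).aestronglyMeasurable
    · refine Eventually.of_forall fun δ => Eventually.of_forall fun x => ?_
      rw [smul_assoc, norm_smul, Real.norm_of_nonneg (cutoff_nonneg _ _)]
      exact mul_le_of_le_one_left (norm_nonneg _) (cutoff_le_one _ _)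
    · have h0 : ∀ᵐ x : Euc n, x ≠ 0 := by
        have : Nonempty (Fin n) := ⟨⟨0, by omega⟩⟩
        exact compl_mem_ae_iff.2 (measure_singleton 0)
      filter_upwards [h0] with x hx
      refine tendsto_const_nhds.congr' ?_
      have : 0 < ‖x‖ ^ 2 / 2 := by have := norm_pos_iff.2 hx; positivity
      filter_upwards [Ioo_mem_nhdsGT this] with δ hδ
      rw [cutoff_eq_one hδ.1 (by linarith [hδ.2]), one_smul]
  refine tendsto_nhds_unique hL ?_
  have hsq : Tendsto (fun x : Euc n => ‖x‖ ^ 2) (𝓝[≠] 0) (𝓝[>] 0) := by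
    refine tendsto_nhdsWithin_iff.2 ⟨?_, ?_⟩
    · have : Tendsto (fun x : Euc n => ‖x‖ ^ 2) (𝓝 0) (𝓝 (‖(0 : Euc n)‖ ^ 2)) :=
        (continuous_norm.pow 2).tendsto 0
      rw [norm_zero, zero_pow two_ne_zero] at this
      exact this.mono_left nhdsWithin_le_nhds
    · filter_upwards [self_mem_nhdsWithin] with x hx
      exact pow_pos (norm_pos_iff.2 hx) 2
  -- the term with the derivative of `G` tends to the value of `φ`
  have hT2 : Tendsto (fun δ => ∫ x : Euc n, ((4 * ‖x‖ ^ 2) • cutoffDeriv δ (‖x‖ ^ 2) •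
      G₁ (‖x‖ ^ 2)) • φ x) (𝓝[>] 0) (𝓝 (-φ 0)) := by
    have hq : Tendsto (fun x : Euc n => ((‖x‖ ^ 2) ^ ((n : ℝ) / 2) • G₁ (‖x‖ ^ 2)) • φ x) (𝓝[≠] 0)
        (𝓝 ((-((1 / (2 * sphereArea n) : ℝ) : ℂ)) • φ 0)) := by
      have h1 := hG.tendsto_flux.comp hsq
      have h2 : Tendsto φ (𝓝[≠] 0) (𝓝 (φ 0)) := hφ.continuous.continuousAt.mono_left nhdsWithin_le_nhds
      have := h1.smul h2
      exact this
    have he (δ : ℝ) (hδ : 0 < δ) (x : Euc n) :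
        ((4 * ‖x‖ ^ 2) • cutoffDeriv δ (‖x‖ ^ 2) • G₁ (‖x‖ ^ 2)) • φ x =
        fluxKernel n δ x • ((‖x‖ ^ 2) ^ ((n : ℝ) / 2) • G₁ (‖x‖ ^ 2)) • φ x := by
      rcases eq_or_ne x 0 with rfl | hx
      · rw [fluxKernel_eq_zero hδ (Or.inl (by simpa using hδ))]
        simp
      · have hs : 0 < ‖x‖ ^ 2 := pow_pos (norm_pos_iff.2 hx) 2
        have e1 : (‖x‖ ^ 2) ^ (1 - (n : ℝ) / 2) * (‖x‖ ^ 2) ^ ((n : ℝ) / 2) = ‖x‖ ^ 2 := by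
          rw [← Real.rpow_add hs, sub_add_cancel, Real.rpow_one]
        rw [smul_assoc, smul_assoc, smul_assoc, smul_smul, smul_smul, fluxKernel]
        congr 1
        linear_combination (-4 * cutoffDeriv δ (‖x‖ ^ 2)) * e1
    have := tendsto_integral_fluxKernel hn hq fun δ hδ => by
      simp_rw [← he δ hδ]
      refine integrable_smul_of_hasCompactSupport ?_ hφ.continuous hc
      exact (continuous_const.mul (continuous_norm.pow 2)).smul
        (contDiff_radial (contDiff_cutoffDeriv_smul hδ hG.contDiffOn_deriv)).continuous
    have e2 : (2 * sphereArea n) • (-((1 / (2 * sphereArea n) : ℝ) : ℂ)) • φ 0 = -φ 0 := by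
      have := (sphereArea_pos hn).ne'
      have e3 : ((1 / (2 * sphereArea n) : ℝ) : ℂ) • φ 0 = (1 / (2 * sphereArea n)) • φ 0 :=
        algebraMap_smul ℂ (1 / (2 * sphereArea n)) (φ 0)
      rw [neg_smul, e3, smul_neg, smul_smul, mul_one_div_cancel (by positivity), one_smul]
    rw [e2] at this
    refine this.congr' ?_
    filter_upwards [self_mem_nhdsWithin] with δ hδ
    simp_rw [← he δ hδ]
  -- the term with `G` itself tends to zero
  have hT1 : Tendsto (fun δ => ∑ l, ∫ x : Euc n, ((2 * x l) • cutoffDeriv δ (‖x‖ ^ 2) •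
      G (‖x‖ ^ 2)) • fderiv ℝ φ x (basisVec l)) (𝓝[>] 0) (𝓝 0) := by
    set q : Euc n → F := fun x =>
      ((1 / 2 * (‖x‖ ^ 2) ^ ((n : ℝ) / 2 - 1)) • G (‖x‖ ^ 2)) • fderiv ℝ φ x x with hq
    have hφ' : Continuous (fderiv ℝ φ) := hφ.continuous_fderiv (by simp)
    have hq0 : Tendsto q (𝓝[≠] 0) (𝓝 0) := by
      rw [tendsto_zero_iff_norm_tendsto_zero]
      have h1 := ((hG.tendsto_rpow_smul hn).comp hsq).norm
      have h2 : Tendsto (fun x => ‖fderiv ℝ φ x‖) (𝓝[≠] 0) (𝓝 ‖fderiv ℝ φ 0‖) :=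
        hφ'.norm.continuousAt.mono_left nhdsWithin_le_nhds
      have h3 := (h1.mul h2).const_mul (1 / 2)
      simp only [norm_zero, zero_mul, mul_zero] at h3
      refine squeeze_zero' (Eventually.of_forall fun x => norm_nonneg _) ?_ h3
      filter_upwards [self_mem_nhdsWithin] with x hx
      have hx0 : 0 < ‖x‖ := norm_pos_iff.2 hx
      have e3 : (‖x‖ ^ 2) ^ (((n : ℝ) - 1) / 2) = (‖x‖ ^ 2) ^ ((n : ℝ) / 2 - 1) * ‖x‖ := by
        have : ‖x‖ = (‖x‖ ^ 2) ^ (1 / 2 : ℝ) := by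
          rw [← Real.sqrt_eq_rpow, Real.sqrt_sq hx0.le]
        refine Eq.trans ?_ (congrArg ((‖x‖ ^ 2) ^ ((n : ℝ) / 2 - 1) * ·) this.symm)
        rw [← Real.rpow_add (by positivity)]
        congr 1
        ring
      have hp : 0 ≤ (‖x‖ ^ 2) ^ ((n : ℝ) / 2 - 1) := by positivity
      simp only [hq, Function.comp_apply, norm_smul]
      rw [e3, Real.norm_of_nonneg (by positivity), Real.norm_of_nonneg (by positivity)]
      have := (fderiv ℝ φ x).le_opNorm x
      calc 1 / 2 * (‖x‖ ^ 2) ^ ((n : ℝ) / 2 - 1) * ‖G (‖x‖ ^ 2)‖ * ‖fderiv ℝ φ x x‖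
          ≤ 1 / 2 * (‖x‖ ^ 2) ^ ((n : ℝ) / 2 - 1) * ‖G (‖x‖ ^ 2)‖ * (‖fderiv ℝ φ x‖ * ‖x‖) := by
            gcongr
        _ = _ := by ring
    have hint (δ : ℝ) (hδ : 0 < δ) (l : Fin n) : Integrable fun x : Euc n =>
        ((2 * x l) • cutoffDeriv δ (‖x‖ ^ 2) • G (‖x‖ ^ 2)) • fderiv ℝ φ x (basisVec l) := by
      refine integrable_smul_of_hasCompactSupport ?_ (contDiff_fderiv_apply hφ _).continuous
        (hasCompactSupport_fderiv_apply hc _)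
      exact (continuous_const.mul (EuclideanSpace.proj l : Euc n →L[ℝ] ℝ).continuous).smul
        (contDiff_radial (contDiff_cutoffDeriv_smul hδ hG.contDiffOn)).continuous
    have he (δ : ℝ) (hδ : 0 < δ) (x : Euc n) :
        ∑ l, ((2 * x l) • cutoffDeriv δ (‖x‖ ^ 2) • G (‖x‖ ^ 2)) • fderiv ℝ φ x (basisVec l) =
        fluxKernel n δ x • q x := by
      rcases eq_or_ne x 0 with rfl | hx
      · rw [fluxKernel_eq_zero hδ (Or.inl (by simpa using hδ))]
        simp
      · have hs : 0 < ‖x‖ ^ 2 := pow_pos (norm_pos_iff.2 hx) 2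
        have e1 : (‖x‖ ^ 2) ^ (1 - (n : ℝ) / 2) * (‖x‖ ^ 2) ^ ((n : ℝ) / 2 - 1) = 1 := by
          rw [← Real.rpow_add hs]; simp
        have e2 : fderiv ℝ φ x x = ∑ l, x l • fderiv ℝ φ x (basisVec l) := by
          have := congrArg (fderiv ℝ φ x) (sum_smul_basisVec x)
          rw [map_sum] at this
          rw [← this]
          simp only [map_smul]
        rw [hq]
        simp only
        rw [e2, Finset.smul_sum, Finset.smul_sum]
        refine Finset.sum_congr rfl fun l _ => ?_
        rw [smul_comm _ (x l), smul_assoc, smul_assoc, smul_assoc, smul_smul, smul_smul, smul_smul,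
          fluxKernel]
        congr 1
        linear_combination (-2 * x l * cutoffDeriv δ (‖x‖ ^ 2)) * e1
    have := tendsto_integral_fluxKernel hn hq0 fun δ hδ => by
      simp_rw [← he δ hδ]
      exact integrable_finsetSum _ fun l _ => hint δ hδ l
    rw [smul_zero] at this
    refine this.congr' ?_
    filter_upwards [self_mem_nhdsWithin] with δ hδ
    rw [← integral_finsetSum _ fun l _ => hint δ hδ l]
    simp_rw [← he δ hδ]
  have := hT1.sub hT2
  rw [zero_sub, neg_neg] at this
  refine this.congr' ?_
  filter_upwards [self_mem_nhdsWithin] with δ hδ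
  exact (hG.integral_cutoff_smul_helm hδ hφ hc).symm

end IsRadialGreen

end Green
end

noncomputable section

/-! ### Potentials of smooth densities -/

section ConvolutionLap

variable {n : ℕ} {E₁ E₂ F : Type*} [NormedAddCommGroup E₁] [NormedSpace ℝ E₁]
  [NormedAddCommGroup E₂] [NormedSpace ℝ E₂] [NormedAddCommGroup F] [NormedSpace ℝ F]

theorem fderiv_convolution_apply (L : E₁ →L[ℝ] E₂ →L[ℝ] F) {f : Euc n → E₁} {φ : Euc n → E₂}
    (hf : LocallyIntegrable f) (hφ : ContDiff ℝ ∞ φ) (hc : HasCompactSupport φ) (x v : Euc n) :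
    fderiv ℝ (convolution f φ L volume) x v =
      convolution f (fun y => fderiv ℝ φ y v) L volume x := by
  rw [(hc.hasFDerivAt_convolution_right L hf (hφ.of_le (by simp)) x).fderiv]
  exact convolution_precompR_apply L hf (hc.fderiv ℝ) (hφ.continuous_fderiv (by simp)) x v

/-- The Laplacian commutes with convolution with a test function. -/
theorem lap_convolution (L : E₁ →L[ℝ] E₂ →L[ℝ] F) {f : Euc n → E₁} {φ : Euc n → E₂}
    (hf : LocallyIntegrable f) (hφ : ContDiff ℝ ∞ φ) (hc : HasCompactSupport φ) (x : Euc n) :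
    lap (convolution f φ L volume) x = convolution f (lap φ) L volume x := by
  have h1 (l : Fin n) : (fun Y => fderiv ℝ (convolution f φ L volume) Y (basisVec l)) =
      convolution f (fun y => fderiv ℝ φ y (basisVec l)) L volume :=
    funext fun Y => fderiv_convolution_apply L hf hφ hc Y _
  have h2 (l : Fin n) := contDiff_fderiv_apply hφ (basisVec l)
  have h3 (l : Fin n) : HasCompactSupport fun y => fderiv ℝ φ y (basisVec l) :=
    hasCompactSupport_fderiv_apply hc _
  rw [lap]
  simp_rw [h1, fderiv_convolution_apply L hf (h2 _) (h3 _)]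
  simp only [convolution_def]
  rw [← integral_finsetSum]
  · simp only [lap, map_sum]
  · exact fun l _ => (hasCompactSupport_fderiv_apply (h3 l) _).convolutionExists_right L hf
      (contDiff_fderiv_apply (h2 l) _).continuous x

end ConvolutionLap

section Translation

variable {n : ℕ} {F : Type*} [NormedAddCommGroup F] [NormedSpace ℝ F]

theorem fderiv_const_sub_apply {u : Euc n → F} (hu : Differentiable ℝ u) (c t v : Euc n) :
    fderiv ℝ (fun t => u (c - t)) t v = -fderiv ℝ u (c - t) v := by
  have h := (hu (c - t)).hasFDerivAt.comp t ((hasFDerivAt_id t).const_sub c)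
  refine (congrArg (fun A => A v) h.fderiv).trans ?_
  simp

theorem lap_const_sub {u : Euc n → F} (hu : ContDiff ℝ ∞ u) (c t : Euc n) :
    lap (fun t => u (c - t)) t = lap u (c - t) := by
  refine Finset.sum_congr rfl fun l _ => ?_
  simp_rw [fderiv_const_sub_apply (hu.differentiable (by simp))]
  rw [fderiv_fun_neg, neg_apply,
    fderiv_const_sub_apply ((contDiff_fderiv_apply hu _).differentiable (by simp)), neg_neg]

theorem lap_add {u v : Euc n → F} (hu : ContDiff ℝ ∞ u) (hv : ContDiff ℝ ∞ v) (x : Euc n) :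
    lap (fun y => u y + v y) x = lap u x + lap v x := by
  rw [lap, lap, lap, ← Finset.sum_add_distrib]
  refine Finset.sum_congr rfl fun l _ => ?_
  have h1 : (fun Y => fderiv ℝ (fun y => u y + v y) Y (basisVec l)) =
      fun Y => fderiv ℝ u Y (basisVec l) + fderiv ℝ v Y (basisVec l) := by
    funext Y
    rw [fderiv_fun_add (hu.differentiable (by simp) Y) (hv.differentiable (by simp) Y), add_apply]
  rw [h1, fderiv_fun_add ((contDiff_fderiv_apply hu _).differentiable (by simp) x)
    ((contDiff_fderiv_apply hv _).differentiable (by simp) x), add_apply]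

end Translation

theorem hasCompactSupport_comp_const_sub {n : ℕ} {F : Type*} [NormedAddCommGroup F]
    {u : Euc n → F} (hc : HasCompactSupport u) (c : Euc n) :
    HasCompactSupport fun t => u (c - t) :=
  hc.comp_homeomorph (Homeomorph.subLeft c)

section Potential

open Filter Topology

variable {n : ℕ} {F : Type*} [NormedAddCommGroup F] [NormedSpace ℂ F] [NormedSpace ℝ F]

theorem helm_const_sub (k : ℂ) {u : Euc n → F} (hu : ContDiff ℝ ∞ u) (c t : Euc n) :
    helm k (fun t => u (c - t)) t = helm k u (c - t) := by
  rw [helm, helm, lap_const_sub hu]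

theorem helm_add (k : ℂ) {u v : Euc n → F} (hu : ContDiff ℝ ∞ u) (hv : ContDiff ℝ ∞ v)
    (x : Euc n) : helm k (fun y => u y + v y) x = helm k u x + helm k v x := by
  rw [helm, helm, helm, lap_add hu hv, smul_add]
  abel

variable [IsScalarTower ℝ ℂ F] [CompleteSpace F]

namespace IsRadialGreen

variable {k : ℂ} {G G₁ : ℝ → ℂ}

/-- A test function is recovered from its image under the Helmholtz operator. -/
theorem integral_smul_helm_sub (hn : 2 ≤ n) (hG : IsRadialGreen n k G G₁)
    {φ : Euc n → F} (hφ : ContDiff ℝ ∞ φ) (hc : HasCompactSupport φ) (Y : Euc n) :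
    ∫ t : Euc n, G (‖t‖ ^ 2) • helm k φ (Y - t) = φ Y := by
  have hφ' : ContDiff ℝ ∞ fun t => φ (Y - t) := hφ.comp (contDiff_const.sub contDiff_id)
  have h := hG.integral_smul_helm_eq hn hφ' (hasCompactSupport_comp_const_sub hc Y)
  simp_rw [helm_const_sub k hφ] at h
  simpa using h

/-- The potential of a test density is smooth, and solves the inhomogeneous Helmholtz equation. -/
theorem potential_of_test (hn : 2 ≤ n) (hG : IsRadialGreen n k G G₁)
    {η : Euc n → F} (hη : ContDiff ℝ ∞ η) (hc : HasCompactSupport η) :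
    ContDiff ℝ ∞ (fun Y => ∫ X : Euc n, G (‖Y - X‖ ^ 2) • η X) ∧
      ∀ Y, helm k (fun Y => ∫ X : Euc n, G (‖Y - X‖ ^ 2) • η X) Y = η Y := by
  set L : ℂ →L[ℝ] F →L[ℝ] F := ContinuousLinearMap.lsmul ℝ ℂ
  set g : Euc n → ℂ := fun x => G (‖x‖ ^ 2)
  have hg : LocallyIntegrable g := hG.locallyIntegrable hn
  have e : (fun Y => ∫ X : Euc n, G (‖Y - X‖ ^ 2) • η X) = convolution g η L volume := by
    funext Y
    exact (convolution_eq_swap (f := g) (g := η) (x := Y) (μ := volume) L).symm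
  rw [e]
  refine ⟨hc.contDiff_convolution_right L hg hη, fun Y => ?_⟩
  rw [helm, lap_convolution L hg hη hc, ← hG.integral_smul_helm_sub hn hη hc Y]
  simp only [convolution_def, helm, smul_sub, smul_neg]
  have h1 : Integrable fun t => g t • lap η (Y - t) :=
    (hasCompactSupport_lap hc).convolutionExists_right L hg (contDiff_lap hη).continuous Y
  have h2 : Integrable fun t => g t • η (Y - t) :=
    hc.convolutionExists_right L hg hη.continuous Y
  have h3 : Integrable fun t => g t • k ^ 2 • η (Y - t) := by
    simp_rw [smul_comm _ (k ^ 2)]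
    exact h2.smul (k ^ 2)
  have h1n : Integrable fun t => -(g t • lap η (Y - t)) := h1.neg
  rw [integral_sub h1n h3, integral_neg, ← integral_smul]
  simp_rw [smul_comm _ (k ^ 2)]
  rfl

/-- The regular part of the kernel: it agrees with the kernel where `|x|² ≥ 2`, and vanishes near the
origin. -/
def regularPart (n : ℕ) (G : ℝ → ℂ) (x : Euc n) : ℂ := cutoff 1 (‖x‖ ^ 2) • G (‖x‖ ^ 2)

theorem regularPart_eq {x : Euc n} (hx : 2 ≤ ‖x‖) : regularPart n G x = G (‖x‖ ^ 2) := by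
  rw [regularPart, cutoff_eq_one one_pos (by nlinarith), one_smul]

theorem contDiff_regularPart (hG : IsRadialGreen n k G G₁) : ContDiff ℝ ∞ (regularPart n G) :=
  hG.contDiff_regular one_pos

theorem helm_regularPart_eq_zero (hG : IsRadialGreen n k G G₁) {x : Euc n} (hx : 3 / 2 ≤ ‖x‖) :
    helm k (regularPart n G) x = 0 := by
  have hs : 2 * 1 < ‖x‖ ^ 2 := by nlinarith
  have hx0 : (‖x‖ : ℂ) ≠ 0 := by
    have : ‖x‖ ≠ 0 := by linarith
    exact_mod_cast this
  have h1 : regularPart n G =ᶠ[𝓝 x] fun y => G (‖y‖ ^ 2) := by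
    have hc : Tendsto (fun y : Euc n => ‖y‖ ^ 2) (𝓝 x) (𝓝 (‖x‖ ^ 2)) :=
      (continuous_norm.pow 2).continuousAt
    filter_upwards [hc.eventually (lt_mem_nhds hs)] with y hy
    rw [regularPart, cutoff_eq_one one_pos hy.le, one_smul]
  rw [helm_congr k h1, helm, lap_radial (n := n) (H1 := G₁) ?_ (hG.hasDerivAt_deriv _ (by linarith))]
  · simp only [Complex.real_smul, smul_eq_mul]
    push_cast
    field_simp
    ring
  · filter_upwards [lt_mem_nhds (by linarith : (0 : ℝ) < ‖x‖ ^ 2)] with s hs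
    exact hG.hasDerivAt s hs

theorem hasCompactSupport_helm_regularPart (hG : IsRadialGreen n k G G₁) :
    HasCompactSupport (helm k (regularPart n G)) := by
  refine HasCompactSupport.intro (isCompact_closedBall 0 2) fun x hx => ?_
  refine hG.helm_regularPart_eq_zero ?_
  rw [mem_closedBall_zero_iff, not_le] at hx
  linarith

/-- Away from the origin, the kernel is reproduced by convolution with the test function
`(-Δ - k²) S`, where `S` is its regular part. -/
theorem integral_helm_regularPart_smul (hn : 2 ≤ n) (hG : IsRadialGreen n k G G₁) {W : Euc n}
    (hW : 4 ≤ ‖W‖) :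
    ∫ t, helm k (regularPart n G) t • regularPart n G (W - t) = regularPart n G W := by
  set S := regularPart n G with hS
  have hSc : ContDiff ℝ ∞ S := hG.contDiff_regularPart
  let χ : ContDiffBump W := ⟨3, 4, by norm_num, by norm_num⟩
  set φ : Euc n → ℂ := fun x => χ x • S x with hφd
  have hφ : ContDiff ℝ ∞ φ := χ.contDiff.smul hSc
  have hc : HasCompactSupport φ := χ.hasCompactSupport.smul_right
  have hφS {x : Euc n} (hx : ‖W - x‖ ≤ 3) : φ x = S x := by
    rw [hφd]
    simp only
    rw [χ.one_of_mem_closedBall, one_smul]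
    rwa [Metric.mem_closedBall, dist_comm, dist_eq_norm]
  have hφh {t : Euc n} (ht : ‖t‖ < 2) : helm k φ (W - t) = 0 := by
    have h1 : φ =ᶠ[𝓝 (W - t)] S := by
      have : Metric.ball (W - t) 1 ∈ 𝓝 (W - t) := Metric.ball_mem_nhds _ one_pos
      filter_upwards [this] with y hy
      refine hφS ?_
      rw [Metric.mem_ball, dist_comm, dist_eq_norm] at hy
      have : W - y = (W - t - y) + t := by abel
      rw [this]
      exact (norm_add_le _ _).trans (by linarith)
    rw [helm_congr k h1]
    refine hG.helm_regularPart_eq_zero ?_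
    have := norm_sub_norm_le W t
    linarith
  have e1 : ∫ t : Euc n, G (‖t‖ ^ 2) • helm k φ (W - t) = S W := by
    rw [hG.integral_smul_helm_sub hn hφ hc, hφS (by simp)]
  have e2 (t : Euc n) : G (‖t‖ ^ 2) • helm k φ (W - t) = S t • helm k φ (W - t) := by
    rcases lt_or_ge ‖t‖ 2 with ht | ht
    · rw [hφh ht, smul_zero, smul_zero]
    · rw [hS, regularPart_eq ht]
  simp_rw [e2, ← helm_const_sub k hφ] at e1
  have hφ' : ContDiff ℝ ∞ fun t => φ (W - t) := hφ.comp (contDiff_const.sub contDiff_id)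
  rw [← e1, integral_smul_helm k hSc hφ' (hasCompactSupport_comp_const_sub hc W)]
  refine integral_congr_ae (Eventually.of_forall fun t => ?_)
  simp only
  rcases lt_or_ge ‖t‖ 2 with ht | ht
  · rw [hφS]
    rw [sub_sub_cancel]
    linarith
  · rw [hG.helm_regularPart_eq_zero (by linarith), zero_smul, zero_smul]

/-- Away from the origin, the convolution of the kernel with the test function `(-Δ - k²)² S`
vanishes, where `S` is its regular part. -/
theorem integral_helm_helm_regularPart_smul (hn : 2 ≤ n) (hG : IsRadialGreen n k G G₁) {W : Euc n}
    (hW : 4 ≤ ‖W‖) :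
    ∫ t, helm k (helm k (regularPart n G)) t • regularPart n G (W - t) = 0 := by
  set S := regularPart n G with hS
  have hSc : ContDiff ℝ ∞ S := hG.contDiff_regularPart
  have hK : ContDiff ℝ ∞ (helm k S) := contDiff_helm k hSc
  have hKc : HasCompactSupport (helm k S) := hG.hasCompactSupport_helm_regularPart
  have e0 := hG.integral_smul_helm_sub hn hK hKc W
  rw [hG.helm_regularPart_eq_zero (by linarith)] at e0
  rw [← e0, ← integral_sub_left_eq_self _ volume W]
  refine integral_congr_ae (Eventually.of_forall fun t => ?_)
  simp only [sub_sub_cancel]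
  rcases lt_or_ge ‖t‖ 2 with ht | ht
  · have h1 : helm k S =ᶠ[𝓝 (W - t)] fun _ => 0 := by
      have : Metric.ball (W - t) (2 - ‖t‖) ∈ 𝓝 (W - t) := Metric.ball_mem_nhds _ (by linarith)
      filter_upwards [this] with y hy
      refine hG.helm_regularPart_eq_zero ?_
      rw [Metric.mem_ball, dist_comm, dist_eq_norm] at hy
      have h2 := norm_sub_norm_le W t
      have h3 := norm_sub_norm_le (W - t) y
      linarith
    have h2 : helm k (helm k S) (W - t) = 0 := by
      rw [helm_congr k h1]
      simp [helm, lap]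
    rw [h2, zero_smul, smul_zero]
  · rw [hS, regularPart_eq ht, smul_eq_mul, smul_eq_mul, mul_comm]

end IsRadialGreen

/-- The values of the kernel at comparable large distances are comparable: if `r` and `t` are large
and `|r - t| ≤ 3`, then `|G(t²)| ≤ C |G(r²)|`. -/
def HasComparison (G : ℝ → ℂ) : Prop :=
  ∃ R C : ℝ, ∀ r t, R ≤ r → R ≤ t → |r - t| ≤ 3 → ‖G (t ^ 2)‖ ≤ C * ‖G (r ^ 2)‖

namespace IsRadialGreen

variable {k : ℂ} {G G₁ : ℝ → ℂ}

/-- The potential of a density supported far from `X₀` is a smooth solution of the Helmholtz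
equation near `X₀`: there it is the convolution of its restriction to a ball with the test function
`(-Δ - k²) S`, where `S` is the regular part of the kernel. -/
theorem potential_of_far (hn : 2 ≤ n) (hG : IsRadialGreen n k G G₁) {η : Euc n → F}
    (hη : Continuous η) {X₀ : Euc n} {R R' C : ℝ} (hR : R + 3 ≤ R') (hR' : 5 ≤ R')
    (hcomp : ∀ r t, R ≤ r → R ≤ t → |r - t| ≤ 3 → ‖G (t ^ 2)‖ ≤ C * ‖G (r ^ 2)‖)
    (hsupp : ∀ X, ‖X₀ - X‖ < R' → η X = 0)
    (hint : Integrable fun X => regularPart n G (X₀ - X) • η X) :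
    ∃ v : Euc n → F, ContDiff ℝ ∞ v ∧ ∀ Y ∈ Metric.ball X₀ 1,
      ∫ X, regularPart n G (Y - X) • η X = v Y ∧ helm k v Y = 0 := by
  set S := regularPart n G with hS
  have hSc : ContDiff ℝ ∞ S := hG.contDiff_regularPart
  set K := helm k S with hK
  have hKc : ContDiff ℝ ∞ K := contDiff_helm k hSc
  have hKs : HasCompactSupport K := hG.hasCompactSupport_helm_regularPart
  -- domination of the integrand by its value at the centre
  have hdom {Z : Euc n} (hZ : ‖X₀ - Z‖ ≤ 3) (X : Euc n) :
      ‖S (Z - X) • η X‖ ≤ C * ‖S (X₀ - X) • η X‖ := by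
    rcases lt_or_ge ‖X₀ - X‖ R' with h | h
    · rw [hsupp X h]; simp
    · have h1 : ‖X₀ - X‖ - 3 ≤ ‖Z - X‖ := by
        have := norm_sub_norm_le (X₀ - X) (X₀ - Z)
        rw [sub_sub_sub_cancel_left] at this
        linarith
      rw [norm_smul, norm_smul, hS, regularPart_eq (by linarith), regularPart_eq (by linarith),
        ← mul_assoc]
      refine mul_le_mul_of_nonneg_right (hcomp _ _ (by linarith) (by linarith) ?_) (norm_nonneg _)
      refine (abs_norm_sub_norm_le _ _).trans ?_
      rwa [sub_sub_sub_cancel_right]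
  set u : Euc n → F := fun Y => ∫ X, S (Y - X) • η X with hu
  have hum : StronglyMeasurable u := by
    refine StronglyMeasurable.integral_prod_right (f := fun Y X => S (Y - X) • η X) ?_
    refine Continuous.stronglyMeasurable ?_
    exact (hSc.continuous.comp (continuous_fst.sub continuous_snd)).smul (hη.comp continuous_snd)
  set U : Euc n → F := (Metric.closedBall X₀ 3).indicator u with hU
  have hUi : Integrable U := by
    rw [hU, integrable_indicator_iff measurableSet_closedBall]
    refine Measure.integrableOn_of_bounded (M := ∫ X, C * ‖S (X₀ - X) • η X‖)
      measure_closedBall_lt_top.ne hum.aestronglyMeasurable ?_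
    filter_upwards [ae_restrict_mem measurableSet_closedBall] with Z hZ
    refine norm_integral_le_of_norm_le (hint.norm.const_mul C) (Eventually.of_forall fun X => ?_)
    exact hdom (by rwa [Metric.mem_closedBall, dist_comm, dist_eq_norm] at hZ) X
  -- convolutions of `u` with kernels supported in the ball of radius `2`
  have hconv (κ : Euc n → ℂ) (hκ : Continuous κ) (hκc : HasCompactSupport κ)
      (hκs : ∀ t, 2 ≤ ‖t‖ → κ t = 0) (Y : Euc n) (hY : Y ∈ Metric.ball X₀ 1) :
      ∫ t, κ t • U (Y - t) = ∫ X, (∫ t, κ t • S (Y - X - t)) • η X := by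
    rw [Metric.mem_ball, dist_comm, dist_eq_norm] at hY
    have hYt {t : Euc n} (ht : ‖t‖ < 2) : ‖X₀ - (Y - t)‖ ≤ 3 := by
      have : X₀ - (Y - t) = (X₀ - Y) + t := by abel
      rw [this]
      exact (norm_add_le _ _).trans (by linarith)
    have e1 (t : Euc n) : κ t • U (Y - t) = ∫ X, κ t • S (Y - t - X) • η X := by
      rcases lt_or_ge ‖t‖ 2 with ht | ht
      · rw [hU, Set.indicator_of_mem, integral_smul]
        rw [Metric.mem_closedBall, dist_comm, dist_eq_norm]
        exact hYt ht
      · simp [hκs t ht]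
    simp_rw [e1]
    rw [integral_integral_swap]
    · refine integral_congr_ae (Eventually.of_forall fun X => ?_)
      simp only
      rw [← integral_smul_const]
      refine integral_congr_ae (Eventually.of_forall fun t => ?_)
      simp only
      rw [sub_right_comm, smul_eq_mul, mul_smul]
    · have h1 : Integrable (fun z : Euc n × Euc n => ‖κ z.1‖ * (C * ‖S (X₀ - z.2) • η z.2‖))
          (volume.prod volume) :=
        (hκ.integrable_of_hasCompactSupport hκc).norm.mul_prod (hint.norm.const_mul C)
      refine h1.mono' (Continuous.aestronglyMeasurable ?_) (Eventually.of_forall fun z => ?_)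
      · exact (hκ.comp continuous_fst).smul ((hSc.continuous.comp
          ((continuous_const.sub continuous_fst).sub continuous_snd)).smul (hη.comp continuous_snd))
      · obtain ⟨t, X⟩ := z
        simp only [Function.uncurry_apply_pair]
        rcases lt_or_ge ‖t‖ 2 with ht | ht
        · rw [norm_smul]
          exact mul_le_mul_of_nonneg_left (hdom (hYt ht) X) (norm_nonneg _)
        · simp [hκs t ht]
  set L : F →L[ℝ] ℂ →L[ℝ] F := (ContinuousLinearMap.lsmul ℝ ℂ : ℂ →L[ℝ] F →L[ℝ] F).flip
  have hUl : LocallyIntegrable U := hUi.locallyIntegrable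
  have hcv (κ : Euc n → ℂ) (Y : Euc n) :
      convolution U κ L volume Y = ∫ t, κ t • U (Y - t) := convolution_eq_swap L
  have hfar {Y X : Euc n} (hY : Y ∈ Metric.ball X₀ 1) (hX : η X ≠ 0) : 4 ≤ ‖Y - X‖ := by
    rw [Metric.mem_ball, dist_comm, dist_eq_norm] at hY
    have h1 : R' ≤ ‖X₀ - X‖ := by
      by_contra! h
      exact hX (hsupp X h)
    have := norm_sub_norm_le (X₀ - X) (X₀ - Y)
    rw [sub_sub_sub_cancel_left] at this
    linarith
  refine ⟨convolution U K L volume, hKs.contDiff_convolution_right L hUl hKc, fun Y hY => ⟨?_, ?_⟩⟩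
  · rw [hcv, hconv K hKc.continuous hKs (fun t ht => hG.helm_regularPart_eq_zero (by linarith)) Y hY]
    refine integral_congr_ae (Eventually.of_forall fun X => ?_)
    simp only
    by_cases hX : η X = 0
    · simp [hX]
    · rw [hG.integral_helm_regularPart_smul hn (hfar hY hX)]
  · have hKh : helm k (convolution U K L volume) Y = convolution U (helm k K) L volume Y := by
      rw [helm, lap_convolution L hUl hKc hKs, hcv, hcv, hcv, ← integral_smul]
      have h1 : Integrable fun t => lap K t • U (Y - t) :=
        ((hasCompactSupport_lap hKs).convolutionExists_right L hUl
          (contDiff_lap hKc).continuous Y).integrable_swap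
      have h2 : Integrable fun t => K t • U (Y - t) :=
        (hKs.convolutionExists_right L hUl hKc.continuous Y).integrable_swap
      have h1n : Integrable fun t => -(lap K t • U (Y - t)) := h1.neg
      have h2s : Integrable fun t => k ^ 2 • K t • U (Y - t) := h2.smul (k ^ 2)
      rw [← integral_neg, ← integral_sub h1n h2s]
      refine integral_congr_ae (Eventually.of_forall fun t => ?_)
      simp only [helm, sub_smul, neg_smul, smul_eq_mul, mul_smul]
    have hs2 (t : Euc n) (ht : 2 ≤ ‖t‖) : helm k K t = 0 := by
      have h1 : K =ᶠ[𝓝 t] fun _ => 0 := by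
        have : Metric.ball t (1 / 2) ∈ 𝓝 t := Metric.ball_mem_nhds _ (by norm_num)
        filter_upwards [this] with y hy
        refine hG.helm_regularPart_eq_zero ?_
        rw [Metric.mem_ball, dist_comm, dist_eq_norm] at hy
        have := norm_sub_norm_le t y
        linarith
      rw [helm_congr k h1]
      simp [helm, lap]
    rw [hKh, hcv, hconv (helm k K) (contDiff_helm k hKc).continuous (hasCompactSupport_helm k hKs)
      hs2 Y hY]
    refine integral_eq_zero_of_ae (Eventually.of_forall fun X => ?_)
    simp only [Pi.zero_apply]
    by_cases hX : η X = 0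
    · simp [hX]
    · rw [hG.integral_helm_helm_regularPart_smul hn (hfar hY hX), zero_smul]

/-- The potential of a smooth density is smooth and solves the inhomogeneous Helmholtz equation, as
soon as the integral defining it converges everywhere. -/
theorem potential (hn : 2 ≤ n) (hG : IsRadialGreen n k G G₁) (hcomp : HasComparison G)
    {η : Euc n → F} (hη : ContDiff ℝ ∞ η)
    (hint : ∀ Y, Integrable fun X : Euc n => G (‖Y - X‖ ^ 2) • η X) :
    ContDiff ℝ ∞ (fun Y => ∫ X : Euc n, G (‖Y - X‖ ^ 2) • η X) ∧
      ∀ Y, helm k (fun Y => ∫ X : Euc n, G (‖Y - X‖ ^ 2) • η X) Y = η Y := by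
  obtain ⟨R, C, hcomp⟩ := hcomp
  suffices h : ∀ X₀, ContDiffAt ℝ ∞ (fun Y => ∫ X : Euc n, G (‖Y - X‖ ^ 2) • η X) X₀ ∧
      helm k (fun Y => ∫ X : Euc n, G (‖Y - X‖ ^ 2) • η X) X₀ = η X₀ from
    ⟨contDiff_iff_contDiffAt.2 fun X₀ => (h X₀).1, fun X₀ => (h X₀).2⟩
  intro X₀
  set R' := max (R + 3) 5 with hR'
  have hR'0 : 0 < R' := lt_of_lt_of_le (by norm_num) (le_max_right _ _)
  let χ : ContDiffBump X₀ := ⟨R', R' + 1, hR'0, by linarith⟩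
  have hχ : ContDiff ℝ ∞ χ := χ.contDiff
  set η₁ : Euc n → F := fun X => χ X • η X with hη₁
  set η₂ : Euc n → F := fun X => (1 - χ X) • η X with hη₂
  have hη₁c : ContDiff ℝ ∞ η₁ := hχ.smul hη
  have hη₁s : HasCompactSupport η₁ := χ.hasCompactSupport.smul_right
  have hη₂c : ContDiff ℝ ∞ η₂ := (contDiff_const.sub hχ).smul hη
  have hsum (X : Euc n) : η X = η₁ X + η₂ X := by
    simp only [hη₁, hη₂]
    rw [← add_smul, add_sub_cancel, one_smul]
  have hsupp (X : Euc n) (hX : ‖X₀ - X‖ < R') : η₂ X = 0 := by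
    simp only [hη₂]
    rw [χ.one_of_mem_closedBall, sub_self, zero_smul]
    rw [Metric.mem_closedBall, dist_comm, dist_eq_norm]
    exact hX.le
  have h5 : 5 ≤ R' := le_max_right _ _
  have hi₁ (Y : Euc n) : Integrable fun X : Euc n => G (‖Y - X‖ ^ 2) • η₁ X := by
    have h1 := hη₁s.convolutionExists_right (ContinuousLinearMap.lsmul ℝ ℂ : ℂ →L[ℝ] F →L[ℝ] F)
      (hG.locallyIntegrable hn) hη₁c.continuous Y
    exact h1.integrable_swap
  have hi₂ (Y : Euc n) : Integrable fun X : Euc n => G (‖Y - X‖ ^ 2) • η₂ X := by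
    refine ((hint Y).sub (hi₁ Y)).congr (Eventually.of_forall fun X => ?_)
    simp [hsum X]
  have heq {Y : Euc n} (hY : Y ∈ Metric.ball X₀ 1) (X : Euc n) :
      G (‖Y - X‖ ^ 2) • η₂ X = regularPart n G (Y - X) • η₂ X := by
    rcases lt_or_ge ‖X₀ - X‖ R' with h | h
    · rw [hsupp X h]; simp
    · rw [regularPart_eq]
      rw [Metric.mem_ball, dist_comm, dist_eq_norm] at hY
      have := norm_sub_norm_le (X₀ - X) (X₀ - Y)
      rw [sub_sub_sub_cancel_left] at this
      linarith
  obtain ⟨v, hv, hvY⟩ := hG.potential_of_far hn hη₂c.continuous (le_max_left _ _) h5 hcomp hsupp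
    ((hi₂ X₀).congr (Eventually.of_forall (heq (Metric.mem_ball_self one_pos))))
  obtain ⟨hu₁, hu₁'⟩ := hG.potential_of_test hn hη₁c hη₁s
  have hev : (fun Y => ∫ X : Euc n, G (‖Y - X‖ ^ 2) • η X) =ᶠ[𝓝 X₀]
      fun Y => (∫ X : Euc n, G (‖Y - X‖ ^ 2) • η₁ X) + v Y := by
    filter_upwards [Metric.ball_mem_nhds X₀ one_pos] with Y hY
    rw [← (hvY Y hY).1, ← integral_congr_ae (Eventually.of_forall (heq hY)),
      ← integral_add (hi₁ Y) (hi₂ Y)]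
    refine integral_congr_ae (Eventually.of_forall fun X => ?_)
    simp only
    rw [hsum X, smul_add]
  refine ⟨((hu₁.add hv).contDiffAt).congr_of_eventuallyEq hev, ?_⟩
  rw [helm_congr k hev, helm_add k hu₁ hv, hu₁', (hvY X₀ (Metric.mem_ball_self one_pos)).2, add_zero]
  simp only [hη₁]
  rw [χ.one_of_mem_closedBall (Metric.mem_closedBall_self hR'0.le), one_smul]

end IsRadialGreen

end Potential
end

noncomputable section

/-! ### Comparison of the values of a radial solution at infinity -/

section Comparison

open Filter Topology

/-- A differential inequality `h' ≥ c h` forces exponential growth. -/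
theorem exp_mul_le_of_le_deriv {h h' : ℝ → ℝ} {R c : ℝ}
    (hd : ∀ r, R ≤ r → HasDerivAt h (h' r) r) (hc : ∀ r, R ≤ r → c * h r ≤ h' r)
    {r₀ r : ℝ} (h0 : R ≤ r₀) (h1 : r₀ ≤ r) : Real.exp (c * (r - r₀)) * h r₀ ≤ h r := by
  have hd' (x : ℝ) (hx : R ≤ x) : HasDerivAt (fun x => Real.exp (-(c * x)) * h x)
      (Real.exp (-(c * x)) * (h' x - c * h x)) x := by
    have h2 : HasDerivAt (fun x : ℝ => -(c * x)) (-(c * 1)) x := ((hasDerivAt_id x).const_mul c).neg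
    exact (h2.exp.mul (hd x hx)).congr_deriv (by ring)
  have hm : MonotoneOn (fun x => Real.exp (-(c * x)) * h x) (Set.Ici R) := by
    refine monotoneOn_of_hasDerivWithinAt_nonneg (convex_Ici R)
      (f' := fun x => Real.exp (-(c * x)) * (h' x - c * h x)) ?_ ?_ ?_
    · exact fun x hx => (hd' x hx).continuousAt.continuousWithinAt
    · exact fun x hx => (hd' x (interior_subset hx)).hasDerivWithinAt
    · exact fun x hx => mul_nonneg (Real.exp_pos _).le
        (sub_nonneg.2 (hc x (interior_subset hx)))
  have h3 := mul_le_mul_of_nonneg_left (hm h0 (h0.trans h1) h1) (Real.exp_pos (c * r)).le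
  simp only [← mul_assoc, ← Real.exp_add] at h3
  rw [add_neg_cancel, Real.exp_zero, one_mul] at h3
  rwa [mul_sub, sub_eq_add_neg]

/-- A bound on the logarithmic derivative bounds the ratio of nearby values. -/
theorem norm_le_of_norm_deriv_le {f f' : ℝ → ℂ} {R C : ℝ}
    (hd : ∀ r, R ≤ r → HasDerivAt f (f' r) r) (hC : ∀ r, R ≤ r → ‖f' r‖ ≤ C * ‖f r‖)
    {r t : ℝ} (hr : R ≤ r) (ht : R ≤ t) : ‖f t‖ ≤ Real.exp (C * |r - t|) * ‖f r‖ := by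
  have hd2 (x : ℝ) (hx : R ≤ x) : HasDerivAt (fun x => ‖f x‖ ^ 2) (2 * inner ℝ (f x) (f' x)) x :=
    (hd x hx).norm_sq
  have hb (x : ℝ) (hx : R ≤ x) : |inner ℝ (f x) (f' x)| ≤ C * ‖f x‖ ^ 2 := by
    refine (abs_real_inner_le_norm _ _).trans ?_
    calc ‖f x‖ * ‖f' x‖ ≤ ‖f x‖ * (C * ‖f x‖) := by gcongr; exact hC x hx
      _ = C * ‖f x‖ ^ 2 := by ring
  have key : ‖f t‖ ^ 2 ≤ Real.exp (2 * C * |r - t|) * ‖f r‖ ^ 2 := by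
    rcases le_total r t with h | h
    · have h1 := exp_mul_le_of_le_deriv (h := fun x => -‖f x‖ ^ 2)
        (h' := fun x => -(2 * inner ℝ (f x) (f' x))) (c := 2 * C) (fun x hx => (hd2 x hx).neg)
        (fun x hx => by have := (abs_le.1 (hb x hx)).2; linarith) hr h
      rw [abs_sub_comm, abs_of_nonneg (sub_nonneg.2 h)]
      linarith
    · have h1 := exp_mul_le_of_le_deriv (h := fun x => ‖f x‖ ^ 2)
        (h' := fun x => 2 * inner ℝ (f x) (f' x)) (c := -(2 * C)) (fun x hx => hd2 x hx)
        (fun x hx => by have := (abs_le.1 (hb x hx)).1; linarith) ht h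
      rw [abs_of_nonneg (sub_nonneg.2 h)]
      have h2 := mul_le_mul_of_nonneg_left h1 (Real.exp_pos (2 * C * (r - t))).le
      rw [← mul_assoc, ← Real.exp_add] at h2
      simpa using h2
  refine abs_le_of_sq_le_sq' ?_ (by positivity) |>.2
  rw [mul_pow, ← Real.exp_nat_mul]
  refine key.trans (le_of_eq ?_)
  congr 2
  push_cast
  ring

namespace IsRadialGreen

variable {n : ℕ} {k : ℂ} {G G₁ : ℝ → ℂ}

theorem hasDerivAt_sq (hG : IsRadialGreen n k G G₁) {r : ℝ} (hr : 0 < r) :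
    HasDerivAt (fun r : ℝ => G (r ^ 2)) (2 * r * G₁ (r ^ 2)) r := by
  have h1 : HasDerivAt (fun r : ℝ => r ^ 2) (2 * r) r := by simpa using hasDerivAt_pow 2 r
  refine ((hG.hasDerivAt _ (by positivity)).scomp r h1).congr_deriv ?_
  simp

/-- The radial Helmholtz equation `f'' = -((n - 1) / r) f' - k² f`. -/
theorem hasDerivAt_deriv_sq (hG : IsRadialGreen n k G G₁) {r : ℝ} (hr : 0 < r) :
    HasDerivAt (fun r : ℝ => 2 * r * G₁ (r ^ 2))
      (-(((n : ℝ) - 1) / r : ℝ) * (2 * r * G₁ (r ^ 2)) - k ^ 2 * G (r ^ 2)) r := by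
  have h1 : HasDerivAt (fun r : ℝ => r ^ 2) (2 * r) r := by simpa using hasDerivAt_pow 2 r
  have h2 := HasDerivAt.scomp (g₁ := G₁) (h := fun r : ℝ => r ^ 2) r
    (hG.hasDerivAt_deriv _ (by positivity : (0 : ℝ) < r ^ 2)) h1
  have h3 : HasDerivAt (fun r : ℝ => (2 * r : ℂ)) 2 r := by
    simpa using (HasDerivAt.ofReal_comp (hasDerivAt_id r)).const_mul (2 : ℂ)
  refine (h3.mul h2).congr_deriv ?_
  have hr0 : (r : ℂ) ≠ 0 := by exact_mod_cast hr.ne'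
  simp only [Function.comp, Complex.real_smul]
  push_cast
  field_simp
  ring

/-- The kernel has comparable values at infinity if its logarithmic derivative is bounded there. -/
theorem hasComparison_of_deriv_le (hG : IsRadialGreen n k G G₁) {R C : ℝ}
    (hC : ∀ r, R ≤ r → ‖2 * r * G₁ (r ^ 2)‖ ≤ C * ‖G (r ^ 2)‖) : HasComparison G := by
  have hR (r : ℝ) (hr : max R 1 ≤ r) : R ≤ r := (le_max_left _ _).trans hr
  have h0 (r : ℝ) (hr : max R 1 ≤ r) : 0 < r := one_pos.trans_le ((le_max_right _ _).trans hr)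
  refine ⟨max R 1, Real.exp (|C| * 3), fun r t hr ht hrt => ?_⟩
  have hC' (r : ℝ) (hr : max R 1 ≤ r) : ‖2 * r * G₁ (r ^ 2)‖ ≤ |C| * ‖G (r ^ 2)‖ :=
    (hC r (hR r hr)).trans (mul_le_mul_of_nonneg_right (le_abs_self C) (norm_nonneg _))
  refine (norm_le_of_norm_deriv_le (fun r hr => hG.hasDerivAt_sq (h0 r hr)) hC' hr ht).trans ?_
  gcongr

/-- For `Im k > 0`, the solutions are asymptotically exponential. The two combinations
`A = f' - i k f` and `B = f' + i k f` satisfy a perturbed diagonal system, for which the cones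
`|A|² ≥ λ |B|²` are invariant at large distances. -/
theorem hasComparison_of_im_pos (hn : 2 ≤ n) (hG : IsRadialGreen n k G G₁) (hk : 0 < k.im) :
    HasComparison G := by
  set β := k.im with hβ
  have hn1 : (0 : ℝ) < (n : ℝ) - 1 := by
    have : (2 : ℝ) ≤ n := by exact_mod_cast hn
    linarith
  set f : ℝ → ℂ := fun r => G (r ^ 2) with hf
  set f' : ℝ → ℂ := fun r => 2 * r * G₁ (r ^ 2) with hf'
  set ε : ℝ → ℝ := fun r => ((n : ℝ) - 1) / r with hε
  set A : ℝ → ℂ := fun r => f' r - Complex.I * k * f r with hA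
  set B : ℝ → ℂ := fun r => f' r + Complex.I * k * f r with hB
  set R := 8 * ((n : ℝ) - 1) / β with hR
  have hR0 : 0 < R := by positivity
  have hεβ (r : ℝ) (hr : R ≤ r) : 0 ≤ ε r ∧ ε r ≤ β / 8 := by
    have hr0 : 0 < r := hR0.trans_le hr
    refine ⟨by simp only [hε]; positivity, ?_⟩
    rw [hR, div_le_iff₀ hk] at hr
    simp only [hε]
    rw [div_le_iff₀ hr0]
    linarith
  have hdA (r : ℝ) (hr : R ≤ r) :
      HasDerivAt A (-(Complex.I * k) * A r - (ε r / 2 : ℝ) * (A r + B r)) r := by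
    have hr0 : 0 < r := hR0.trans_le hr
    refine ((hG.hasDerivAt_deriv_sq hr0).sub
      ((hG.hasDerivAt_sq hr0).const_mul (Complex.I * k))).congr_deriv ?_
    simp only [hA, hB, hf, hf', hε]
    push_cast
    linear_combination (-(k ^ 2 * G (r ^ 2))) * Complex.I_sq
  have hdB (r : ℝ) (hr : R ≤ r) :
      HasDerivAt B ((Complex.I * k) * B r - (ε r / 2 : ℝ) * (A r + B r)) r := by
    have hr0 : 0 < r := hR0.trans_le hr
    refine ((hG.hasDerivAt_deriv_sq hr0).add
      ((hG.hasDerivAt_sq hr0).const_mul (Complex.I * k))).congr_deriv ?_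
    simp only [hA, hB, hf, hf', hε]
    push_cast
    linear_combination (-(k ^ 2 * G (r ^ 2))) * Complex.I_sq
  have hsq (z : ℂ) : ‖z‖ ^ 2 = z.re * z.re + z.im * z.im := by
    rw [Complex.sq_norm, Complex.normSq_apply]
  have hdA2 (r : ℝ) (hr : R ≤ r) : HasDerivAt (fun r => ‖A r‖ ^ 2)
      (2 * β * ‖A r‖ ^ 2 - ε r * (‖A r‖ ^ 2 + inner ℝ (A r) (B r))) r := by
    refine (hdA r hr).norm_sq.congr_deriv ?_
    simp [Complex.inner, hsq]
    ring
  have hdB2 (r : ℝ) (hr : R ≤ r) : HasDerivAt (fun r => ‖B r‖ ^ 2)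
      (-(2 * β) * ‖B r‖ ^ 2 - ε r * (‖B r‖ ^ 2 + inner ℝ (A r) (B r))) r := by
    refine (hdB r hr).norm_sq.congr_deriv ?_
    simp [Complex.inner, hsq]
    ring
  have hin (r : ℝ) : |inner ℝ (A r) (B r)| ≤ (‖A r‖ ^ 2 + ‖B r‖ ^ 2) / 2 := by
    refine (abs_real_inner_le_norm _ _).trans ?_
    nlinarith [sq_nonneg (‖A r‖ - ‖B r‖)]
  have hgrow {l : ℝ} (hl : 1 / 4 ≤ l) (hl' : l ≤ 4) {r₀ r : ℝ} (h0 : R ≤ r₀) (h1 : r₀ ≤ r) :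
      Real.exp (β * (r - r₀)) * (‖A r₀‖ ^ 2 - l * ‖B r₀‖ ^ 2) ≤ ‖A r‖ ^ 2 - l * ‖B r‖ ^ 2 := by
    refine exp_mul_le_of_le_deriv (fun r hr => (hdA2 r hr).sub ((hdB2 r hr).const_mul l))
      (fun r hr => ?_) h0 h1
    obtain ⟨e0, e1⟩ := hεβ r hr
    have hx := hin r
    set a := ‖A r‖ ^ 2 with ha
    set b := ‖B r‖ ^ 2 with hb
    set x : ℝ := inner ℝ (A r) (B r)
    have ha0 : 0 ≤ a := by positivity
    have hb0 : 0 ≤ b := by positivity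
    have h2 : |(1 - l) * x| ≤ 3 * ((a + b) / 2) := by
      rw [abs_mul]
      exact mul_le_mul (abs_le.2 ⟨by linarith, by linarith⟩) hx (abs_nonneg _) (by norm_num)
    have h3 := (abs_le.1 h2).2
    -- the perturbation is at most `ε (a + 3 (a + b) / 2) ≤ β (a + l b)`
    have h4 : ε r * (a - l * b + (1 - l) * x) ≤ ε r * (5 / 2 * a + 6 * (l * b)) := by
      refine mul_le_mul_of_nonneg_left ?_ e0
      nlinarith
    have h5 : ε r * (5 / 2 * a + 6 * (l * b)) ≤ β / 8 * (5 / 2 * a + 6 * (l * b)) :=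
      mul_le_mul_of_nonneg_right e1 (by positivity)
    have h6 : 0 ≤ β * a := by positivity
    have h7 : 0 ≤ β * (l * b) := by positivity
    change β * (a - l * b) ≤ _
    nlinarith
  have hk0 : 0 < ‖k‖ := norm_pos_iff.2 fun h => by simp [hβ, h] at hk
  have hff (r : ℝ) : 2 * ‖f' r‖ ≤ ‖A r‖ + ‖B r‖ := by
    have h1 : (2 : ℂ) * f' r = A r + B r := by simp only [hA, hB]; ring
    have h2 := norm_add_le (A r) (B r)
    rw [← h1, norm_mul, Complex.norm_two] at h2
    exact h2
  have hfB (r : ℝ) : |‖A r‖ - ‖B r‖| ≤ 2 * ‖k‖ * ‖f r‖ := by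
    have h1 : A r - B r = -(2 * Complex.I * k * f r) := by simp only [hA, hB]; ring
    have h2 := abs_norm_sub_norm_le (A r) (B r)
    rw [h1, norm_neg, norm_mul, norm_mul, norm_mul, Complex.norm_two, Complex.norm_I, mul_one] at h2
    exact h2
  by_cases hcase : ∃ r₁, R ≤ r₁ ∧ 4 * ‖B r₁‖ ^ 2 ≤ ‖A r₁‖ ^ 2
  · obtain ⟨r₁, hr₁, h4⟩ := hcase
    refine hG.hasComparison_of_deriv_le (R := r₁) (C := 3 * ‖k‖) fun r hr => ?_
    have h5 := hgrow (l := 4) (by norm_num) le_rfl hr₁ hr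
    have h6 : 0 ≤ Real.exp (β * (r - r₁)) * (‖A r₁‖ ^ 2 - 4 * ‖B r₁‖ ^ 2) :=
      mul_nonneg (Real.exp_pos _).le (by linarith)
    have h7 : 2 * ‖B r‖ ≤ ‖A r‖ := by
      refine abs_le_of_sq_le_sq' ?_ (norm_nonneg _) |>.2
      nlinarith
    have h8 := hff r
    have h9 := (abs_le.1 (hfB r)).2
    change ‖f' r‖ ≤ _ * ‖f r‖
    linarith
  · push Not at hcase
    have hBanti {r₀ r : ℝ} (h0 : R ≤ r₀) (h1 : r₀ ≤ r) : ‖B r‖ ^ 2 ≤ ‖B r₀‖ ^ 2 := by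
      have := exp_mul_le_of_le_deriv (h := fun r => -‖B r‖ ^ 2) (c := 0)
        (fun r hr => (hdB2 r hr).neg) (fun r hr => ?_) h0 h1
      · simpa using this
      · obtain ⟨e0, e1⟩ := hεβ r hr
        have hx := (abs_le.1 (hin r)).1
        have hc := hcase r hr
        have hb0 : 0 ≤ ‖B r‖ ^ 2 := by positivity
        have h4 : ε r * (-(5 / 2) * ‖B r‖ ^ 2) ≤
            ε r * (‖B r‖ ^ 2 + inner ℝ (A r) (B r)) :=
          mul_le_mul_of_nonneg_left (by linarith) e0
        nlinarith
    refine hG.hasComparison_of_deriv_le (R := R) (C := 3 * ‖k‖) fun r₀ h0 => ?_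
    have h1 : ‖A r₀‖ ^ 2 - 1 / 4 * ‖B r₀‖ ^ 2 ≤ 0 := by
      by_contra! hpos
      -- otherwise this quantity grows exponentially, but it is at most `4 |B(r₀)|²`
      have hub (r : ℝ) (hr : r₀ ≤ r) : Real.exp (β * (r - r₀)) *
          (‖A r₀‖ ^ 2 - 1 / 4 * ‖B r₀‖ ^ 2) ≤ 4 * ‖B r₀‖ ^ 2 := by
        have h2 := hgrow (l := 1 / 4) le_rfl (by norm_num) h0 hr
        have h3 := hBanti h0 hr
        have h4 := hcase r (h0.trans hr)
        have h5 : 0 ≤ ‖B r‖ ^ 2 := by positivity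
        linarith
      have ht : Tendsto (fun r => Real.exp (β * (r - r₀)) *
          (‖A r₀‖ ^ 2 - 1 / 4 * ‖B r₀‖ ^ 2)) atTop atTop := by
        refine Tendsto.atTop_mul_const hpos (Real.tendsto_exp_atTop.comp ?_)
        exact (tendsto_atTop_add_const_right _ _ tendsto_id).const_mul_atTop hk
      obtain ⟨r, hr1, hr2⟩ :=
        ((ht.eventually_gt_atTop (4 * ‖B r₀‖ ^ 2)).and (eventually_ge_atTop r₀)).exists
      exact absurd (hub r hr2) (not_le.2 hr1)
    have h7 : 2 * ‖A r₀‖ ≤ ‖B r₀‖ := by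
      refine abs_le_of_sq_le_sq' ?_ (norm_nonneg _) |>.2
      nlinarith
    have h8 := hff r₀
    have h9 := (abs_le.1 (hfB r₀)).1
    change ‖f' r₀‖ ≤ _ * ‖f r₀‖
    linarith

/-- The Wronskian of an outgoing solution with its conjugate, times `rⁿ⁻¹`, is constant. -/
theorem wronskian_eq {m : ℕ} {κ : ℝ} (hG : IsRadialGreen (m + 1) κ G G₁) {r₀ r : ℝ} (h0 : 0 < r₀)
    (h1 : r₀ ≤ r) :
    r ^ m * (conj (G (r ^ 2)) * (2 * r * G₁ (r ^ 2))).im =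
      r₀ ^ m * (conj (G (r₀ ^ 2)) * (2 * r₀ * G₁ (r₀ ^ 2))).im := by
  have hd (r : ℝ) (hr : r₀ ≤ r) : HasDerivAt
      (fun r : ℝ => r ^ m * (conj (G (r ^ 2)) * (2 * r * G₁ (r ^ 2))).im) 0 r := by
    have hr0 := h0.trans_le hr
    have hp : HasDerivAt (fun r : ℝ => r ^ m) (m / r * r ^ m) r := by
      refine (hasDerivAt_pow m r).congr_deriv ?_
      rcases m with _ | m
      · simp
      · field_simp
        simp [pow_succ]
    have hw := (hG.hasDerivAt_sq hr0).star.mul (hG.hasDerivAt_deriv_sq hr0)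
    have hw' : HasDerivAt (fun r : ℝ => (conj (G (r ^ 2)) * (2 * r * G₁ (r ^ 2))).im) _ r :=
      Complex.imCLM.hasFDerivAt.comp_hasDerivAt r hw
    refine (hp.mul hw').congr_deriv ?_
    simp [pow_two]
    ring
  have a1 := exp_mul_le_of_le_deriv (c := 0) hd (by simp) le_rfl h1
  have a2 := exp_mul_le_of_le_deriv (c := 0) (fun r hr => (hd r hr).neg) (by simp) le_rfl h1
  simp only [zero_mul, Real.exp_zero, one_mul, Pi.neg_apply] at a1 a2
  linarith

/-- The weighted energy of a solution stays bounded at infinity. -/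
theorem exists_energy_le {m : ℕ} {κ : ℝ} (hκ : 0 < κ) (hG : IsRadialGreen (m + 1) κ G G₁) :
    ∃ R M : ℝ, 0 < R ∧ ∀ r, R ≤ r → r ^ m * ‖2 * r * G₁ (r ^ 2)‖ ^ 2 ≤ M := by
  set f : ℝ → ℂ := fun r => G (r ^ 2) with hf
  set f' : ℝ → ℂ := fun r => 2 * r * G₁ (r ^ 2) with hf'
  -- the energy, corrected by a term of lower order so as to vary slowly
  set E : ℝ → ℝ := fun r => r ^ m * (‖f' r‖ ^ 2 + κ ^ 2 * ‖f r‖ ^ 2 +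
    m / r * inner ℝ (f' r) (f r)) with hE
  have hsq (z : ℂ) : ‖z‖ ^ 2 = z.re * z.re + z.im * z.im := by
    rw [Complex.sq_norm, Complex.normSq_apply]
  have hdE (r : ℝ) (hr : 0 < r) :
      HasDerivAt E (-(r ^ m * (m / r ^ 2 * inner ℝ (f' r) (f r)))) r := by
    have hp : HasDerivAt (fun r : ℝ => r ^ m) (m / r * r ^ m) r := by
      refine (hasDerivAt_pow m r).congr_deriv ?_
      rcases m with _ | m
      · simp
      · field_simp
        simp [pow_succ]
    have hi : HasDerivAt (fun r : ℝ => (m : ℝ) / r) (-(m / r ^ 2)) r := by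
      refine ((hasDerivAt_inv hr.ne').const_mul (m : ℝ)).congr_deriv ?_
      field_simp
    have h1 := hG.hasDerivAt_sq hr
    have h2 := hG.hasDerivAt_deriv_sq hr
    refine (hp.mul ((h2.norm_sq.add (h1.norm_sq.const_mul (κ ^ 2))).add
      (hi.mul (h2.inner ℝ h1)))).congr_deriv ?_
    simp only [hsq, Complex.inner, hf, hf']
    simp [pow_two]
    field_simp
    ring
  set R : ℝ := max (m / κ) 1 with hR
  have hR0 : 0 < R := one_pos.trans_le (le_max_right _ _)
  have hx (r : ℝ) : |inner ℝ (f' r) (f r)| * (2 * κ) ≤ ‖f' r‖ ^ 2 + κ ^ 2 * ‖f r‖ ^ 2 := by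
    have h1 := mul_le_mul_of_nonneg_right (abs_real_inner_le_norm (f' r) (f r))
      (by positivity : 0 ≤ 2 * κ)
    nlinarith [sq_nonneg (‖f' r‖ - κ * ‖f r‖)]
  have hEge (r : ℝ) (hr : R ≤ r) : r ^ m * (‖f' r‖ ^ 2 + κ ^ 2 * ‖f r‖ ^ 2) ≤ 2 * E r := by
    have hr0 := hR0.trans_le hr
    have h1 : (m : ℝ) / r ≤ κ := by
      have : m / κ ≤ r := (le_max_left _ _).trans hr
      rw [div_le_iff₀ hκ] at this
      rw [div_le_iff₀ hr0]
      linarith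
    have h2 : |m / r * inner ℝ (f' r) (f r)| ≤ κ * |inner ℝ (f' r) (f r)| := by
      rw [abs_mul, abs_of_nonneg (by positivity : (0 : ℝ) ≤ m / r)]
      exact mul_le_mul_of_nonneg_right h1 (abs_nonneg _)
    have h3 := (abs_le.1 h2).1
    have h4 := hx r
    rw [hE]
    simp only
    rw [← mul_assoc, mul_comm (2 : ℝ), mul_assoc]
    exact mul_le_mul_of_nonneg_left (by linarith) (by positivity)
  have hanti (r : ℝ) (hr : R ≤ r) :
      Real.exp (m / (κ * r)) * E r ≤ Real.exp (m / (κ * R)) * E R := by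
    have hd (r : ℝ) (hr : R ≤ r) : HasDerivAt (fun r => -(Real.exp (m / (κ * r)) * E r))
        (Real.exp (m / (κ * r)) * (m / (κ * r ^ 2) * E r +
          r ^ m * (m / r ^ 2 * inner ℝ (f' r) (f r)))) r := by
      have hr0 := hR0.trans_le hr
      have h1 : HasDerivAt (fun r : ℝ => (m : ℝ) / (κ * r)) (-(m / (κ * r ^ 2))) r := by
        have := ((hasDerivAt_inv hr0.ne').const_mul (m / κ : ℝ))
        refine (this.congr_of_eventuallyEq (Eventually.of_forall fun x => ?_)).congr_deriv ?_
        · simp only; rw [div_mul_eq_div_div, div_eq_mul_inv _ x]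
        · field_simp
      refine (h1.exp.mul (hdE r hr0)).neg.congr_deriv ?_
      ring
    have h2 := exp_mul_le_of_le_deriv (c := 0) hd (fun r hr => ?_) le_rfl hr
    · simp only [zero_mul, Real.exp_zero, one_mul] at h2
      linarith
    · have hr0 := hR0.trans_le hr
      rw [zero_mul]
      refine mul_nonneg (Real.exp_pos _).le ?_
      have h3 := hEge r hr
      have h4 := hx r
      have h5 := (abs_le.1 (le_refl |inner ℝ (f' r) (f r)|)).1
      have h6 : m / (κ * r ^ 2) * E r + r ^ m * (m / r ^ 2 * inner ℝ (f' r) (f r)) =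
          m / (κ * r ^ 2) * (E r + r ^ m * (κ * inner ℝ (f' r) (f r))) := by
        field_simp
      rw [h6]
      refine mul_nonneg (by positivity) ?_
      have h7 : 0 ≤ r ^ m * (‖f' r‖ ^ 2 + κ ^ 2 * ‖f r‖ ^ 2 +
          2 * κ * inner ℝ (f' r) (f r)) := by
        refine mul_nonneg (by positivity) ?_
        nlinarith
      nlinarith
  refine ⟨R, 2 * (Real.exp (m / (κ * R)) * E R), hR0, fun r hr => ?_⟩
  have hr0 := hR0.trans_le hr
  have h1 := hEge r hr
  have h2 := hanti r hr
  have h3 : 1 ≤ Real.exp (m / (κ * r)) := Real.one_le_exp (by positivity)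
  have h4 : 0 ≤ r ^ m * ‖f' r‖ ^ 2 := by positivity
  have h5 : 0 ≤ r ^ m * (κ ^ 2 * ‖f r‖ ^ 2) := by positivity
  change r ^ m * ‖f' r‖ ^ 2 ≤ _
  rw [mul_add] at h1
  nlinarith

/-- For `k > 0`, an outgoing solution and its derivative have comparable sizes at infinity: the
energy bounds the derivative from above, and the Wronskian with the conjugate solution, which does
not vanish, bounds the solution from below. -/
theorem hasComparison_of_pos (hn : 2 ≤ n) {κ : ℝ} (hκ : 0 < κ) (hG : IsRadialGreen n κ G G₁)
    {c M : ℝ} (hc : c ≠ 0) (him : Tendsto (fun s => (G s).im) (𝓝[>] 0) (𝓝 c))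
    (him₁ : ∀ᶠ s in 𝓝[>] 0, |(G₁ s).im| ≤ M) : HasComparison G := by
  obtain ⟨m, rfl⟩ : ∃ m, n = m + 1 := ⟨n - 1, by omega⟩
  set S := ((volume : Measure (Euc (m + 1))).toSphere).real Set.univ with hS
  have hS0 : 0 < S := sphereArea_pos (by omega)
  set W : ℝ → ℝ := fun r => r ^ m * (conj (G (r ^ 2)) * (2 * r * G₁ (r ^ 2))).im with hW
  have hlim : Tendsto (fun s : ℝ => 2 * ((s ^ (((m + 1 : ℕ) : ℝ) / 2) * (G₁ s).im) * (G s).re -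
      (s ^ (((m + 1 : ℕ) : ℝ) / 2) * (G₁ s).re) * (G s).im)) (𝓝[>] 0)
      (𝓝 (2 * (0 - (-(1 / (2 * S))) * c))) := by
    have h1 := (Complex.continuous_re.tendsto _).comp hG.tendsto_flux
    have h2 : Tendsto (fun s : ℝ => (s ^ (1 / 2 : ℝ) * (G₁ s).im) *
        (s ^ ((((m + 1 : ℕ) : ℝ) - 1) / 2) * (G s).re)) (𝓝[>] 0) (𝓝 (0 * 0)) := by
      refine Tendsto.mul ?_ ?_
      · have h3 : Tendsto (fun s : ℝ => s ^ (1 / 2 : ℝ)) (𝓝[>] 0) (𝓝 0) := by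
          have := (Real.continuousAt_rpow_const 0 (1 / 2) (Or.inr (by norm_num))).tendsto
          rw [Real.zero_rpow (by norm_num)] at this
          exact this.mono_left nhdsWithin_le_nhds
        exact h3.zero_mul_isBoundedUnder_le ⟨M, eventually_map.2 (by simpa using him₁)⟩
      · have h3 := (Complex.continuous_re.tendsto _).comp (hG.tendsto_rpow_smul hn)
        simpa [Function.comp_def] using h3
    refine Tendsto.const_mul 2 (Tendsto.sub ?_ (Tendsto.mul ?_ him))
    · rw [mul_zero] at h2
      refine h2.congr' ?_
      filter_upwards [self_mem_nhdsWithin] with s hs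
      have h4 : s ^ (((m + 1 : ℕ) : ℝ) / 2) =
          s ^ (1 / 2 : ℝ) * s ^ ((((m + 1 : ℕ) : ℝ) - 1) / 2) := by
        rw [← Real.rpow_add hs]
        congr 1
        ring
      rw [h4]
      ring
    · rw [← hS] at h1
      simpa [Function.comp_def] using h1
  have hW1 : W 1 = 2 * (0 - (-(1 / (2 * S))) * c) := by
    refine tendsto_nhds_unique ((tendsto_congr' ?_).1 tendsto_const_nhds) hlim
    filter_upwards [Ioo_mem_nhdsGT (zero_lt_one : (0 : ℝ) < 1)] with s hs
    have hs0 : 0 < √s := Real.sqrt_pos.2 hs.1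
    have h1 := hG.wronskian_eq hs0 (Real.sqrt_le_one.2 hs.2.le)
    have h2 : s ^ (((m + 1 : ℕ) : ℝ) / 2) = √s ^ m * √s := by
      rw [← pow_succ, Real.sqrt_eq_rpow, ← Real.rpow_natCast, ← Real.rpow_mul hs.1.le]
      congr 1
      ring
    simp only [hW]
    rw [h1, h2, Real.sq_sqrt hs.1.le]
    simp
    ring
  have hw0 : 0 < |W 1| := by
    rw [hW1, abs_pos]
    have : (2 : ℝ) * (0 - (-(1 / (2 * S))) * c) = c / S := by field_simp; ring
    rw [this]
    exact div_ne_zero hc hS0.ne'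
  obtain ⟨R, M', hR0, hM⟩ := hG.exists_energy_le hκ
  refine hG.hasComparison_of_deriv_le (R := max R 1) (C := M' / |W 1|) fun r hr => ?_
  have hr1 : 1 ≤ r := (le_max_right _ _).trans hr
  have hr0 : 0 < r := one_pos.trans_le hr1
  have h1 : W r = W 1 := hG.wronskian_eq one_pos hr1
  have h2 := hM r ((le_max_left _ _).trans hr)
  set f' := 2 * r * G₁ (r ^ 2)
  have h3 : |W 1| ≤ r ^ m * (‖G (r ^ 2)‖ * ‖f'‖) := by
    rw [← h1, hW]
    simp only
    rw [abs_mul, abs_of_pos (by positivity : 0 < r ^ m)]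
    refine mul_le_mul_of_nonneg_left ((Complex.abs_im_le_norm _).trans ?_) (by positivity)
    rw [norm_mul, RCLike.norm_conj]
  rw [div_mul_eq_mul_div, le_div_iff₀ hw0]
  calc ‖f'‖ * |W 1| ≤ ‖f'‖ * (r ^ m * (‖G (r ^ 2)‖ * ‖f'‖)) := by gcongr
    _ = (r ^ m * ‖f'‖ ^ 2) * ‖G (r ^ 2)‖ := by ring
    _ ≤ M' * ‖G (r ^ 2)‖ := by gcongr

end IsRadialGreen

end Comparison
end

noncomputable section

/-! ### Power series solutions of the radial equation -/

section ExpSeries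

open Filter Topology

/-- The power series with coefficients `c`, as a function of a real variable. -/
def expSeries (c : ℕ → ℂ) (s : ℝ) : ℂ := ∑' j, c j * (s : ℂ) ^ j

/-- Coefficients dominated by those of an exponential `C exp (M s)`. -/
def HasExpBound (c : ℕ → ℂ) : Prop := ∃ C M : ℝ, 0 ≤ M ∧ ∀ j, ‖c j‖ ≤ C * (M ^ j / j.factorial)

theorem HasExpBound.hasSum {c : ℕ → ℂ} (hc : HasExpBound c) (s : ℝ) :
    HasSum (fun j => c j * (s : ℂ) ^ j) (expSeries c s) := by
  obtain ⟨C, M, hM, h⟩ := hc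
  have hg : Summable fun j : ℕ => C * ((M * |s|) ^ j / j.factorial) :=
    (Real.summable_pow_div_factorial _).mul_left C
  have hs : Summable fun j => c j * (s : ℂ) ^ j := by
    refine hg.of_norm_bounded fun j => ?_
    rw [norm_mul, norm_pow, Complex.norm_real, Real.norm_eq_abs, mul_pow]
    calc ‖c j‖ * |s| ^ j ≤ C * (M ^ j / j.factorial) * |s| ^ j := by gcongr; exact h j
      _ = C * (M ^ j * |s| ^ j / j.factorial) := by ring
  exact hs.hasSum

theorem HasExpBound.const_mul {c : ℕ → ℂ} (hc : HasExpBound c) (b : ℂ) :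
    HasExpBound fun j => b * c j := by
  obtain ⟨C, M, hM, h⟩ := hc
  refine ⟨‖b‖ * C, M, hM, fun j => ?_⟩
  rw [norm_mul, mul_assoc]
  gcongr
  exact h j

/-- The coefficients of the derivative. -/
theorem HasExpBound.deriv {c : ℕ → ℂ} (hc : HasExpBound c) :
    HasExpBound fun j => (j + 1) * c (j + 1) := by
  obtain ⟨C, M, hM, h⟩ := hc
  refine ⟨C * M, M, hM, fun j => ?_⟩
  have h1 : ‖((j : ℂ) + 1)‖ = (j : ℝ) + 1 := by
    rw [← Nat.cast_succ, Complex.norm_natCast, Nat.cast_succ]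
  rw [norm_mul, h1]
  calc ((j : ℝ) + 1) * ‖c (j + 1)‖ ≤ (j + 1) * (C * (M ^ (j + 1) / (j + 1).factorial)) := by
        gcongr; exact h _
    _ = C * M * (M ^ j / j.factorial) := by
        rw [Nat.factorial_succ]
        push_cast
        field_simp
        ring

theorem HasExpBound.tail {c : ℕ → ℂ} (hc : HasExpBound c) : HasExpBound fun j => c (j + 1) := by
  obtain ⟨C, M, hM, h⟩ := hc.deriv
  refine ⟨C, M, hM, fun j => le_trans ?_ (h j)⟩
  have h1 : ‖((j : ℂ) + 1)‖ = (j : ℝ) + 1 := by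
    rw [← Nat.cast_succ, Complex.norm_natCast, Nat.cast_succ]
  rw [norm_mul, h1]
  exact le_mul_of_one_le_left (norm_nonneg _) (by simp)

theorem HasExpBound.drop {c : ℕ → ℂ} (hc : HasExpBound c) (m : ℕ) :
    HasExpBound fun j => c (j + m) := by
  induction m with
  | zero => exact hc
  | succ m ih =>
    have h := ih.tail
    simp_rw [Nat.add_right_comm _ 1 m, Nat.add_assoc] at h
    exact h

theorem expSeries_const_mul (c : ℕ → ℂ) (b : ℂ) (s : ℝ) :
    expSeries (fun j => b * c j) s = b * expSeries c s := by
  rw [expSeries, expSeries, ← tsum_mul_left]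
  simp_rw [mul_assoc]

theorem expSeries_zero (c : ℕ → ℂ) : expSeries c 0 = c 0 := by
  rw [expSeries, tsum_eq_single 0]
  · simp
  · intro j hj
    simp [hj]

theorem HasExpBound.eq_sum_add {c : ℕ → ℂ} (hc : HasExpBound c) (m : ℕ) (s : ℝ) :
    expSeries c s = ∑ j ∈ Finset.range m, c j * (s : ℂ) ^ j +
      (s : ℂ) ^ m * expSeries (fun j => c (j + m)) s := by
  rw [expSeries, ← (hc.hasSum s).summable.sum_add_tsum_nat_add m, expSeries, ← tsum_mul_left]
  congr 2
  funext j
  ring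

theorem HasExpBound.eq_add {c : ℕ → ℂ} (hc : HasExpBound c) (s : ℝ) :
    expSeries c s = c 0 + s * expSeries (fun j => c (j + 1)) s := by
  simpa using hc.eq_sum_add 1 s

theorem HasExpBound.hasDerivAt {c : ℕ → ℂ} (hc : HasExpBound c) (s : ℝ) :
    HasDerivAt (expSeries c) (expSeries (fun j => (j + 1) * c (j + 1)) s) s := by
  obtain ⟨C, M, hM, h⟩ := hc.deriv
  have hsum : ∑' j : ℕ, (j : ℂ) * c j * (s : ℂ) ^ (j - 1) =
      expSeries (fun j => (j + 1) * c (j + 1)) s := by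
    rw [tsum_eq_zero_add']
    · simp [expSeries]
    · simpa using (hc.deriv.hasSum s).summable
  rw [← hsum]
  -- the differentiated series is dominated by an exponential series on a bounded interval
  set b := |s| + 1
  set u : ℕ → ℝ := fun j => j.casesOn 0 fun j => C * ((M * b) ^ j / j.factorial)
  have hu : Summable u := by
    rw [← summable_nat_add_iff 1]
    exact (Real.summable_pow_div_factorial _).mul_left C
  refine hasDerivAt_tsum_of_isPreconnected (t := Metric.ball 0 b) (y₀ := 0) (u := u)
    (g := fun j (s : ℝ) => c j * (s : ℂ) ^ j) (g' := fun j (s : ℝ) => (j : ℂ) * c j * (s : ℂ) ^ (j - 1))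
    hu Metric.isOpen_ball (convex_ball _ _).isPreconnected ?_ ?_ (Metric.mem_ball_self (by positivity))
    (hc.hasSum 0).summable (by simp [b])
  · intro j y _
    refine (((hasDerivAt_pow j (y : ℂ)).comp_ofReal).const_mul (c j)).congr_deriv ?_
    ring
  · intro j y hy
    rw [mem_ball_zero_iff, Real.norm_eq_abs] at hy
    rcases j with _ | j
    · simp [u]
    · have h2 := h j
      simp only [u, Nat.cast_succ, Nat.add_sub_cancel]
      rw [norm_mul, norm_pow, Complex.norm_real, Real.norm_eq_abs, mul_pow]
      calc ‖((j : ℂ) + 1) * c (j + 1)‖ * |y| ^ j ≤ C * (M ^ j / j.factorial) * b ^ j := by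
            gcongr
            · exact (norm_nonneg _).trans h2
        _ = C * (M ^ j * b ^ j / j.factorial) := by ring

theorem HasExpBound.tendsto {c : ℕ → ℂ} (hc : HasExpBound c) :
    Tendsto (expSeries c) (𝓝[>] 0) (𝓝 (c 0)) := by
  have h := (hc.hasDerivAt 0).continuousAt.tendsto
  rw [expSeries_zero] at h
  exact h.mono_left nhdsWithin_le_nhds

theorem HasExpBound.im_eq_zero {c : ℕ → ℂ} (hc : HasExpBound c) (h : ∀ j, (c j).im = 0) (s : ℝ) :
    (expSeries c s).im = 0 := by
  refine (Complex.imCLM.hasSum (hc.hasSum s)).unique ?_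
  convert hasSum_zero with j
  have : c j = ((c j).re : ℂ) := Complex.ext rfl (by simp [h j])
  rw [this]
  simp [← Complex.ofReal_pow, ← Complex.ofReal_mul]

/-- The effect of the differential operator `s ∂² + (μ + 1) ∂ + a` on the coefficients. -/
theorem HasExpBound.hasSum_radial {c : ℕ → ℂ} (hc : HasExpBound c) (μ a : ℂ) (s : ℝ) :
    HasSum (fun j : ℕ => ((j + 1) * (j + 1 + μ) * c (j + 1) + a * c j) * (s : ℂ) ^ j)
      (s * expSeries (fun j => (j + 1) * (((j + 1 : ℕ) + 1) * c (j + 1 + 1))) s +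
        (μ + 1) * expSeries (fun j => (j + 1) * c (j + 1)) s + a * expSeries c s) := by
  have h2 : HasSum (fun j : ℕ => (j : ℂ) * ((j + 1) * c (j + 1)) * (s : ℂ) ^ j)
      (s * expSeries (fun j => (j + 1) * (((j + 1 : ℕ) + 1) * c (j + 1 + 1))) s) := by
    rw [← hasSum_nat_add_iff' 1]
    simp only [Finset.range_one, Finset.sum_singleton, Nat.cast_zero, zero_mul, sub_zero]
    refine ((hc.deriv.deriv.hasSum s).mul_left (s : ℂ)).congr_fun fun j => ?_
    push_cast
    ring
  refine ((h2.add ((hc.deriv.hasSum s).mul_left (μ + 1))).add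
    ((hc.hasSum s).mul_left a)).congr_fun fun j => ?_
  ring

end ExpSeries

section RadialSolution

open Filter Topology

/-- `G` solves `s G'' + (μ + 1) G' + a G = 0` for `s > 0`, and `G₁` is its derivative. In the
variable `s = r²` and with `a = k² / 4`, `μ = n / 2 - 1`, this is the radial Helmholtz equation. -/
structure IsRadialSolution (μ a : ℂ) (G G₁ : ℝ → ℂ) : Prop where
  hasDerivAt : ∀ s, 0 < s → HasDerivAt G (G₁ s) s
  hasDerivAt_deriv : ∀ s, 0 < s → HasDerivAt G₁ (-((μ + 1) * G₁ s + a * G s) / s) s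

namespace IsRadialSolution

variable {μ a : ℂ} {G G₁ H H₁ : ℝ → ℂ}

theorem const_mul (h : IsRadialSolution μ a G G₁) (b : ℂ) :
    IsRadialSolution μ a (fun s => b * G s) (fun s => b * G₁ s) where
  hasDerivAt s hs := (h.hasDerivAt s hs).const_mul b
  hasDerivAt_deriv s hs := ((h.hasDerivAt_deriv s hs).const_mul b).congr_deriv (by ring)

theorem add (h : IsRadialSolution μ a G G₁) (h' : IsRadialSolution μ a H H₁) :
    IsRadialSolution μ a (fun s => G s + H s) (fun s => G₁ s + H₁ s) where
  hasDerivAt s hs := (h.hasDerivAt s hs).add (h'.hasDerivAt s hs)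
  hasDerivAt_deriv s hs :=
    ((h.hasDerivAt_deriv s hs).add (h'.hasDerivAt_deriv s hs)).congr_deriv (by ring)

/-- Multiplication by `s^{-ν}` exchanges the exponents `-ν` and `ν` at the origin. -/
theorem rpow_mul {ν : ℝ} (h : IsRadialSolution (-ν) a G G₁) :
    IsRadialSolution ν a (fun s => ((s ^ (-ν) : ℝ) : ℂ) * G s)
      (fun s => ((s ^ (-ν) : ℝ) : ℂ) * (G₁ s - ν * G s / s)) := by
  have hp (s : ℝ) (hs : 0 < s) : HasDerivAt (fun s : ℝ => ((s ^ (-ν) : ℝ) : ℂ))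
      (-ν * ((s ^ (-ν) : ℝ) : ℂ) / s) s := by
    refine (Real.hasDerivAt_rpow_const (Or.inl hs.ne')).ofReal_comp.congr_deriv ?_
    rw [Real.rpow_sub_one hs.ne']
    push_cast
    ring
  refine ⟨fun s hs => ?_, fun s hs => ?_⟩
  · have hs0 : (s : ℂ) ≠ 0 := by exact_mod_cast hs.ne'
    refine ((hp s hs).mul (h.hasDerivAt s hs)).congr_deriv ?_
    field_simp
    ring
  · have hs0 : (s : ℂ) ≠ 0 := by exact_mod_cast hs.ne'
    have h1 : HasDerivAt (fun s : ℝ => (s : ℂ)) 1 s := (hasDerivAt_id s).ofReal_comp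
    refine ((hp s hs).mul ((h.hasDerivAt_deriv s hs).sub
      (((h.hasDerivAt s hs).const_mul (ν : ℂ)).div h1 hs0))).congr_deriv ?_
    simp only [Pi.sub_apply, Pi.div_apply]
    field_simp
    ring

end IsRadialSolution

/-- A two-term recurrence for the coefficients gives a power series solution. -/
theorem HasExpBound.isRadialSolution {c : ℕ → ℂ} (hc : HasExpBound c) {μ a : ℂ}
    (hrec : ∀ j : ℕ, (j + 1) * (j + 1 + μ) * c (j + 1) = -(a * c j)) :
    IsRadialSolution μ a (expSeries c) (expSeries fun j => (j + 1) * c (j + 1)) := by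
  refine ⟨fun s _ => hc.hasDerivAt s, fun s hs => ?_⟩
  refine (hc.deriv.hasDerivAt s).congr_deriv ?_
  have hs0 : (s : ℂ) ≠ 0 := by exact_mod_cast hs.ne'
  have h1 := (hc.hasSum_radial μ a s).unique (hasSum_zero.congr_fun fun j => by
    rw [hrec]; ring)
  rw [eq_div_iff hs0]
  linear_combination h1

/-- The logarithmic solution of Frobenius' method, for an integral exponent `-m`: the power series
solution `U` times a logarithm, minus a power series `w`. -/
theorem HasExpBound.isRadialSolution_log {U w : ℕ → ℂ} (hU : HasExpBound U) (hw : HasExpBound w)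
    {m : ℕ} {a : ℂ} (c₀ : ℂ) (h0 : m * U 0 = 0)
    (hrecU : ∀ j : ℕ, (j + 1) * (j + 1 + -(m : ℂ)) * U (j + 1) = -(a * U j))
    (hrecw : ∀ j : ℕ, (j + 1) * (j + 1 + -(m : ℂ)) * w (j + 1) + a * w j =
      (2 * (j + 1) - m) * U (j + 1)) :
    IsRadialSolution (-(m : ℂ)) a
      (fun s => ((Real.log s : ℝ) + c₀) * expSeries U s - expSeries w s)
      (fun s => expSeries U s / s + ((Real.log s : ℝ) + c₀) *
        expSeries (fun j => (j + 1) * U (j + 1)) s -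
          expSeries (fun j => (j + 1) * w (j + 1)) s) := by
  have hlog (s : ℝ) (hs : 0 < s) :
      HasDerivAt (fun s : ℝ => ((Real.log s : ℝ) : ℂ) + c₀) (s : ℂ)⁻¹ s := by
    have h := (Real.hasDerivAt_log hs.ne').ofReal_comp.add_const c₀
    simpa using h
  refine ⟨fun s hs => ?_, fun s hs => ?_⟩
  · refine (((hlog s hs).mul (hU.hasDerivAt s)).sub (hw.hasDerivAt s)).congr_deriv ?_
    ring
  · have hs0 : (s : ℂ) ≠ 0 := by exact_mod_cast hs.ne'
    have h1 : HasDerivAt (fun s : ℝ => (s : ℂ)) 1 s := (hasDerivAt_id s).ofReal_comp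
    refine ((((hU.hasDerivAt s).div h1 hs0).add ((hlog s hs).mul (hU.deriv.hasDerivAt s))).sub
      (hw.deriv.hasDerivAt s)).congr_deriv ?_
    have e1 := (hU.hasSum_radial (-(m : ℂ)) a s).unique (hasSum_zero.congr_fun fun j => by
      rw [hrecU]; ring)
    have e2 := (hw.hasSum_radial (-(m : ℂ)) a s).unique
      ((((hU.deriv.hasSum s).mul_left 2).sub ((hU.tail.hasSum s).mul_left (m : ℂ))).congr_fun
        fun j => by rw [hrecw]; ring)
    have e3 : (m : ℂ) * expSeries U s = m * (s * expSeries (fun j => U (j + 1)) s) := by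
      rw [hU.eq_add, mul_add, h0, zero_add]
    simp only [← mul_assoc] at e1 e2
    field_simp
    linear_combination ((Real.log s : ℝ) + c₀) * s * e1 - s * e2 - e3

end RadialSolution
end

noncomputable section

/-! ### Bessel series and their logarithmic companions -/

section BesselSeries

open Filter Topology

/-- The Taylor coefficients of `s ↦ ∑ⱼ (-a s)ʲ / (j! Γ(j + μ + 1))`, the entire factor of the Bessel
function `J_μ`. -/
def besselCoeff (μ : ℝ) (a : ℂ) (j : ℕ) : ℂ :=
  (-a) ^ j / j.factorial * (Complex.Gamma (j + μ + 1))⁻¹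

theorem besselCoeff_succ {μ : ℝ} {j : ℕ} (h : (j : ℝ) + 1 + μ ≠ 0) (a : ℂ) :
    (j + 1) * (j + 1 + μ) * besselCoeff μ a (j + 1) = -(a * besselCoeff μ a j) := by
  have h' : (j : ℂ) + 1 + μ ≠ 0 := by exact_mod_cast h
  have hj : (j : ℂ) + 1 ≠ 0 := by exact_mod_cast j.succ_ne_zero
  have hf : (j.factorial : ℂ) ≠ 0 := by exact_mod_cast j.factorial_ne_zero
  have hG : Complex.Gamma ((j + 1 : ℕ) + μ + 1) = (j + 1 + μ) * Complex.Gamma (j + μ + 1) := by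
    push_cast
    rw [Complex.Gamma_add_one _ h']
    congr 2
    ring
  rw [besselCoeff, besselCoeff, hG, Nat.factorial_succ, mul_inv]
  push_cast
  field_simp
  ring

/-- The recurrence bounds the coefficients if `μ` stays away from the negative integers. -/
theorem hasExpBound_besselCoeff {μ : ℝ} (h : ∀ j : ℕ, 1 / 2 ≤ |(j : ℝ) + 1 + μ|) (a : ℂ) :
    HasExpBound (besselCoeff μ a) := by
  refine ⟨‖besselCoeff μ a 0‖, 2 * ‖a‖, by positivity, fun j => ?_⟩
  induction j with
  | zero => simp
  | succ j ih =>
    have h0 : (j : ℝ) + 1 + μ ≠ 0 := fun h1 => by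
      have := h j
      rw [h1] at this
      norm_num at this
    have h1 := congrArg norm (besselCoeff_succ h0 a)
    have h2 : ‖(j : ℂ) + 1‖ = (j : ℝ) + 1 := by
      rw [← Nat.cast_succ, Complex.norm_natCast, Nat.cast_succ]
    have h3 : ‖(j : ℂ) + 1 + μ‖ = |(j : ℝ) + 1 + μ| := by
      rw [← Real.norm_eq_abs, ← Complex.norm_real]
      push_cast
      rfl
    rw [norm_neg, norm_mul, norm_mul, norm_mul, h2, h3] at h1
    have h4 : (j + 1) * (1 / 2) * ‖besselCoeff μ a (j + 1)‖ ≤ ‖a‖ * ‖besselCoeff μ a j‖ := by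
      rw [← h1]
      gcongr
      exact h j
    have h5 : (j + 1) * (1 / 2) * ‖besselCoeff μ a (j + 1)‖ ≤
        ‖a‖ * (‖besselCoeff μ a 0‖ * ((2 * ‖a‖) ^ j / j.factorial)) :=
      h4.trans (mul_le_mul_of_nonneg_left ih (norm_nonneg _))
    have hf : (0 : ℝ) < j.factorial := by exact_mod_cast j.factorial_pos
    rw [Nat.factorial_succ]
    push_cast
    rw [← mul_le_mul_iff_right₀ (by positivity : (0 : ℝ) < (j + 1) * (1 / 2))]
    refine h5.trans (le_of_eq ?_)
    field_simp
    ring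

/-- The coefficients of `s ↦ ∑ᵢ (-1)ⁱ (a s)^{i+m} / (i! (i+m)!)`, indexed by the power of `s`. With
`a s = (z/2)²`, this is `(z/2)^m J_m(z)`. -/
def logU (m : ℕ) (a : ℂ) (j : ℕ) : ℂ :=
  if j < m then 0 else a ^ j * ((-1) ^ (j - m) / ((j - m).factorial * j.factorial))

/-- The coefficients of the power series that accompanies the logarithm in `Y_m`, multiplied by
`(z/2)^m` and indexed by the power of `s`, where `a s = (z/2)²`. The finite and the infinite sum in
`Y_m` become the ranges `j < m` and `j ≥ m` of the index. -/
def logW (m : ℕ) (a : ℂ) (j : ℕ) : ℂ :=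
  if j < m then a ^ j * ((m - 1 - j).factorial / j.factorial)
  else a ^ j * ((-1) ^ (j - m) * ((harmonic (j - m) : ℚ) + (harmonic j : ℚ)) /
    ((j - m).factorial * j.factorial))

theorem logU_of_lt {m j : ℕ} (a : ℂ) (h : j < m) : logU m a j = 0 := if_pos h

theorem logU_add (m i : ℕ) (a : ℂ) :
    logU m a (i + m) = a ^ (i + m) * ((-1) ^ i / (i.factorial * (i + m).factorial)) := by
  rw [logU, if_neg (by omega), Nat.add_sub_cancel]

theorem logW_of_lt {m j : ℕ} (a : ℂ) (h : j < m) :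
    logW m a j = a ^ j * ((m - 1 - j).factorial / j.factorial) := if_pos h

theorem logW_add (m i : ℕ) (a : ℂ) :
    logW m a (i + m) = a ^ (i + m) * ((-1) ^ i * ((harmonic i : ℚ) + (harmonic (i + m) : ℚ)) /
      (i.factorial * (i + m).factorial)) := by
  rw [logW, if_neg (by omega), Nat.add_sub_cancel]

theorem hasExpBound_logU (m : ℕ) (a : ℂ) : HasExpBound (logU m a) := by
  refine ⟨1, ‖a‖, norm_nonneg _, fun j => ?_⟩
  rcases lt_or_ge j m with h | h
  · rw [logU_of_lt a h, norm_zero]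
    positivity
  · obtain ⟨i, rfl⟩ := Nat.exists_eq_add_of_le' h
    rw [logU_add, norm_mul, norm_div, norm_mul, norm_pow, norm_pow, norm_neg, norm_one, one_pow,
      Complex.norm_natCast, Complex.norm_natCast, one_mul, mul_one_div]
    have h1 : (1 : ℝ) ≤ i.factorial := by exact_mod_cast i.factorial_pos
    have h2 : (0 : ℝ) < (i + m).factorial := by exact_mod_cast (i + m).factorial_pos
    gcongr
    exact le_mul_of_one_le_left h2.le h1

theorem norm_harmonic_le (j : ℕ) : ‖((harmonic j : ℚ) : ℂ)‖ ≤ j := by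
  induction j with
  | zero => simp
  | succ j ih =>
    rw [harmonic_succ]
    push_cast
    refine (norm_add_le _ _).trans (add_le_add ih ?_)
    rw [norm_inv, ← Nat.cast_succ, Complex.norm_natCast]
    exact inv_le_one_of_one_le₀ (by simp)

theorem hasExpBound_logW (m : ℕ) (a : ℂ) : HasExpBound (logW m a) := by
  refine ⟨m.factorial + 2, 2 * ‖a‖, by positivity, fun j => ?_⟩
  have hj : (0 : ℝ) < j.factorial := by exact_mod_cast j.factorial_pos
  have h2j : (j : ℝ) ≤ 2 ^ j := by exact_mod_cast (Nat.lt_two_pow_self (n := j)).le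
  have h1j : (1 : ℝ) ≤ 2 ^ j := one_le_pow₀ (by norm_num)
  rcases lt_or_ge j m with h | h
  · rw [logW_of_lt a h, norm_mul, norm_div, norm_pow, Complex.norm_natCast, Complex.norm_natCast,
      mul_pow]
    have h3 : ((m - 1 - j).factorial : ℝ) ≤ m.factorial := by
      exact_mod_cast Nat.factorial_le (by omega)
    have h4 : ((m - 1 - j).factorial : ℝ) ≤ (m.factorial + 2) * 2 ^ j := by
      nlinarith [(Nat.cast_nonneg m.factorial : (0 : ℝ) ≤ m.factorial)]
    calc ‖a‖ ^ j * ((m - 1 - j).factorial / j.factorial)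
        ≤ ‖a‖ ^ j * ((m.factorial + 2) * 2 ^ j / j.factorial) := by gcongr
      _ = (m.factorial + 2) * (2 ^ j * ‖a‖ ^ j / j.factorial) := by ring
  · obtain ⟨i, rfl⟩ := Nat.exists_eq_add_of_le' h
    rw [logW_add, norm_mul, norm_div, norm_mul, norm_mul, norm_pow, norm_pow, norm_neg, norm_one,
      one_pow, Complex.norm_natCast, Complex.norm_natCast, one_mul, mul_pow]
    have h1 : (1 : ℝ) ≤ i.factorial := by exact_mod_cast i.factorial_pos
    have h3 : ‖((harmonic i : ℚ) : ℂ) + ((harmonic (i + m) : ℚ) : ℂ)‖ ≤ 2 * 2 ^ (i + m) := by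
      refine (norm_add_le _ _).trans ?_
      have e1 := norm_harmonic_le i
      have e2 := norm_harmonic_le (i + m)
      have e3 : (i : ℝ) ≤ (i + m : ℕ) := by simp
      linarith
    calc ‖a‖ ^ (i + m) * (‖((harmonic i : ℚ) : ℂ) + ((harmonic (i + m) : ℚ) : ℂ)‖ /
          (i.factorial * (i + m).factorial))
        ≤ ‖a‖ ^ (i + m) * ((m.factorial + 2) * 2 ^ (i + m) / (1 * (i + m).factorial)) := by
          gcongr
          refine h3.trans ?_
          gcongr
          simp
      _ = (m.factorial + 2) * (2 ^ (i + m) * ‖a‖ ^ (i + m) / (i + m).factorial) := by ring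

theorem logU_succ (m : ℕ) (a : ℂ) (j : ℕ) :
    (j + 1) * (j + 1 + -(m : ℂ)) * logU m a (j + 1) = -(a * logU m a j) := by
  rcases lt_trichotomy (j + 1) m with h | h | h
  · rw [logU_of_lt a h, logU_of_lt a (by omega)]
    simp
  · rw [logU_of_lt a (by omega : j < m), ← h]
    simp
  · obtain ⟨i, rfl⟩ := Nat.exists_eq_add_of_le' (by omega : m ≤ j)
    rw [Nat.add_right_comm, logU_add, logU_add, Nat.add_right_comm, Nat.factorial_succ,
      Nat.factorial_succ]
    have h1 : (i : ℂ) + 1 ≠ 0 := by exact_mod_cast i.succ_ne_zero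
    have h2 : (i : ℂ) + m + 1 ≠ 0 := by exact_mod_cast (i + m).succ_ne_zero
    have h3 : (i.factorial : ℂ) ≠ 0 := by exact_mod_cast i.factorial_ne_zero
    have h4 : ((i + m).factorial : ℂ) ≠ 0 := by exact_mod_cast (i + m).factorial_ne_zero
    push_cast
    field_simp
    ring

/-- The recurrence that makes `U log s - w` a solution of the radial equation. -/
theorem logW_succ (m : ℕ) (a : ℂ) (j : ℕ) :
    (j + 1) * (j + 1 + -(m : ℂ)) * logW m a (j + 1) + a * logW m a j =
      (2 * (j + 1) - m) * logU m a (j + 1) := by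
  rcases lt_trichotomy (j + 1) m with h | h | h
  · obtain ⟨t, rfl⟩ := Nat.exists_eq_add_of_lt h
    rw [logU_of_lt a h, logW_of_lt a h, logW_of_lt a (by omega : j < _),
      (by omega : j + 1 + t + 1 - 1 - (j + 1) = t), (by omega : j + 1 + t + 1 - 1 - j = t + 1),
      Nat.factorial_succ, Nat.factorial_succ]
    have h1 : (j : ℂ) + 1 ≠ 0 := by exact_mod_cast j.succ_ne_zero
    have h3 : (j.factorial : ℂ) ≠ 0 := by exact_mod_cast j.factorial_ne_zero
    push_cast
    field_simp
    ring
  · subst h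
    have h1 := logU_add (j + 1) 0 a
    rw [zero_add] at h1
    rw [h1, logW_of_lt a (Nat.lt_succ_self j), (by omega : j + 1 - 1 - j = 0),
      Nat.factorial_succ]
    have h1 : (j : ℂ) + 1 ≠ 0 := by exact_mod_cast j.succ_ne_zero
    have h3 : (j.factorial : ℂ) ≠ 0 := by exact_mod_cast j.factorial_ne_zero
    push_cast
    simp only [Nat.factorial_zero, Nat.cast_one, pow_zero]
    field_simp
    ring
  · obtain ⟨i, rfl⟩ := Nat.exists_eq_add_of_le' (by omega : m ≤ j)
    rw [Nat.add_right_comm, logU_add, logW_add, logW_add, Nat.add_right_comm, Nat.factorial_succ,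
      Nat.factorial_succ, harmonic_succ, harmonic_succ]
    have h1 : (i : ℂ) + 1 ≠ 0 := by exact_mod_cast i.succ_ne_zero
    have h2 : (i : ℂ) + m + 1 ≠ 0 := by exact_mod_cast (i + m).succ_ne_zero
    have h3 : (i.factorial : ℂ) ≠ 0 := by exact_mod_cast i.factorial_ne_zero
    have h4 : ((i + m).factorial : ℂ) ≠ 0 := by exact_mod_cast (i + m).factorial_ne_zero
    push_cast
    field_simp
    ring

/-- The leading coefficients give the strength `m!` of the singularity at the origin. -/
theorem logU_zero_add (m : ℕ) (a : ℂ) : logU m a 0 + m * logW m a 0 = m.factorial := by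
  rcases m with _ | m
  · simp [logU]
  · rw [logU_of_lt a m.succ_pos, logW_of_lt a m.succ_pos, Nat.factorial_succ]
    simp

theorem natCast_mul_logU_zero (m : ℕ) (a : ℂ) : m * logU m a 0 = 0 := by
  rcases m with _ | m
  · simp
  · rw [logU_of_lt a m.succ_pos, mul_zero]

end BesselSeries
end

noncomputable section

/-! ### Radial fundamental solutions -/

section RadialGreen

open Filter Topology

/-- The area `S_n(1) = 2 π^{n/2} / Γ(n/2)`, in the form in which it appears in the flux. -/
theorem one_div_two_mul_sphereArea {n : ℕ} (hn : 2 ≤ n) :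
    1 / (2 * sphereArea n) =
      Real.Gamma ((n : ℝ) / 2 - 1 + 1) / (4 * Real.pi ^ ((n : ℝ) / 2 - 1 + 1)) := by
  have : Nonempty (Fin n) := ⟨⟨0, by omega⟩⟩
  have hn0 : (0 : ℝ) < n := by exact_mod_cast (by omega : 0 < n)
  have hG : 0 < Real.Gamma ((n : ℝ) / 2) := Real.Gamma_pos_of_pos (by positivity)
  have hp : 0 < Real.pi ^ ((n : ℝ) / 2) := Real.rpow_pos_of_pos Real.pi_pos _
  have h1 : (volume : Measure (Euc n)).real (Metric.ball 0 1) =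
      Real.pi ^ ((n : ℝ) / 2) / ((n : ℝ) / 2 * Real.Gamma ((n : ℝ) / 2)) := by
    rw [Measure.real, EuclideanSpace.volume_ball, Fintype.card_fin, ENNReal.ofReal_one, one_pow,
      one_mul, ENNReal.toReal_ofReal, Real.Gamma_add_one (by positivity), Real.sqrt_eq_rpow,
      ← Real.rpow_natCast, ← Real.rpow_mul Real.pi_pos.le, one_div_mul_eq_div]
    exact div_nonneg (by positivity) (Real.Gamma_pos_of_pos (by positivity)).le
  rw [sphereArea_eq, h1, sub_add_cancel]
  field_simp
  norm_num

/-- A radial solution whose flux through small spheres has the right limit is a fundamental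
solution. -/
theorem IsRadialSolution.isRadialGreen {n : ℕ} (hn : 2 ≤ n) {k : ℂ} {G G₁ : ℝ → ℂ}
    {ν : ℝ} (hν : (n : ℝ) / 2 - 1 = ν) (h : IsRadialSolution ν (k ^ 2 / 4) G G₁)
    (hlim : Tendsto (fun s : ℝ => ((s ^ (ν + 1) : ℝ) : ℂ) * G₁ s) (𝓝[>] 0)
      (𝓝 (-(Real.Gamma (ν + 1) / (4 * Real.pi ^ (ν + 1)) : ℝ)))) :
    IsRadialGreen n k G G₁ where
  hasDerivAt := h.hasDerivAt
  hasDerivAt_deriv s hs := by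
    refine (h.hasDerivAt_deriv s hs).congr_deriv ?_
    rw [← hν]
    push_cast
    ring
  tendsto_flux := by
    rw [← hν, ← one_div_two_mul_sphereArea hn, sub_add_cancel] at hlim
    exact hlim

theorem tendsto_ofReal_nhdsGT_zero : Tendsto (fun s : ℝ => (s : ℂ)) (𝓝[>] 0) (𝓝 0) := by
  have := Complex.continuous_ofReal.tendsto 0
  rw [Complex.ofReal_zero] at this
  exact this.mono_left nhdsWithin_le_nhds

theorem tendsto_rpow_nhdsGT_zero {ν : ℝ} (hν : 0 < ν) :
    Tendsto (fun s : ℝ => ((s ^ ν : ℝ) : ℂ)) (𝓝[>] 0) (𝓝 0) := by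
  have h := (Real.continuousAt_rpow_const 0 ν (Or.inr hν.le)).tendsto
  rw [Real.zero_rpow hν.ne'] at h
  have := (Complex.continuous_ofReal.tendsto 0).comp (h.mono_left nhdsWithin_le_nhds :
    Tendsto (fun s : ℝ => s ^ ν) (𝓝[>] 0) (𝓝 0))
  rwa [Complex.ofReal_zero] at this

/-- The comparison at infinity for `k > 0`, when the imaginary part of the kernel extends to a
regular solution that does not vanish at the origin. -/
theorem IsRadialGreen.hasComparison_of_im_eq {n : ℕ} (hn : 2 ≤ n) {κ : ℝ} (hκ : 0 < κ)
    {G G₁ : ℝ → ℂ} (hG : IsRadialGreen n κ G G₁) {c : ℕ → ℂ} (hc : HasExpBound c)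
    (h0 : (c 0).re ≠ 0) (him : ∀ s, 0 < s → (G s).im = (expSeries c s).re) :
    HasComparison G := by
  have hre {c : ℕ → ℂ} (hc : HasExpBound c) :
      Tendsto (fun s => (expSeries c s).re) (𝓝[>] 0) (𝓝 (c 0).re) :=
    (Complex.continuous_re.tendsto _).comp hc.tendsto
  have h1 (s : ℝ) (hs : 0 < s) :
      (G₁ s).im = (expSeries (fun j => (j + 1) * c (j + 1)) s).re := by
    have e1 : HasDerivAt (fun s => (G s).im) (G₁ s).im s :=
      Complex.imCLM.hasFDerivAt.comp_hasDerivAt s (hG.hasDerivAt s hs)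
    have e2 : HasDerivAt (fun s => (expSeries c s).re)
        (expSeries (fun j => (j + 1) * c (j + 1)) s).re s :=
      Complex.reCLM.hasFDerivAt.comp_hasDerivAt s (hc.hasDerivAt s)
    refine e1.unique (e2.congr_of_eventuallyEq ?_)
    filter_upwards [lt_mem_nhds hs] with t ht using him t ht
  obtain ⟨M, hM⟩ := (hre hc.deriv).abs.isBoundedUnder_le
  refine hG.hasComparison_of_pos hn hκ (c := (c 0).re) (M := M) h0 ?_ ?_
  · refine (hre hc).congr' ?_
    filter_upwards [self_mem_nhdsWithin] with s hs using (him s hs).symm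
  · filter_upwards [eventually_map.1 hM, self_mem_nhdsWithin] with s hs hs0
    rw [h1 s hs0]
    exact hs

/-- Both kinds of admissible nonzero wave numbers. -/
theorem im_pos_or_pos {k : ℂ} (hk : k ≠ 0) (h0 : 0 ≤ k.arg) (hπ : k.arg < Real.pi) :
    0 < k.im ∨ ∃ κ : ℝ, 0 < κ ∧ k = κ := by
  have him : 0 ≤ k.im := Complex.arg_nonneg_iff.1 h0
  rcases him.lt_or_eq with h | h
  · exact Or.inl h
  · refine Or.inr ⟨k.re, ?_, Complex.ext rfl (by simp [← h])⟩
    by_contra! hre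
    rcases hre.lt_or_eq with h' | h'
    · exact hπ.ne (Complex.arg_eq_pi_iff.2 ⟨h', h.symm⟩)
    · exact hk (Complex.ext h' h.symm)

/-! ### Odd dimensions -/

/-- The radial outgoing fundamental solution in odd dimension, `ν = n / 2 - 1`, `s = r²`, as a
combination of the two Frobenius solutions at the origin. -/
def oddGreen (ν : ℝ) (k : ℂ) (s : ℝ) : ℂ :=
  Complex.I / 4 * Complex.exp (ν * (2 * Complex.log k - Real.log (4 * Real.pi))) *
      expSeries (besselCoeff ν (k ^ 2 / 4)) s +
    (Real.pi ^ (-ν) / (4 * Real.sin (ν * Real.pi)) : ℝ) *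
      (((s ^ (-ν) : ℝ) : ℂ) * expSeries (besselCoeff (-ν) (k ^ 2 / 4)) s)

/-- Only the Frobenius solution with exponent `-ν` contributes to the flux; for `k > 0` only the regular
one contributes to the imaginary part. -/
theorem exists_isRadialGreen_odd {n : ℕ} (hn : 2 ≤ n) (hodd : Odd n) {k : ℂ} (hk : k ≠ 0)
    (h0 : 0 ≤ k.arg) (hπ : k.arg < Real.pi) :
    (∃ G₁, IsRadialGreen n k (oddGreen ((n : ℝ) / 2 - 1) k) G₁) ∧
      HasComparison (oddGreen ((n : ℝ) / 2 - 1) k) := by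
  obtain ⟨l, rfl⟩ : ∃ l, n = 2 * l + 3 := by
    obtain ⟨m, rfl⟩ := hodd
    exact ⟨m - 1, by omega⟩
  set ν : ℝ := ((2 * l + 3 : ℕ) : ℝ) / 2 - 1 with hνd
  have hν : ν = l + 1 / 2 := by
    rw [hνd]
    push_cast
    ring
  have hν0 : 0 < ν := by rw [hν]; positivity
  have hb1 (j : ℕ) : 1 / 2 ≤ |(j : ℝ) + 1 + ν| := by
    rw [abs_of_pos (by positivity), hν]
    have := (Nat.cast_nonneg j : (0 : ℝ) ≤ j)
    have := (Nat.cast_nonneg l : (0 : ℝ) ≤ l)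
    linarith
  have hb2 (j : ℕ) : 1 / 2 ≤ |(j : ℝ) + 1 + -ν| := by
    rw [hν, le_abs]
    rcases le_or_gt l j with h | h
    · left
      have : (l : ℝ) ≤ j := by exact_mod_cast h
      linarith
    · right
      have : (j : ℝ) + 1 ≤ l := by exact_mod_cast h
      linarith
  have hne {x : ℝ} (h : 1 / 2 ≤ |x|) : x ≠ 0 := by
    rintro rfl
    norm_num at h
  set a := k ^ 2 / 4 with ha
  have hc1 := hasExpBound_besselCoeff hb1 a
  have hc2 := hasExpBound_besselCoeff (μ := -ν) hb2 a
  have s1 := (hc1.isRadialSolution (μ := (ν : ℂ)) (a := a)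
    fun j => besselCoeff_succ (hne (hb1 j)) a).const_mul
      (Complex.I / 4 * Complex.exp (ν * (2 * Complex.log k - Real.log (4 * Real.pi))))
  have s2' : IsRadialSolution (-(ν : ℂ)) a _ _ := hc2.isRadialSolution fun j => by
    have := besselCoeff_succ (μ := -ν) (hne (hb2 j)) a
    push_cast at this
    exact this
  have s2 := s2'.rpow_mul.const_mul (Real.pi ^ (-ν) / (4 * Real.sin (ν * Real.pi)) : ℝ)
  have hsol := s1.add s2
  have hsin : Real.sin (ν * Real.pi) ≠ 0 := by
    intro h
    obtain ⟨z, hz⟩ := Real.sin_eq_zero_iff.1 h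
    have h1 : (z : ℝ) = l + 1 / 2 := by
      rw [← hν]
      exact mul_right_cancel₀ Real.pi_pos.ne' hz
    have h2 : ((2 * z : ℤ) : ℝ) = ((2 * l + 1 : ℤ) : ℝ) := by
      push_cast
      linarith
    have h3 : 2 * z = 2 * (l : ℤ) + 1 := by exact_mod_cast h2
    omega
  obtain ⟨G₁, hgreen⟩ : ∃ G₁, IsRadialGreen (2 * l + 3) k (oddGreen ν k) G₁ := by
    refine ⟨_, IsRadialSolution.isRadialGreen hn hνd.symm hsol ?_⟩
    have hpow : Tendsto (fun s : ℝ => ((s ^ (ν + 1) : ℝ) : ℂ)) (𝓝[>] 0) (𝓝 0) :=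
      tendsto_rpow_nhdsGT_zero (by linarith)
    have t1 := hpow.mul ((hc1.deriv.tendsto).const_mul
      (Complex.I / 4 * Complex.exp (ν * (2 * Complex.log k - Real.log (4 * Real.pi)))))
    have t2 := ((tendsto_ofReal_nhdsGT_zero.mul hc2.deriv.tendsto).sub
      (hc2.tendsto.const_mul (ν : ℂ))).const_mul
        ((Real.pi ^ (-ν) / (4 * Real.sin (ν * Real.pi)) : ℝ) : ℂ)
    have hval : ((Real.pi ^ (-ν) / (4 * Real.sin (ν * Real.pi)) : ℝ) : ℂ) *
        (0 * ((((0 : ℕ) : ℂ) + 1) * besselCoeff (-ν) a (0 + 1)) - ν * besselCoeff (-ν) a 0) =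
        -((Real.Gamma (ν + 1) / (4 * Real.pi ^ (ν + 1)) : ℝ) : ℂ) := by
      have h1 : besselCoeff (-ν) a 0 = (((Real.Gamma (1 - ν))⁻¹ : ℝ) : ℂ) := by
        rw [besselCoeff]
        simp only [pow_zero, Nat.factorial_zero, Nat.cast_one, div_one, one_mul, Nat.cast_zero,
          zero_add]
        rw [Complex.ofReal_inv, ← Complex.Gamma_ofReal]
        congr 2
        push_cast
        ring
      rw [h1, zero_mul, zero_sub, ← Complex.ofReal_mul, ← Complex.ofReal_neg, ← Complex.ofReal_mul,
        ← Complex.ofReal_neg]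
      congr 1
      -- Euler's reflection formula
      have h2 := Real.Gamma_mul_Gamma_one_sub ν
      have hG0 : Real.Gamma (1 - ν) ≠ 0 := by
        intro h
        rw [h, mul_zero, mul_comm Real.pi] at h2
        exact div_ne_zero Real.pi_pos.ne' hsin h2.symm
      rw [mul_comm Real.pi] at h2
      rw [Real.Gamma_add_one hν0.ne', Real.rpow_neg Real.pi_pos.le, Real.rpow_add_one Real.pi_pos.ne']
      have hp : Real.pi ^ ν ≠ 0 := (Real.rpow_pos_of_pos Real.pi_pos ν).ne'
      have hpi := Real.pi_pos.ne'
      field_simp at h2 ⊢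
      linear_combination h2
    have t3 := t1.add t2
    rw [hval, zero_mul, zero_add] at t3
    refine t3.congr' ?_
    filter_upwards [self_mem_nhdsWithin] with s hs
    have hs : 0 < s := hs
    have hs0 : (s : ℂ) ≠ 0 := by exact_mod_cast hs.ne'
    have hpp : ((s ^ (ν + 1) : ℝ) : ℂ) * ((s ^ (-ν) : ℝ) : ℂ) = s := by
      rw [← Complex.ofReal_mul, ← Real.rpow_add hs]
      simp
    simp only [mul_add]
    congr 1
    set B₁ := expSeries (fun j => (j + 1) * besselCoeff (-ν) a (j + 1)) s
    set B := expSeries (besselCoeff (-ν) a) s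
    have hB : (s : ℂ) * (B₁ - ν * B / s) = s * B₁ - ν * B := by field_simp
    rw [← hB]
    linear_combination (-((Real.pi ^ (-ν) / (4 * Real.sin (ν * Real.pi)) : ℝ) : ℂ) *
      (B₁ - ν * B / s)) * hpp
  refine ⟨⟨_, hgreen⟩, ?_⟩
  rcases im_pos_or_pos hk h0 hπ with h | ⟨κ, hκ, rfl⟩
  · exact hgreen.hasComparison_of_im_pos hn h
  · set C : ℝ := Real.exp (ν * (2 * Real.log κ - Real.log (4 * Real.pi))) with hC
    have hC' : Complex.exp (ν * (2 * Complex.log κ - Real.log (4 * Real.pi))) = C := by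
      rw [hC, ← Complex.ofReal_log hκ.le]
      push_cast
      rfl
    have hreal (μ : ℝ) (j : ℕ) : (besselCoeff μ a j).im = 0 := by
      have : besselCoeff μ a j =
          (((-(κ ^ 2 / 4)) ^ j / j.factorial * (Real.Gamma (j + μ + 1))⁻¹ : ℝ) : ℂ) := by
        rw [besselCoeff, ha]
        push_cast
        rw [← Complex.Gamma_ofReal]
        push_cast
        rfl
      rw [this, Complex.ofReal_im]
    refine hgreen.hasComparison_of_im_eq hn hκ (hc1.const_mul (C / 4 : ℝ)) ?_ fun s hs => ?_
    · rw [besselCoeff]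
      simp only [pow_zero, Nat.factorial_zero, Nat.cast_one, div_one, one_mul, Nat.cast_zero,
        zero_add]
      rw [← Complex.ofReal_one, ← Complex.ofReal_add, Complex.Gamma_ofReal, ← Complex.ofReal_inv,
        ← Complex.ofReal_mul, Complex.ofReal_re]
      have := Real.Gamma_pos_of_pos (by linarith : 0 < ν + 1)
      have := Real.exp_pos (ν * (2 * Real.log κ - Real.log (4 * Real.pi)))
      positivity
    · rw [expSeries_const_mul, oddGreen, hC', ← ha]
      have e1 := hc1.im_eq_zero (hreal ν) s
      have e2 := hc2.im_eq_zero (hreal (-ν)) s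
      simp only [Complex.add_im, Complex.im_ofReal_mul, e2, Complex.re_ofReal_mul, mul_zero,
        add_zero]
      simp [Complex.mul_im, e1]
      exact Or.inl (by ring)

/-! ### Even dimensions -/

/-- The radial outgoing fundamental solution in dimension `2 m + 2`, `s = r²`. -/
def evenGreen (m : ℕ) (k : ℂ) (s : ℝ) : ℂ :=
  (-(1 / (4 * Real.pi ^ (m + 1))) : ℝ) * (((s ^ (-(m : ℝ)) : ℝ) : ℂ) *
    (((Real.log s : ℝ) + (2 * Complex.log (k / 2) + 2 * Real.eulerMascheroniConstant -
        Complex.I * Real.pi)) * expSeries (logU m (k ^ 2 / 4)) s -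
      expSeries (logW m (k ^ 2 / 4)) s))

/-- For `k > 0`, the imaginary part of the kernel is the regular solution, which enters with the
constant `-iπ` next to the logarithm. -/
theorem exists_isRadialGreen_even (m : ℕ) {k : ℂ} (hk : k ≠ 0)
    (h0 : 0 ≤ k.arg) (hπ : k.arg < Real.pi) :
    (∃ G₁, IsRadialGreen (2 * m + 2) k (evenGreen m k) G₁) ∧ HasComparison (evenGreen m k) := by
  have hn : 2 ≤ 2 * m + 2 := by omega
  have hν : ((2 * m + 2 : ℕ) : ℝ) / 2 - 1 = m := by
    push_cast
    ring
  set a := k ^ 2 / 4 with ha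
  set c₀ : ℂ := 2 * Complex.log (k / 2) + 2 * Real.eulerMascheroniConstant -
    Complex.I * Real.pi with hc₀
  have hU := hasExpBound_logU m a
  have hW := hasExpBound_logW m a
  have hU0 := natCast_mul_logU_zero m a
  have s1 : IsRadialSolution (-((m : ℝ) : ℂ)) a _ _ :=
    hU.isRadialSolution_log hW c₀ hU0 (logU_succ m a) (logW_succ m a)
  have hsol := s1.rpow_mul.const_mul (-(1 / (4 * Real.pi ^ (m + 1))) : ℝ)
  obtain ⟨G₁, hgreen⟩ : ∃ G₁, IsRadialGreen (2 * m + 2) k (evenGreen m k) G₁ := by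
    refine ⟨_, IsRadialSolution.isRadialGreen hn hν hsol ?_⟩
    have hslog : Tendsto (fun s : ℝ => (s : ℂ) * ((Real.log s : ℝ) + c₀)) (𝓝[>] 0) (𝓝 0) := by
      have h1 : Tendsto (fun s : ℝ => ((s * Real.log s : ℝ) : ℂ)) (𝓝[>] 0)
          (𝓝 ((0 * Real.log 0 : ℝ) : ℂ)) :=
        ((Complex.continuous_ofReal.comp Real.continuous_mul_log).tendsto 0).mono_left
          nhdsWithin_le_nhds
      have h2 : Tendsto (fun s : ℝ => (s : ℂ) * c₀) (𝓝[>] 0) (𝓝 (0 * c₀)) :=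
        tendsto_ofReal_nhdsGT_zero.mul_const c₀
      have h3 := h1.add h2
      simp only [zero_mul, Complex.ofReal_zero, add_zero] at h3
      refine h3.congr fun s => ?_
      push_cast
      ring
    have t1 := (((hU.tendsto.add (hslog.mul hU.deriv.tendsto)).sub
      (tendsto_ofReal_nhdsGT_zero.mul hW.deriv.tendsto)).sub
        (((hslog.mul hU.tail.tendsto).sub hW.tendsto).const_mul (m : ℂ))).const_mul
          ((-(1 / (4 * Real.pi ^ (m + 1))) : ℝ) : ℂ)
    simp only [zero_mul, add_zero, sub_zero, zero_sub, mul_neg, sub_neg_eq_add] at t1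
    rw [logU_zero_add] at t1
    have hval : ((-(1 / (4 * Real.pi ^ (m + 1))) : ℝ) : ℂ) * (m.factorial : ℂ) =
        -((Real.Gamma (m + 1) / (4 * Real.pi ^ ((m : ℝ) + 1)) : ℝ) : ℂ) := by
      rw [Real.Gamma_nat_eq_factorial, ← Nat.cast_add_one, Real.rpow_natCast]
      push_cast
      ring
    rw [hval] at t1
    refine t1.congr' ?_
    filter_upwards [self_mem_nhdsWithin] with s hs
    have hs : 0 < s := hs
    have hs0 : (s : ℂ) ≠ 0 := by exact_mod_cast hs.ne'
    have hpp : ((s ^ ((m : ℝ) + 1) : ℝ) : ℂ) * ((s ^ (-(m : ℝ)) : ℝ) : ℂ) = s := by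
      rw [← Complex.ofReal_mul, ← Real.rpow_add hs]
      simp
    have e3 : (m : ℂ) * expSeries (logU m a) s =
        m * (s * expSeries (fun j => logU m a (j + 1)) s) := by
      rw [hU.eq_add, mul_add, hU0, zero_add]
    generalize expSeries (fun j => logU m a (j + 1)) s = V at *
    generalize expSeries (fun j => (j + 1) * logU m a (j + 1)) s = U₁ at *
    generalize expSeries (fun j => (j + 1) * logW m a (j + 1)) s = W₁ at *
    generalize expSeries (logU m a) s = U at *
    generalize expSeries (logW m a) s = W at *
    have hB : (s : ℂ) * (U / s + ((Real.log s : ℝ) + c₀) * U₁ - W₁ -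
        (m : ℝ) * (((Real.log s : ℝ) + c₀) * U - W) / s) =
        U + s * ((Real.log s : ℝ) + c₀) * U₁ - s * W₁ -
          ((Real.log s : ℝ) + c₀) * (m * U) + m * W := by
      push_cast
      field_simp
      ring
    rw [e3] at hB
    rw [mul_left_comm, ← mul_assoc (((s ^ ((m : ℝ) + 1) : ℝ) : ℂ)), hpp, hB]
    ring
  refine ⟨⟨_, hgreen⟩, ?_⟩
  rcases im_pos_or_pos hk h0 hπ with h | ⟨κ, hκ, rfl⟩
  · exact hgreen.hasComparison_of_im_pos hn h
  · have hdrop := hU.drop m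
    have hUim (j : ℕ) : (logU m a j).im = 0 := by
      rcases lt_or_ge j m with h | h
      · rw [logU_of_lt a h, Complex.zero_im]
      · obtain ⟨i, rfl⟩ := Nat.exists_eq_add_of_le' h
        have : logU m a (i + m) =
            (((κ ^ 2 / 4) ^ (i + m) * ((-1) ^ i / (i.factorial * (i + m).factorial)) : ℝ) : ℂ) := by
          rw [logU_add, ha]
          push_cast
          rfl
        rw [this, Complex.ofReal_im]
    have hWim (j : ℕ) : (logW m a j).im = 0 := by
      rcases lt_or_ge j m with h | h
      · have : logW m a j =
            (((κ ^ 2 / 4) ^ j * ((m - 1 - j).factorial / j.factorial) : ℝ) : ℂ) := by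
          rw [logW_of_lt a h, ha]
          push_cast
          rfl
        rw [this, Complex.ofReal_im]
      · obtain ⟨i, rfl⟩ := Nat.exists_eq_add_of_le' h
        have : logW m a (i + m) = (((κ ^ 2 / 4) ^ (i + m) *
            ((-1) ^ i * ((harmonic i : ℚ) + (harmonic (i + m) : ℚ)) /
              (i.factorial * (i + m).factorial)) : ℝ) : ℂ) := by
          rw [logW_add, ha]
          push_cast
          rfl
        rw [this, Complex.ofReal_im]
    refine hgreen.hasComparison_of_im_eq hn hκ
      (hdrop.const_mul ((1 / (4 * Real.pi ^ m) : ℝ) : ℂ)) ?_ fun s hs => ?_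
    · rw [logU_add, ha]
      have : ((1 / (4 * Real.pi ^ m) : ℝ) : ℂ) * (((κ : ℂ) ^ 2 / 4) ^ (0 + m) *
          ((-1) ^ 0 / ((Nat.factorial 0 : ℕ) * (0 + m).factorial))) =
          ((1 / (4 * Real.pi ^ m) * ((κ ^ 2 / 4) ^ m * (1 / m.factorial)) : ℝ) : ℂ) := by
        simp
      rw [this, Complex.ofReal_re]
      have := Real.pi_pos
      positivity
    · have hc₀im : c₀.im = -Real.pi := by
        have h2 : Complex.log ((κ : ℂ) / 2) = (Real.log (κ / 2) : ℝ) := by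
          rw [Complex.ofReal_log (by positivity)]
          push_cast
          rfl
        rw [hc₀, h2]
        simp
      have e1 := hU.im_eq_zero hUim s
      have e2 := hW.im_eq_zero hWim s
      have e3 := hU.eq_sum_add m s
      rw [Finset.sum_eq_zero fun j hj => by
        rw [logU_of_lt a (Finset.mem_range.1 hj), zero_mul], zero_add] at e3
      have e4 : (expSeries (logU m a) s).re =
          s ^ m * (expSeries (fun j => logU m a (j + m)) s).re := by
        rw [e3, ← Complex.ofReal_pow, Complex.re_ofReal_mul]
      rw [expSeries_const_mul, evenGreen, ← ha, ← hc₀, Complex.im_ofReal_mul, Complex.im_ofReal_mul,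
        Complex.re_ofReal_mul, Complex.sub_im, Complex.mul_im, e1, e2, e4, Complex.add_im, hc₀im,
        Complex.ofReal_im, Real.rpow_neg hs.le, Real.rpow_natCast, pow_succ]
      have := Real.pi_pos
      field_simp
      ring

/-! ### The static case -/

/-- The radial fundamental solution for `k = 0`, `s = r²`. -/
def staticGreen (n : ℕ) (r₀ : ℝ) (s : ℝ) : ℂ :=
  if n = 2 then ((1 / (4 * Real.pi) * (2 * Real.log r₀ - Real.log s) : ℝ) : ℂ)
  else ((1 / (((n : ℝ) - 2) * sphereArea n) * s ^ (-((n : ℝ) / 2 - 1)) : ℝ) : ℂ)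

theorem exists_isRadialGreen_static {n : ℕ} (hn : 2 ≤ n) {r₀ : ℝ} (hr₀ : 0 < r₀) :
    (∃ G₁, IsRadialGreen n 0 (staticGreen n r₀) G₁) ∧ HasComparison (staticGreen n r₀) := by
  have hcomp (r t : ℝ) (hr : 1 ≤ r) (hrt : |r - t| ≤ 3) : t ≤ 4 * r := by
    have := (abs_le.1 hrt).1
    linarith
  rcases hn.lt_or_eq with hn2 | rfl
  · set ν : ℝ := (n : ℝ) / 2 - 1 with hν
    have hn2' : (2 : ℝ) < n := by exact_mod_cast hn2
    have hν0 : 0 < ν := by rw [hν]; linarith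
    have hS := sphereArea_pos hn
    have hst : staticGreen n r₀ = fun s => ((1 / (((n : ℝ) - 2) * sphereArea n) : ℝ) : ℂ) *
        (((s ^ (-ν) : ℝ) : ℂ) * 1) := by
      funext s
      rw [staticGreen, if_neg hn2.ne', Complex.ofReal_mul, mul_one]
    rw [hst]
    have hone : IsRadialSolution (-(ν : ℂ)) ((0 : ℂ) ^ 2 / 4) (fun _ => 1) fun _ => 0 :=
      ⟨fun s _ => hasDerivAt_const s 1, fun s _ => (hasDerivAt_const s 0).congr_deriv (by simp)⟩
    have hsol := hone.rpow_mul.const_mul ((1 / (((n : ℝ) - 2) * sphereArea n) : ℝ) : ℂ)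
    refine ⟨⟨_, hsol.isRadialGreen hn rfl ?_⟩, 1, 16 ^ ν, fun r t hr ht hrt => ?_⟩
    · refine tendsto_const_nhds.congr' ?_
      filter_upwards [self_mem_nhdsWithin] with s hs
      have hs : 0 < s := hs
      have hs0 : (s : ℂ) ≠ 0 := by exact_mod_cast hs.ne'
      have hpp : ((s ^ (ν + 1) : ℝ) : ℂ) * ((s ^ (-ν) : ℝ) : ℂ) = s := by
        rw [← Complex.ofReal_mul, ← Real.rpow_add hs]
        simp
      have hn3 : (n : ℝ) - 2 ≠ 0 := by linarith
      rw [mul_left_comm, ← mul_assoc (((s ^ (ν + 1) : ℝ) : ℂ)), hpp,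
        ← one_div_two_mul_sphereArea hn, zero_sub, mul_one, mul_neg, mul_div_cancel₀ _ hs0,
        mul_neg, ← Complex.ofReal_mul]
      congr 2
      rw [hν]
      field_simp
    · have hr0 : 0 < r := by linarith
      have ht0 : 0 < t := by linarith
      have h4 : r ≤ 4 * t := hcomp t r ht (by rwa [abs_sub_comm])
      have key : (t ^ 2) ^ (-ν) ≤ 16 ^ ν * (r ^ 2) ^ (-ν) := by
        have h1 : (16 * t ^ 2) ^ (-ν) ≤ (r ^ 2) ^ (-ν) :=
          Real.rpow_le_rpow_of_nonpos (by positivity) (by nlinarith) (by linarith)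
        rw [Real.mul_rpow (by norm_num) (by positivity), Real.rpow_neg (by norm_num : (0 : ℝ) ≤ 16),
          inv_mul_le_iff₀ (by positivity)] at h1
        exact h1
      simp only [mul_one, norm_mul, Complex.norm_real]
      rw [Real.norm_of_nonneg (by positivity : 0 ≤ (t ^ 2) ^ (-ν)),
        Real.norm_of_nonneg (by positivity : 0 ≤ (r ^ 2) ^ (-ν)), mul_left_comm]
      exact mul_le_mul_of_nonneg_left key (norm_nonneg _)
  · have hst : staticGreen 2 r₀ = fun s =>
        ((1 / (4 * Real.pi) * (2 * Real.log r₀ - Real.log s) : ℝ) : ℂ) := by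
      funext s
      rw [staticGreen, if_pos rfl]
    rw [hst]
    have hpi := Real.pi_pos
    have hsol : IsRadialSolution (((2 : ℕ) : ℝ) / 2 - 1 : ℝ) ((0 : ℂ) ^ 2 / 4)
        (fun s => ((1 / (4 * Real.pi) * (2 * Real.log r₀ - Real.log s) : ℝ) : ℂ))
        (fun s => ((-(1 / (4 * Real.pi)) * s⁻¹ : ℝ) : ℂ)) := by
      refine ⟨fun s hs => ?_, fun s hs => ?_⟩
      · refine HasDerivAt.ofReal_comp ?_
        refine (((Real.hasDerivAt_log hs.ne').const_sub _).const_mul _).congr_deriv ?_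
        ring
      · refine ((hasDerivAt_inv hs.ne').const_mul (-(1 / (4 * Real.pi)))).ofReal_comp.congr_deriv ?_
        have hs0 : (s : ℂ) ≠ 0 := by exact_mod_cast hs.ne'
        push_cast
        field_simp
        ring
    refine ⟨⟨_, hsol.isRadialGreen hn rfl ?_⟩, max 1 (Real.exp 1 * r₀), 1 + Real.log 4,
      fun r t hr ht hrt => ?_⟩
    · refine tendsto_const_nhds.congr' ?_
      filter_upwards [self_mem_nhdsWithin] with s hs
      have hs : 0 < s := hs
      rw [← Complex.ofReal_mul, ← Complex.ofReal_neg]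
      congr 1
      norm_num
      field_simp
    · have hr1 : 1 ≤ r := (le_max_left _ _).trans hr
      have ht1 : 1 ≤ t := (le_max_left _ _).trans ht
      have hlog {x : ℝ} (hx : max 1 (Real.exp 1 * r₀) ≤ x) : 1 ≤ Real.log x - Real.log r₀ := by
        have h1 := Real.log_le_log (by positivity) ((le_max_right _ _).trans hx)
        rw [Real.log_mul (Real.exp_pos 1).ne' hr₀.ne', Real.log_exp] at h1
        linarith
      have e1 := hlog hr
      have e2 := hlog ht
      have h4 : Real.log t ≤ Real.log 4 + Real.log r := by
        rw [← Real.log_mul (by norm_num) (by linarith)]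
        exact Real.log_le_log (by linarith) (hcomp r t hr1 hrt)
      have hl4 : 0 ≤ Real.log 4 := Real.log_nonneg (by norm_num)
      have hn {x : ℝ} (hx : 1 ≤ Real.log x - Real.log r₀) :
          ‖((1 / (4 * Real.pi) * (2 * Real.log r₀ - Real.log (x ^ 2)) : ℝ) : ℂ)‖ =
            1 / (2 * Real.pi) * (Real.log x - Real.log r₀) := by
        have h5 : 1 / (4 * Real.pi) * (2 * Real.log r₀ - Real.log (x ^ 2)) =
            -(1 / (2 * Real.pi) * (Real.log x - Real.log r₀)) := by
          rw [Real.log_pow]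
          push_cast
          field_simp
          ring
        rw [h5, Complex.norm_real, norm_neg, Real.norm_of_nonneg]
        exact mul_nonneg (by positivity) (by linarith)
      rw [hn e1, hn e2, mul_left_comm]
      exact mul_le_mul_of_nonneg_left (by nlinarith) (by positivity)

end RadialGreen
end

noncomputable section

/-! ### The Hankel functions as radial fundamental solutions -/

section Hankel

open Filter Topology

variable {k : ℂ} {r : ℝ}

theorem log_half_mul (hk : k ≠ 0) (hr : 0 < r) :
    Complex.log (k * r / 2) = Real.log (r / 2) + Complex.log k := by
  have h : k * r / 2 = ((r / 2 : ℝ) : ℂ) * k := by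
    push_cast
    ring
  rw [h, Complex.log_ofReal_mul (by positivity) hk]

theorem log_div_two_pi_mul (hk : k ≠ 0) (hr : 0 < r) :
    Complex.log (k / (2 * Real.pi * r)) = Complex.log k - Real.log (2 * Real.pi * r) := by
  have hpi := Real.pi_pos
  have h : k / (2 * Real.pi * r) = (((2 * Real.pi * r)⁻¹ : ℝ) : ℂ) * k := by
    push_cast
    ring
  rw [h, Complex.log_ofReal_mul (by positivity) hk, Real.log_inv]
  push_cast
  ring

theorem half_mul_ne_zero (hk : k ≠ 0) (hr : 0 < r) : k * r / 2 ≠ 0 := by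
  have : (r : ℂ) ≠ 0 := by exact_mod_cast hr.ne'
  simp [hk, this]

theorem besselJ_eq_expSeries (ν : ℝ) (k : ℂ) (r : ℝ) :
    besselJ ν (k * r) =
      (k * r / 2) ^ (ν : ℂ) * expSeries (besselCoeff ν (k ^ 2 / 4)) (r ^ 2) := by
  rw [besselJ, expSeries]
  congr 1
  refine tsum_congr fun j => ?_
  rw [besselCoeff, pow_mul, neg_pow (k ^ 2 / 4)]
  have h : (k * r / 2) ^ 2 = k ^ 2 / 4 * ((r ^ 2 : ℝ) : ℂ) := by
    push_cast
    ring
  rw [h, mul_pow (k ^ 2 / 4)]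
  ring

/-- In odd dimension, the kernel is the combination of the Frobenius solutions with exponents `0`
and `-ν`, because `cos νπ = 0`. -/
theorem hankel_eq_oddGreen {l : ℕ} {ν : ℝ} (hν : ν = l + 1 / 2) (hk : k ≠ 0) (hr : 0 < r) :
    Complex.I / 4 * (k / (2 * Real.pi * r)) ^ (ν : ℂ) * hankel1 ν (k * r) =
      oddGreen ν k (r ^ 2) := by
  have hpi := Real.pi_pos
  have hz := half_mul_ne_zero hk hr
  have hq : k / (2 * Real.pi * r) ≠ 0 := by
    have h1 : (r : ℂ) ≠ 0 := by exact_mod_cast hr.ne'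
    have h2 : (Real.pi : ℂ) ≠ 0 := by exact_mod_cast hpi.ne'
    simp [hk, h1, h2]
  have hfloor : ¬((⌊ν⌋ : ℝ) = ν) := by
    intro h
    have h1 : ((2 * ⌊ν⌋ : ℤ) : ℝ) = ((2 * l + 1 : ℤ) : ℝ) := by
      push_cast
      rw [h, hν]
      ring
    have h2 : 2 * ⌊ν⌋ = 2 * (l : ℤ) + 1 := by exact_mod_cast h1
    omega
  have hcos : Real.cos (ν * Real.pi) = 0 := by
    rw [Real.cos_eq_zero_iff]
    refine ⟨l, ?_⟩
    rw [hν]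
    push_cast
    ring
  have e1 : (k / (2 * Real.pi * r)) ^ (ν : ℂ) * (k * r / 2) ^ (ν : ℂ) =
      Complex.exp (ν * (2 * Complex.log k - Real.log (4 * Real.pi))) := by
    rw [Complex.cpow_def_of_ne_zero hq, Complex.cpow_def_of_ne_zero hz, ← Complex.exp_add,
      log_half_mul hk hr, log_div_two_pi_mul hk hr]
    have h : Real.log (2 * Real.pi * r) = Real.log (r / 2) + Real.log (4 * Real.pi) := by
      rw [← Real.log_mul (by positivity) (by positivity)]
      congr 1
      ring
    rw [h]
    congr 1
    push_cast
    ring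
  have e2 : (k / (2 * Real.pi * r)) ^ (ν : ℂ) * (k * r / 2) ^ ((-ν : ℝ) : ℂ) =
      ((Real.pi ^ (-ν) : ℝ) : ℂ) * (((r ^ 2) ^ (-ν) : ℝ) : ℂ) := by
    rw [Complex.cpow_def_of_ne_zero hq, Complex.cpow_def_of_ne_zero hz, ← Complex.exp_add,
      log_half_mul hk hr, log_div_two_pi_mul hk hr, ← Complex.ofReal_mul,
      ← Real.mul_rpow hpi.le (by positivity), Real.rpow_def_of_pos (by positivity)]
    have h : Real.log (Real.pi * r ^ 2) = Real.log (2 * Real.pi * r) + Real.log (r / 2) := by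
      rw [← Real.log_mul (by positivity) (by positivity)]
      congr 1
      ring
    rw [h]
    push_cast
    congr 1
    ring
  rw [hankel1, besselY, if_neg hfloor, hcos, besselJ_eq_expSeries, besselJ_eq_expSeries, oddGreen,
    ← e1]
  generalize expSeries (besselCoeff ν (k ^ 2 / 4)) (r ^ 2) = A
  generalize expSeries (besselCoeff (-ν) (k ^ 2 / 4)) (r ^ 2) = B
  have e3 : ((Real.pi ^ (-ν) / (4 * Real.sin (ν * Real.pi)) : ℝ) : ℂ) *
      ((((r ^ 2) ^ (-ν) : ℝ) : ℂ) * B) =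
      (k / (2 * Real.pi * r)) ^ (ν : ℂ) * (k * r / 2) ^ ((-ν : ℝ) : ℂ) * B /
        (4 * (Real.sin (ν * Real.pi) : ℝ)) := by
    rw [e2]
    push_cast
    ring
  rw [e3]
  generalize (k / (2 * Real.pi * r)) ^ (ν : ℂ) = P
  generalize (k * r / 2) ^ (ν : ℂ) = Q
  generalize (k * r / 2) ^ ((-ν : ℝ) : ℂ) = R
  simp only [Complex.ofReal_zero, mul_zero, zero_sub]
  linear_combination (-(P * R * B / (4 * (Real.sin (ν * Real.pi) : ℝ)))) * Complex.I_sq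

/-- The series `U` of the even-dimensional kernel is `(z/2)^m J_m(z)`, `z = k r`. -/
theorem expSeries_logU (m : ℕ) (hk : k ≠ 0) (hr : 0 < r) :
    expSeries (logU m (k ^ 2 / 4)) (r ^ 2) = (k * r / 2) ^ m * besselJ m (k * r) := by
  have h : (k * r / 2) ^ 2 = k ^ 2 / 4 * ((r ^ 2 : ℝ) : ℂ) := by
    push_cast
    ring
  have hz := half_mul_ne_zero hk hr
  rw [(hasExpBound_logU m _).eq_sum_add m, Finset.sum_eq_zero fun j hj => by
    rw [logU_of_lt _ (Finset.mem_range.1 hj), zero_mul], zero_add, besselJ, expSeries,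
    ← tsum_mul_left, ← mul_assoc, ← tsum_mul_left]
  refine tsum_congr fun j => ?_
  have hG : Complex.Gamma (j + ((m : ℝ) : ℂ) + 1) = (j + m).factorial := by
    rw [← Complex.Gamma_nat_eq_factorial]
    push_cast
    rfl
  have hc : (k * r / 2) ^ (((m : ℝ) : ℂ)) = (k * r / 2) ^ m := by
    rw [Complex.ofReal_natCast, Complex.cpow_natCast]
  rw [logU_add, hG, hc, pow_mul, h, ← pow_two, ← pow_mul, mul_comm m 2, pow_mul, h, mul_pow,
    mul_pow, pow_add]
  ring

/-- The series `w` of the even-dimensional kernel collects the two sums in the definition of `Y_m`. -/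
theorem expSeries_logW (m : ℕ) (hk : k ≠ 0) (hr : 0 < r) :
    expSeries (logW m (k ^ 2 / 4)) (r ^ 2) = (k * r / 2) ^ m *
      (∑ j ∈ Finset.range m, ((m - 1 - j).factorial : ℂ) / (j.factorial : ℂ) *
          (k * r / 2) ^ (2 * (j : ℤ) - (m : ℤ)) +
        ∑' j : ℕ, (-1) ^ j * (((harmonic j : ℚ) : ℂ) + ((harmonic (j + m) : ℚ) : ℂ)) /
          ((j.factorial : ℂ) * ((j + m).factorial : ℂ)) * (k * r / 2) ^ (2 * j + m)) := by
  have h : (k * r / 2) ^ 2 = k ^ 2 / 4 * ((r ^ 2 : ℝ) : ℂ) := by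
    push_cast
    ring
  have hz := half_mul_ne_zero hk hr
  rw [(hasExpBound_logW m _).eq_sum_add m, mul_add, expSeries, Finset.mul_sum, ← tsum_mul_left,
    ← tsum_mul_left]
  congr 1
  · refine Finset.sum_congr rfl fun j hj => ?_
    have h1 : (k * r / 2) ^ (2 * (j : ℤ) - (m : ℤ)) = (k * r / 2) ^ (2 * j) / (k * r / 2) ^ m := by
      rw [zpow_sub₀ hz, zpow_natCast]
      norm_cast
    rw [logW_of_lt _ (Finset.mem_range.1 hj), h1, pow_mul, h, mul_pow]
    field_simp
  · refine tsum_congr fun j => ?_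
    have h1 : (k * r / 2) ^ m * (k * r / 2) ^ (2 * j + m) =
        (k ^ 2 / 4 * ((r ^ 2 : ℝ) : ℂ)) ^ (j + m) := by
      rw [← h, ← pow_mul, ← pow_add]
      congr 1
      ring
    rw [logW_add, mul_left_comm ((k * r / 2) ^ m), h1, mul_pow]
    ring

/-- In even dimension, the kernel is the logarithmic Frobenius solution. -/
theorem hankel_eq_evenGreen (m : ℕ) (hk : k ≠ 0) (hr : 0 < r) :
    Complex.I / 4 * (k / (2 * Real.pi * r)) ^ (((m : ℝ) : ℂ)) * hankel1 m (k * r) =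
      evenGreen m k (r ^ 2) := by
  have hpi := Real.pi_pos
  have hpi0 : (Real.pi : ℂ) ≠ 0 := by exact_mod_cast hpi.ne'
  have hr0 : (r : ℂ) ≠ 0 := by exact_mod_cast hr.ne'
  have hz := half_mul_ne_zero hk hr
  have hlog : 2 * Complex.log (k * r / 2) =
      (Real.log (r ^ 2) : ℝ) + 2 * Complex.log (k / 2) := by
    have h1 : k * r / 2 = (r : ℂ) * (k / 2) := by ring
    rw [h1, Complex.log_ofReal_mul hr (by simp [hk]), Real.log_pow]
    push_cast
    ring
  rw [evenGreen, hankel1, besselY, if_pos (by simp), if_pos (by positivity), one_mul,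
    Int.floor_natCast, Int.natAbs_natCast, besselYNat, expSeries_logU m hk hr,
    expSeries_logW m hk hr, Complex.ofReal_natCast, Complex.cpow_natCast, Real.rpow_neg (by positivity),
    Real.rpow_natCast]
  set J := besselJ m (k * r)
  generalize (∑ j ∈ Finset.range m, ((m - 1 - j).factorial : ℂ) / (j.factorial : ℂ) *
          (k * r / 2) ^ (2 * (j : ℤ) - (m : ℤ))) = W₁
  generalize (∑' j : ℕ, (-1) ^ j * (((harmonic j : ℚ) : ℂ) + ((harmonic (j + m) : ℚ) : ℂ)) /
          ((j.factorial : ℂ) * ((j + m).factorial : ℂ)) * (k * r / 2) ^ (2 * j + m)) = W₂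
  have hpow : (k / (2 * Real.pi * r)) ^ m =
      ((Real.pi : ℂ) ^ m)⁻¹ * (((r ^ 2) ^ m)⁻¹ : ℝ) * (k * r / 2) ^ m := by
    push_cast
    rw [← inv_pow, ← inv_pow, ← mul_pow, ← mul_pow]
    congr 1
    field_simp
  rw [hpow]
  push_cast at hlog ⊢
  have hlog' : Complex.log (k * r / 2) =
      (((Real.log (r ^ 2) : ℝ) : ℂ) + 2 * Complex.log (k / 2)) / 2 := by
    rw [← hlog]
    ring
  generalize ((Real.log (r ^ 2) : ℝ) : ℂ) = ℓ at *
  rw [hlog']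
  generalize Complex.log (k / 2) = L at *
  field_simp
  linear_combination (Real.pi * Real.pi ^ m *
    (J * (ℓ + 2 * L + 2 * Real.eulerMascheroniConstant) - W₁ - W₂)) * Complex.I_sq

theorem static_eq_staticGreen {n : ℕ} {r₀ : ℝ} (hr₀ : 0 < r₀) (hr : 0 < r) :
    (if n = 2 then ((1 / (2 * Real.pi) * Real.log (r₀ / r) : ℝ) : ℂ)
    else ((1 / (((n : ℝ) - 2) * ((volume : Measure (Euc n)).toSphere).real Set.univ) *
      r ^ (2 - (n : ℤ)) : ℝ) : ℂ)) = staticGreen n r₀ (r ^ 2) := by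
  rw [staticGreen]
  split_ifs with h
  · congr 1
    rw [Real.log_div hr₀.ne' hr.ne', Real.log_pow]
    push_cast
    field_simp
    ring
  · congr 2
    rw [← Real.rpow_natCast r 2, ← Real.rpow_mul hr.le, ← Real.rpow_intCast]
    congr 1
    push_cast
    ring

/-- The kernel of the Green operator is a radial fundamental solution with comparable values at
infinity. -/
theorem exists_scalarGreen_eq {n : ℕ} (hn : 2 ≤ n) {k : ℂ}
    (hk : k = 0 ∨ (k ≠ 0 ∧ 0 ≤ k.arg ∧ k.arg < Real.pi)) {r₀ : ℝ} (hr₀ : 0 < r₀) :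
    ∃ G G₁ : ℝ → ℂ, IsRadialGreen n k G G₁ ∧ HasComparison G ∧
      ∀ X X' : Euc n, X ≠ X' → scalarGreen n k r₀ X X' = G (‖X' - X‖ ^ 2) := by
  have hd {X X' : Euc n} : ‖X' - X‖ = dist X X' := by rw [dist_comm, dist_eq_norm]
  rcases hk with rfl | ⟨hk, h0, hπ⟩
  · obtain ⟨⟨G₁, hG⟩, hc⟩ := exists_isRadialGreen_static hn hr₀
    refine ⟨_, G₁, hG, hc, fun X X' h => ?_⟩
    rw [scalarGreen, if_pos rfl, hd, static_eq_staticGreen hr₀ (dist_pos.2 h)]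
  · rcases Nat.even_or_odd n with he | ho
    · obtain ⟨m, rfl⟩ : ∃ m, n = 2 * m + 2 := by
        obtain ⟨m, rfl⟩ := he
        exact ⟨m - 1, by omega⟩
      obtain ⟨⟨G₁, hG⟩, hc⟩ := exists_isRadialGreen_even m hk h0 hπ
      refine ⟨_, G₁, hG, hc, fun X X' h => ?_⟩
      have hν : ((2 * m + 2 : ℕ) : ℝ) / 2 - 1 = m := by
        push_cast
        ring
      rw [scalarGreen, if_neg hk, hd, hν, hankel_eq_evenGreen m hk (dist_pos.2 h)]
    · obtain ⟨⟨G₁, hG⟩, hc⟩ := exists_isRadialGreen_odd hn ho hk h0 hπ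
      refine ⟨_, G₁, hG, hc, fun X X' h => ?_⟩
      obtain ⟨l, hl⟩ : ∃ l, n = 2 * l + 3 := by
        obtain ⟨m, rfl⟩ := ho
        exact ⟨m - 1, by omega⟩
      have hν : (n : ℝ) / 2 - 1 = l + 1 / 2 := by
        rw [hl]
        push_cast
        ring
      rw [scalarGreen, if_neg hk, hd, hankel_eq_oddGreen hν hk (dist_pos.2 h)]

end Hankel
end

noncomputable section

/-! ### The Green operator on forms -/

section Green

open Filter Topology

variable {n p : ℕ} {k : ℂ} {r₀ : ℝ} {G G₁ : ℝ → ℂ}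

/-- Pairing with the Green kernel is multiplication by the scalar kernel. -/
theorem doubleInner_greenKernel (α : Cov n p) (X X' : Euc n) :
    doubleInner α (greenKernel n p k r₀ X X') = scalarGreen n k r₀ X X' • α := by
  rw [greenKernel, kernelExtension, identityDouble, doubleInner_riesz, Complex.conj_conj]

theorem ae_doubleInner_greenKernel (hn : 2 ≤ n)
    (hG : ∀ X X' : Euc n, X ≠ X' → scalarGreen n k r₀ X X' = G (‖X' - X‖ ^ 2))
    (η : PForm n p) (X' : Euc n) :
    (fun X => doubleInner (η X) (greenKernel n p k r₀ X X')) =ᵐ[volume]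
      fun X => G (‖X' - X‖ ^ 2) • η X := by
  have : Nonempty (Fin n) := ⟨⟨0, by omega⟩⟩
  filter_upwards [Measure.ae_ne volume X'] with X hX
  rw [doubleInner_greenKernel, hG X X' hX]

theorem greenOperator_eq (hn : 2 ≤ n)
    (hG : ∀ X X' : Euc n, X ≠ X' → scalarGreen n k r₀ X X' = G (‖X' - X‖ ^ 2))
    (η : PForm n p) :
    greenOperator k r₀ η = fun X' => ∫ X, G (‖X' - X‖ ^ 2) • η X :=
  funext fun X' => integral_congr_ae (ae_doubleInner_greenKernel hn hG η X')

theorem l2DoubleExists_greenKernel_iff (hn : 2 ≤ n)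
    (hG : ∀ X X' : Euc n, X ≠ X' → scalarGreen n k r₀ X X' = G (‖X' - X‖ ^ 2))
    (η : PForm n p) :
    L2DoubleExists η (greenKernel n p k r₀) ↔
      ∀ X', Integrable fun X => G (‖X' - X‖ ^ 2) • η X :=
  forall_congr' fun X' => integrable_congr (ae_doubleInner_greenKernel hn hG η X')

theorem IsRadialGreen.locallyIntegrable_sub (hn : 2 ≤ n) (hG : IsRadialGreen n k G G₁)
    (X' : Euc n) : LocallyIntegrable fun X : Euc n => G (‖X' - X‖ ^ 2) := by
  have h := hG.locallyIntegrable hn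
  rw [← (Measure.measurePreserving_sub_left volume X').map_eq] at h
  exact (locallyIntegrable_map_homeomorph (Homeomorph.subLeft X')).1 h

end Green
end

theorem mainTheorem10 (n p : ℕ) (hn : 2 ≤ n) (hp : p ≤ n) (k : ℂ)
    (hk : k = 0 ∨ (k ≠ 0 ∧ 0 ≤ k.arg ∧ k.arg < Real.pi)) (r₀ : ℝ) (hr₀ : 0 < r₀) :
    ((∀ η : PForm n p, IsTestForm η → L2DoubleExists η (greenKernel n p k r₀)) ∧
      (∀ η : PForm n p, ContDiff ℝ ∞ η → L2DoubleExists η (greenKernel n p k r₀) →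
        ContDiff ℝ ∞ (greenOperator k r₀ η) ∧
          helmholtz k (greenOperator k r₀ η) = η)) ∧
    ((∀ (X' : Euc n) (v : Fin p → Euc n), LocallyIntegrable fun X => greenKernel n p k r₀ X X' v) ∧
      (∀ φ : PForm n p, IsTestForm φ →
        distribHelmholtz (conj k) (greenKernel n p k r₀) φ =
          diracDouble (identityDouble n p) φ)) := by
  obtain ⟨G, G₁, hG, hcomp, hGe⟩ := exists_scalarGreen_eq hn hk hr₀
  have hloc := hG.locallyIntegrable_sub hn
  refine ⟨⟨fun η hη => ?_, fun η hη hint => ?_⟩, fun X' v => ?_, fun φ hφ => ?_⟩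
  · rw [l2DoubleExists_greenKernel_iff hn hGe]
    exact fun X' => (hloc X').integrable_smul_right_of_hasCompactSupport hη.1.continuous hη.2
  · rw [l2DoubleExists_greenKernel_iff hn hGe] at hint
    rw [greenOperator_eq hn hGe]
    obtain ⟨h1, h2⟩ := hG.potential hn hcomp hη hint
    refine ⟨h1, ?_⟩
    rw [helmholtz_eq k _ h1]
    exact funext h2
  · have : Nonempty (Fin n) := ⟨⟨0, by omega⟩⟩
    have hmeas : AEStronglyMeasurable (fun X => conj (G (‖X' - X‖ ^ 2)) • riesz n p v) volume :=
      (Complex.continuous_conj.comp_aestronglyMeasurable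
        (hloc X').aestronglyMeasurable).smul_const _
    have h1 : LocallyIntegrable fun X => conj (G (‖X' - X‖ ^ 2)) • riesz n p v := by
      refine ((hloc X').smul ‖riesz n p v‖).mono hmeas (Filter.Eventually.of_forall fun X => ?_)
      rw [norm_smul, RCLike.norm_conj, Pi.smul_apply, norm_smul, norm_norm, mul_comm]
    refine h1.congr ?_
    filter_upwards [Measure.ae_ne volume X'] with X hX
    rw [← hGe X X' hX]
    rfl
  · rw [distribHelmholtz, Complex.conj_conj]
    change greenOperator k r₀ (helmholtz k φ) = _
    rw [greenOperator_eq hn hGe, helmholtz_eq k φ hφ.1]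
    funext X'
    have h1 := hG.integral_smul_helm_sub hn hφ.1 hφ.2 X'
    rw [← integral_sub_left_eq_self _ volume X'] at h1
    simp only [sub_sub_cancel] at h1
    refine h1.trans ?_
    have h2 := doubleInner_riesz 1 (φ X')
    rw [map_one, one_smul, one_smul] at h2
    exact h2.symm
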